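/- **Setting.** Let $H:\mathbb R\to\mathbb R$ be smooth and even with $H(0)=1$, $H(\pm1)=0$, $H>0$ on $(-1,1)$, $H<1$ on $[-1,1]\setminus\{0\}$, $H''(0)<0$ and $H''(1)>0$. Put $\Xi=[-1,1]$, $k=\frac1\pi\sqrt{|H''(0)|H''(1)}$, $\kappa=1/k$, $\mathrm S=[-\kappa,\kappa]$. For $\varepsilon>0$ put $$Z_\varepsilon=\int_{-1}^1 e^{-H/\varepsilon}\,d\xi,\quad g_\varepsilon=Z_\varepsilon^{-1}e^{-H/\varepsilon},\quad \gamma_\varepsilon=g_\varepsilon\mathscr L^1|_\Xi,\quad \tau_\varepsilon=\frac1{2\kappa}\int_{-1}^1\frac{d\xi}{g_\varepsilon},\quad \hat s_\varepsilon(\xi)=\int_0^\xi\frac{d\eta}{\tau_\varepsilon g_\varepsilon(\eta)},$$ let $\hat\xi_\varepsilon:\mathrm S\to\Xi$ be the inverse of $\hat s_\varepsilon:\Xi\to\mathrm S$, and let $\gamma_0=\frac12\delta_{-1}+\frac12\delta_1$. $\mathscr M(K)$ denotes the finite nonnegative Borel measures on $K$ with the weak-$*$ topology (duality with $C(K)$).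 For $\rho\in\mathscr M(\Xi)$ let $\mathcal E_\varepsilon(\rho)=\int_\Xi u\log u\,d\gamma_\varepsilon-\rho(\Xi)\log\rho(\Xi)$ if $\rho=u\gamma_\varepsilon$, and $+\infty$ if $\rho\not\ll\gamma_\varepsilon$. For $\rho\in C([0,T];\mathscr M(\Xi))$ let $$\mathcal J_\varepsilon(\rho)=\int_0^T\Big(\frac1{2\tau_\varepsilon}\int_\Xi v^2\,d\rho(t)+2\tau_\varepsilon\int_\Xi|\partial_\xi\sqrt u|^2\,d\gamma_\varepsilon\Big)dt,$$ where $\rho=u\gamma_\varepsilon$ and $v$ is a Borel velocity field with $\int_0^T\!\int_\Xi|v|\,d\rho(t)\,dt<\infty$ and $\partial_t\rho+\partial_\xi(\rho v)=0$ in $\mathscr D'((0,T)\times\mathbb R)$ ($\rho$ extended by zero; such a $v$ is unique $\rho(t,d\xi)\,dt$-a.e.), and $\mathcal J_\varepsilon(\rho)=+\infty$ if $u$, $v$ or the weak derivative $\partial_\xi\sqrt u$ does not exist. Finally put $\hat\rho=(\hat s_\varepsilon)_\#\rho$, $\hat u=u\circ\hat\xi_\varepsilon$, $\hat v=\dfrac{v\circ\hat\xi_\varepsilon}{\tau_\varepsilon\,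 g_\varepsilon\circ\hat\xi_\varepsilon}$, $\hat g_\varepsilon=\tau_\varepsilon\,(g_\varepsilon\circ\hat\xi_\varepsilon)^2$ and $\hat w=\hat u\,\hat v\,\hat g_\varepsilon$ (compositions in the space variable). **Theorem (compactness under uniform $L^\infty$ bounds).** Let $T,m,C>0$, let $\varepsilon\to0$ along a sequence of positive numbers, and let $\rho_\varepsilon=u_\varepsilon\gamma_\varepsilon\in C([0,T];\mathscr M(\Xi))$ satisfy, for every $\varepsilon$ of the sequence, $$\rho_\varepsilon(t,\Xi)=m\ \text{ for all }t\in[0,T],\qquad \mathcal E_\varepsilon(\rho_\varepsilon(0))\le C,\qquad \mathcal J_\varepsilon(\rho_\varepsilon)\le C,\qquad \|u_\varepsilon\|_{L^\infty((0,T)\times\Xi)}\le C .$$ Then there are a subsequence (not relabelled) and a limit $\rho_0=u_0\gamma_0\in C([0,T];\mathscr M(\Xi))$, with $u_0^\pm(t)=u_0(t,\pm1)\ge0$, such that: 1. $\rho_\varepsilon(t)\rightharpoonup^*\rho_0(t)$ in $\mathscr M(\Xi)$ for every $t\in[0,T]$. 2. For a.e. $t\in(0,T)$ the function $u_\varepsilon(t,\cdot)$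 has a representative continuous on $[-1,1]$, so that the traces $u_\varepsilon(\cdot,\pm1)$ are well defined, and these converge strongly to $u_0^\pm$ in $L^1(0,T)$. 3. For all $0<\delta<1$, $u_\varepsilon\to u_0^-$ in $L^1(0,T;L^\infty(-1,-\delta))$ and $u_\varepsilon\to u_0^+$ in $L^1(0,T;L^\infty(\delta,1))$. Moreover $\hat u_\varepsilon\in L^2(0,T;W^{1,2}(\mathrm S))$, and there are $\hat u_0\in L^\infty((0,T)\times\mathrm S)\cap L^2(0,T;W^{1,2}(\mathrm S))$ and $\hat w_0\in L^2((0,T)\times\mathrm S)$ such that, along the same subsequence: 4. $\hat u_\varepsilon\rightharpoonup^*\hat u_0$ in $L^\infty((0,T)\times\mathrm S)$, and $\partial_s\hat u_\varepsilon\rightharpoonup\partial_s\hat u_0$, $\hat w_\varepsilon\rightharpoonup\hat w_0$ weakly in $L^2((0,T)\times\mathrm S)$. 5. For a.e. $t\in(0,T)$ the traces of $\hat u_0(t,\cdot)$ at $s=\pm\kappa$ are $u_0^\pm(t)$. 6. $\hat\rho_\varepsilon(t)\rightharpoonup^*\hat\rho_0(t)=\frac12\big(u_0^-(t)\delta_{-\kappa}+u_0^+(t)\delta_\kappa\big)$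 in $\mathscr M(\mathrm S)$ for every $t\in[0,T]$. 7. $u_0^+$ is absolutely continuous on $[0,T]$, and for a.e. $t\in(0,T)$ the function $\hat w_0(t,\cdot)$ is (a.e.) constant in $\mathrm S$, equal to $\frac12\dot u_0^+(t)$. The couple $(\hat\rho_0,\hat w_0\mathscr L^2|_{(0,T)\times\mathrm S})$ satisfies $\partial_t\hat\rho_0+\partial_s(\hat w_0\mathscr L^2|_{(0,T)\times\mathrm S})=0$ in $\mathscr D'((0,T)\times\mathbb R)$. -/

import Mathlib

open MeasureTheory Filter Topology Set
open scoped ENNReal NNReal ContDiff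

noncomputable section

namespace KramersLimit

/-! ### The potential and the objects built from it -/

/-- A smooth even double-well potential: strict maximum `1` at `0`, strict minima `0` at the two
wells `±1` (on `[-1,1]`), both nondegenerate. -/
structure DoubleWell (H : ℝ → ℝ) : Prop where
  smooth : ContDiff ℝ ∞ H
  even : ∀ ξ, H (-ξ) = H ξ
  zero : H 0 = 1
  one : H 1 = 0
  pos : ∀ ξ ∈ Ioo (-1 : ℝ) 1, 0 < H ξ
  lt_one : ∀ ξ ∈ Icc (-1 : ℝ) 1, ξ ≠ 0 → H ξ < 1
  deriv2_zero : iteratedDeriv 2 H 0 < 0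
  deriv2_one : 0 < iteratedDeriv 2 H 1

/-- The space domain `Ξ = [-1,1]`. -/
abbrev Xi : Set ℝ := Icc (-1) 1

/-- The reaction rate `k = π⁻¹ √(|H''(0)| H''(1))`. -/
def rate (H : ℝ → ℝ) : ℝ :=
  1 / Real.pi * Real.sqrt (|iteratedDeriv 2 H 0| * iteratedDeriv 2 H 1)

/-- `κ = 1/k`. -/
def kappa (H : ℝ → ℝ) : ℝ := 1 / rate H

/-- The rescaled space domain `S = [-κ,κ]`. -/
abbrev S (H : ℝ → ℝ) : Set ℝ := Icc (-kappa H) (kappa H)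

/-- Normalization constant `Z_ε`. -/
def Z (H : ℝ → ℝ) (ε : ℝ) : ℝ := ∫ ξ in (-1 : ℝ)..1, Real.exp (-H ξ / ε)

/-- Lebesgue density `g_ε = Z_ε⁻¹ e^{-H/ε}` of the invariant measure. -/
def g (H : ℝ → ℝ) (ε ξ : ℝ) : ℝ := (Z H ε)⁻¹ * Real.exp (-H ξ / ε)

/-- Lebesgue measure on a subset of the line. -/
def leb (K : Set ℝ) : Measure K := Measure.comap Subtype.val volume

/-- The invariant measure `γ_ε = g_ε ℒ¹` on `Ξ`. -/
def gam (H : ℝ → ℝ) (ε : ℝ) : Measure Xi :=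
  (leb Xi).withDensity fun ξ => ENNReal.ofReal (g H ε ξ)

/-- The limit measure `γ₀ = ½ δ₋₁ + ½ δ₁` on `Ξ`. -/
def gam0 : Measure Xi :=
  (1 / 2 : ℝ≥0∞) • Measure.dirac ⟨-1, by norm_num⟩
    + (1 / 2 : ℝ≥0∞) • Measure.dirac ⟨1, by norm_num⟩

/-- The time scale `τ_ε = (2κ)⁻¹ ∫_{-1}^1 dξ / g_ε(ξ)`. -/
def tau (H : ℝ → ℝ) (ε : ℝ) : ℝ :=
  1 / (2 * kappa H) * ∫ ξ in (-1 : ℝ)..1, 1 / g H ε ξ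

/-! ### The rescaling -/

/-- `ŝ_ε(ξ) = ∫₀^ξ dη / (τ_ε g_ε(η))`. -/
def shat (H : ℝ → ℝ) (ε ξ : ℝ) : ℝ := ∫ η in (0 : ℝ)..ξ, 1 / (tau H ε * g H ε η)

/-- `ξ̂_ε`, the inverse of `ŝ_ε : [-1,1] → [-κ,κ]`. -/
def xihat (H : ℝ → ℝ) (ε : ℝ) : ℝ → ℝ := Function.invFunOn (shat H ε) (Icc (-1) 1)

/-- Lebesgue density `ĝ_ε(s) = τ_ε g_ε(ξ̂_ε(s))²` of `(ŝ_ε)_# γ_ε`. -/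
def ghat (H : ℝ → ℝ) (ε s : ℝ) : ℝ := tau H ε * g H ε (xihat H ε s) ^ 2

/-- `û = u ∘ ξ̂_ε`. -/
def uhat (H : ℝ → ℝ) (ε : ℝ) (u : ℝ → ℝ → ℝ) (t s : ℝ) : ℝ := u t (xihat H ε s)

/-- `v̂ = (v ∘ ξ̂_ε) / (τ_ε g_ε ∘ ξ̂_ε)`. -/
def vhat (H : ℝ → ℝ) (ε : ℝ) (v : ℝ → ℝ → ℝ) (t s : ℝ) : ℝ :=
  v t (xihat H ε s) / (tau H ε * g H ε (xihat H ε s))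

/-- `ŵ = û v̂ ĝ_ε`. -/
def what (H : ℝ → ℝ) (ε : ℝ) (u v : ℝ → ℝ → ℝ) (t s : ℝ) : ℝ :=
  uhat H ε u t s * vhat H ε v t s * ghat H ε s

theorem kappa_nonneg (H : ℝ → ℝ) : 0 ≤ kappa H := by
  unfold kappa rate; positivity

theorem kappa_pos {H : ℝ → ℝ} (hH : DoubleWell H) : 0 < kappa H := by
  have h0 : 0 < |iteratedDeriv 2 H 0| := abs_pos.mpr hH.deriv2_zero.ne
  have h1 := hH.deriv2_one
  have := Real.pi_pos
  unfold kappa rate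
  positivity

theorem g_pos {H : ℝ → ℝ} (hH : DoubleWell H) (ε ξ : ℝ) : 0 < g H ε ξ := by
  have hc : Continuous H := hH.smooth.continuous
  have hZ : 0 < Z H ε := by
    unfold Z
    apply intervalIntegral.intervalIntegral_pos_of_pos
    · exact (by fun_prop : Continuous fun ξ => Real.exp (-H ξ / ε)).intervalIntegrable _ _
    · intro x; positivity
    · norm_num
  unfold g; positivity

theorem g_continuous {H : ℝ → ℝ} (hH : DoubleWell H) (ε : ℝ) : Continuous (g H ε) := by
  have hc : Continuous H := hH.smooth.continuous
  unfold g
  fun_prop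

theorem tau_pos {H : ℝ → ℝ} (hH : DoubleWell H) (ε : ℝ) : 0 < tau H ε := by
  have hk := kappa_pos hH
  have : 0 < ∫ ξ in (-1 : ℝ)..1, 1 / g H ε ξ := by
    apply intervalIntegral.intervalIntegral_pos_of_pos
    · exact (continuous_const.div (g_continuous hH ε)
        fun x => (g_pos hH ε x).ne').intervalIntegrable _ _
    · intro x; have := g_pos hH ε x; positivity
    · norm_num
  unfold tau; positivity

theorem shat_neg {H : ℝ → ℝ} (hH : DoubleWell H) (ε ξ : ℝ) :
    shat H ε (-ξ) = -shat H ε ξ := by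
  have h := intervalIntegral.integral_comp_neg (a := 0) (b := ξ)
    (fun η => 1 / (tau H ε * g H ε η))
  have he : ∀ η, g H ε (-η) = g H ε η := fun η => by simp [g, hH.even]
  simp only [he, neg_zero] at h
  unfold shat
  rw [intervalIntegral.integral_symm, ← h]

theorem shat_one {H : ℝ → ℝ} (hH : DoubleWell H) (ε : ℝ) : shat H ε 1 = kappa H := by
  have hk := kappa_pos hH
  have ht := tau_pos hH ε
  have hn := shat_neg hH ε 1
  have hi : ∀ a b : ℝ, IntervalIntegrable (fun η => 1 / (tau H ε * g H ε η)) volume a b :=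
    fun a b => (continuous_const.div (continuous_const.mul (g_continuous hH ε))
      fun x => (mul_pos ht (g_pos hH ε x)).ne').intervalIntegrable _ _
  have h2 : shat H ε 1 - shat H ε (-1) = 2 * kappa H := by
    unfold shat
    rw [intervalIntegral.integral_interval_sub_left (hi _ _) (hi _ _)]
    have : (fun η => 1 / (tau H ε * g H ε η)) = fun η => (tau H ε)⁻¹ * (1 / g H ε η) := by
      funext η; rw [one_div, mul_inv, one_div]
    rw [this, intervalIntegral.integral_const_mul]
    have htd : tau H ε = 1 / (2 * kappa H) * ∫ ξ in (-1 : ℝ)..1, 1 / g H ε ξ := rfl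
    have h3 : ∫ ξ in (-1 : ℝ)..1, 1 / g H ε ξ = 2 * kappa H * tau H ε := by
      rw [htd]; field_simp
    rw [h3]; field_simp
  linarith

theorem shat_mem {H : ℝ → ℝ} (hH : DoubleWell H) (ε : ℝ) {ξ : ℝ} (hξ : ξ ∈ Xi) :
    shat H ε ξ ∈ S H := by
  have ht := tau_pos hH ε
  have hi : ∀ a b : ℝ, IntervalIntegrable (fun η => 1 / (tau H ε * g H ε η)) volume a b :=
    fun a b => (continuous_const.div (continuous_const.mul (g_continuous hH ε))
      fun x => (mul_pos ht (g_pos hH ε x)).ne').intervalIntegrable _ _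
  have hmono : ∀ a b : ℝ, a ≤ b → shat H ε a ≤ shat H ε b := by
    intro a b hab
    have : 0 ≤ shat H ε b - shat H ε a := by
      unfold shat
      rw [intervalIntegral.integral_interval_sub_left (hi _ _) (hi _ _)]
      refine intervalIntegral.integral_nonneg hab fun x _ => ?_
      have := mul_pos ht (g_pos hH ε x)
      positivity
    linarith
  have h1 := hmono _ _ hξ.1
  have h2 := hmono _ _ hξ.2
  rw [shat_neg hH, shat_one hH] at h1
  rw [shat_one hH] at h2
  exact ⟨h1, h2⟩

/-- `ŝ_ε` as a map from `Ξ` to `S`. -/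
def rescale {H : ℝ → ℝ} (hH : DoubleWell H) (ε : ℝ) : Xi → S H :=
  fun ξ => ⟨shat H ε ξ, shat_mem hH ε ξ.2⟩

/-! ### Densities, weak derivatives, traces, continuity equation -/

/-- `μ = f γ` with a nonnegative density `f`. -/
def IsDensity {K : Set ℝ} (μ γ : Measure K) (f : ℝ → ℝ) : Prop :=
  (∀ᵐ x : K ∂γ, 0 ≤ f x) ∧ μ = γ.withDensity fun x => ENNReal.ofReal (f x)

/-- `d` is the weak derivative of `f` on the open interval `(a,b)`. -/
def IsWeakDeriv (a b : ℝ) (f d : ℝ → ℝ) : Prop :=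
  LocallyIntegrableOn f (Ioo a b) ∧ LocallyIntegrableOn d (Ioo a b) ∧
  ∀ φ : ℝ → ℝ, ContDiff ℝ ∞ φ → HasCompactSupport φ → tsupport φ ⊆ Ioo a b →
    ∫ x in Ioo a b, f x * deriv φ x = -∫ x in Ioo a b, d x * φ x

/-- `f` has a representative that is continuous on `[a,b]`, and the boundary values of this
representative at `a` and `b` are `α` and `β`. -/
def HasTraces (a b : ℝ) (f : ℝ → ℝ) (α β : ℝ) : Prop :=
  ∃ c : ℝ → ℝ, ContinuousOn c (Icc a b) ∧ f =ᵐ[volume.restrict (Ioo a b)] c ∧ c a = α ∧ c b = β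

/-- Lebesgue measure on the cylinder `(0,T) × (a,b)`. -/
def cyl (T a b : ℝ) : Measure (ℝ × ℝ) := volume.restrict (Ioo 0 T ×ˢ Ioo a b)

/-- `f ∈ L²(0,T; W^{1,2}(a,b))` with spatial derivative `d`. -/
def IsL2W12 (T a b : ℝ) (f d : ℝ → ℝ → ℝ) : Prop :=
  MemLp (Function.uncurry f) 2 (cyl T a b) ∧ MemLp (Function.uncurry d) 2 (cyl T a b) ∧
  ∀ᵐ t ∂volume.restrict (Ioo 0 T), IsWeakDeriv a b (f t) (d t)

/-- `(ρ, ν)` with `ν(dt dx) = v(t,x) μ_t(dx) dt` solves the continuity equation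
`∂_t ρ + ∂_x ν = 0` in `𝒟'((a,b) × ℝ)`: `ρ` is a weakly-* continuous curve of finite measures on
`K` (extended by zero outside `K`), `ν` is a finite signed measure. -/
def ContinuityEq {K : Set ℝ} (a b : ℝ) (ρ : ℝ → FiniteMeasure K) (μ : ℝ → Measure K)
    (v : ℝ → ℝ → ℝ) : Prop :=
  ContinuousOn ρ (Icc a b) ∧ Measurable (Function.uncurry v) ∧
  ∫⁻ t in Ioo a b, ∫⁻ x : K, ‖v t x‖ₑ ∂μ t < (⊤ : ℝ≥0∞) ∧
  ∀ φ : ℝ × ℝ → ℝ, ContDiff ℝ ∞ φ → HasCompactSupport φ → tsupport φ ⊆ Ioo a b ×ˢ univ →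
    ∫ t in Ioo a b, ((∫ x : K, deriv (fun r => φ (r, x)) t ∂(ρ t : Measure K))
      + ∫ x : K, deriv (fun y => φ (t, y)) x * v t x ∂μ t) = 0

/-- `(ρ, ρ v)` satisfies the continuity equation on `(a,b)`. -/
def IsVelocity {K : Set ℝ} (a b : ℝ) (ρ : ℝ → FiniteMeasure K) (v : ℝ → ℝ → ℝ) : Prop :=
  ContinuityEq a b ρ (fun t => (ρ t : Measure K)) v

/-! ### Free energy and dissipation functional -/

open Classical in
/-- `ℰ_ε(ρ) = ∫ u log u dγ_ε - ρ(Ξ) log ρ(Ξ)`, `u = dρ/dγ_ε`, with value `+∞` if `ρ` is not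
absolutely continuous (or if the integral, whose integrand is bounded below, is `+∞`). -/
def freeEnergy (H : ℝ → ℝ) (ε : ℝ) (ρ : FiniteMeasure Xi) : EReal :=
  let u : Xi → ℝ := fun ξ => ((ρ : Measure Xi).rnDeriv (gam H ε) ξ).toReal
  if (ρ : Measure Xi) ≪ gam H ε ∧ Integrable (fun ξ => u ξ * Real.log (u ξ)) (gam H ε) then
    (((∫ ξ, u ξ * Real.log (u ξ) ∂gam H ε)
      - (ρ : Measure Xi).real univ * Real.log ((ρ : Measure Xi).real univ) : ℝ) : EReal)
  else ⊤

/-- `u` is the density of the curve `ρ` with respect to `γ_ε` on `(a,b)`, and `p = ∂_ξ √u`. -/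
def IsSqrtDeriv (H : ℝ → ℝ) (ε a b : ℝ) (ρ : ℝ → FiniteMeasure Xi) (u p : ℝ → ℝ → ℝ) : Prop :=
  Measurable (Function.uncurry u) ∧ Measurable (Function.uncurry p) ∧
  ∀ᵐ t ∂volume.restrict (Ioo a b), IsDensity (ρ t : Measure Xi) (gam H ε) (u t) ∧
    IsWeakDeriv (-1) 1 (fun ξ => Real.sqrt (u t ξ)) (p t)

/-- `𝒥_ε(ρ;a,b) = ∫_a^b (1/(2τ_ε) ∫ v² dρ_t + 2τ_ε ∫ |∂_ξ √u|² dγ_ε) dt`, where `(ρ, ρv)` solves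
the continuity equation and `ρ = u γ_ε`. The functions `v`, `u`, `∂_ξ √u` are determined by `ρ`
almost everywhere, so the infimum runs over a single value; it is `+∞` if they do not exist. -/
def dissipation (H : ℝ → ℝ) (ε : ℝ) (ρ : ℝ → FiniteMeasure Xi) (a b : ℝ) : ℝ≥0∞ :=
  ⨅ (v : ℝ → ℝ → ℝ) (u : ℝ → ℝ → ℝ) (p : ℝ → ℝ → ℝ)
    (_ : IsVelocity a b ρ v) (_ : IsSqrtDeriv H ε a b ρ u p),
    ∫⁻ t in Ioo a b,
      (ENNReal.ofReal (1 / (2 * tau H ε)) * ∫⁻ ξ : Xi, ENNReal.ofReal (v t ξ ^ 2) ∂(ρ t : Measure Xi)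
        + ENNReal.ofReal (2 * tau H ε) * ∫⁻ ξ : Xi, ENNReal.ofReal (p t ξ ^ 2) ∂gam H ε)

/-! ### Modes of convergence -/

/-- Weak convergence in `L²(μ)`. -/
def WeakL2 {α : Type*} [MeasurableSpace α] (μ : Measure α) (f : ℕ → α → ℝ) (f₀ : α → ℝ) : Prop :=
  (∀ n, MemLp (f n) 2 μ) ∧ MemLp f₀ 2 μ ∧
  ∀ h : α → ℝ, MemLp h 2 μ →
    Tendsto (fun n => ∫ x, f n x * h x ∂μ) atTop (𝓝 (∫ x, f₀ x * h x ∂μ))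

/-- Weak-* convergence in `L^∞(μ) = L¹(μ)*`. -/
def WeakStarLinfty {α : Type*} [MeasurableSpace α] (μ : Measure α) (f : ℕ → α → ℝ)
    (f₀ : α → ℝ) : Prop :=
  (∀ n, MemLp (f n) ∞ μ) ∧ MemLp f₀ ∞ μ ∧
  ∀ h : α → ℝ, MemLp h 1 μ →
    Tendsto (fun n => ∫ x, f n x * h x ∂μ) atTop (𝓝 (∫ x, f₀ x * h x ∂μ))

/-- Strong convergence in `L¹(μ)`. -/
def StrongL1 {α : Type*} [MeasurableSpace α] (μ : Measure α) (f : ℕ → α → ℝ)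
    (f₀ : α → ℝ) : Prop :=
  (∀ n, MemLp (f n) 1 μ) ∧ MemLp f₀ 1 μ ∧
  Tendsto (fun n => eLpNorm (fun x => f n x - f₀ x) 1 μ) atTop (𝓝 0)

/-- The measure `½ (α δ_{-κ} + β δ_κ)` on `S`. -/
def twoPoint (H : ℝ → ℝ) (α β : ℝ) : Measure (S H) :=
  ENNReal.ofReal (α / 2) •
      Measure.dirac ⟨-kappa H, le_refl _, neg_le_self (kappa_nonneg H)⟩
    + ENNReal.ofReal (β / 2) •
      Measure.dirac ⟨kappa H, neg_le_self (kappa_nonneg H), le_refl _⟩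

end KramersLimit

end

open KramersLimit

noncomputable section

namespace KramersLimit

/-! ### Weak derivatives and primitives -/

/-! The change of variable `s = ŝ_ε(ξ)` stretches the neighbourhood of the saddle `ξ = 0` over `S`
and squeezes the rest into the end points: `ŝ_ε(δ) → κ` for every fixed `0 < δ ≤ 1`. At the same
time `γ_ε` charges only the wells in the limit. Both facts are Laplace estimates for quotients of
exponential integrals (`tendsto_exp_ratio`, `tendsto_shat`, `tendsto_gam_core`). In the variable `s`
the weights `τ_ε` and `g_ε` disappear from the estimates: since `0 ≤ u ≤ C`, the two halves of the
dissipation bound `ŵ` and `∂_s û` in `L²`, uniformly in `ε` (`eLpNorm_what_le`, `eLpNorm_slope_le`),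
and weakly convergent subsequences exist.

Convergence at every time follows without an equicontinuity argument. The continuity equation tested
with the coordinate `s` says that the mean `∫ ŝ_ε dρ_ε(t)` is its initial value plus the integral of
`ŵ` over `(0,t) × S` (`integral_shat_eq`). Weak convergence of `ŵ` and convergence of the initial
means, a bounded sequence of numbers, therefore give a limit `F(t)` for all `t`. The density bound
gives `ρ_ε(t) ≤ C γ_ε` at every time, so `ρ_ε(t)` can only charge the two wells in the limit; two
weights are determined by two linear data, the mass `m` and the mean `F(t)`
(`tendsto_integral_of_dominated`). The limit densities are `u₀^± = m ± F/κ`, which are absolutely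
continuous because `F` is a primitive.

Strong convergence of the traces rests on the square-root oscillation bound for functions with `L²`
slope: on `(δ,1)` the density differs from its trace at `1` by at most `√(κ - ŝ_ε(δ))` times a
function bounded in `L¹(0,T)`. Integrals of a cutoff against `ρ_ε(t)`, which converge for every `t`,
are thus close to the trace times the integral of the cutoff against `γ_ε`, which tends to `1/2`
(`CurveSeq.tendsto_trace`). Since `û` is its left trace plus the primitive of its slope, the limit
of `û` and its traces follow (`CurveSeq.tendsto_uhat`, `CurveSeq.ae_jump_eq`).

Finally, the limit measures sit at `±κ`. For a test function `φ(t) B(s)` the limit continuity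
equation sees `B` only through `B(κ) - B(-κ) = ∫ B'`, so the limit flux is constant in `s`
(`CurveSeq.ae_limFlux_eq`). -/

lemma absolutelyContinuous_primitive {a b k : ℝ} {d : ℝ → ℝ} (hab : a ≤ b)
    (hd : IntegrableOn d (Ioo a b)) :
    AbsolutelyContinuousOnInterval (fun x => k + ∫ y in a..x, d y) a b := by
  have hi : IntervalIntegrable d volume a b :=
    (intervalIntegrable_iff_integrableOn_Ioo_of_le hab).2 hd
  have h1 : AbsolutelyContinuousOnInterval (fun _ : ℝ => k) a b :=
    ((LipschitzWith.const k).lipschitzOnWith).absolutelyContinuousOnInterval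
  exact h1.add (hi.absolutelyContinuousOnInterval_intervalIntegral (by simp))

lemma ae_hasDerivAt_primitive {a b k : ℝ} {d : ℝ → ℝ} (hab : a ≤ b)
    (hd : IntegrableOn d (Ioo a b)) :
    ∀ᵐ x ∂volume.restrict (Ioo a b), HasDerivAt (fun x => k + ∫ y in a..x, d y) (d x) x := by
  have hi : IntervalIntegrable d volume a b :=
    (intervalIntegrable_iff_integrableOn_Ioo_of_le hab).2 hd
  rw [ae_restrict_iff' measurableSet_Ioo]
  filter_upwards [hi.ae_hasDerivAt_integral] with x hx hx'
  have := hx (by rw [uIcc_of_le hab]; exact Ioo_subset_Icc_self hx') a (by simp)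
  exact this.const_add k

lemma continuousOn_primitive {a b k : ℝ} {d : ℝ → ℝ} (hab : a ≤ b)
    (hd : IntegrableOn d (Ioo a b)) :
    ContinuousOn (fun x => k + ∫ y in a..x, d y) (Icc a b) := by
  have := (absolutelyContinuous_primitive (k := k) hab hd).continuousOn
  rwa [uIcc_of_le hab] at this

/-- Integration by parts between a primitive and a `C¹` function. -/
lemma integral_primitive_mul_deriv {a b k : ℝ} {d φ : ℝ → ℝ} (hab : a ≤ b)
    (hd : IntegrableOn d (Ioo a b)) (hφ : ContDiff ℝ ∞ φ) :
    ∫ x in Ioo a b, (k + ∫ y in a..x, d y) * deriv φ x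
      = (k + ∫ y in a..b, d y) * φ b - k * φ a - ∫ x in Ioo a b, d x * φ x := by
  have hF := absolutelyContinuous_primitive (k := k) hab hd
  have hG : AbsolutelyContinuousOnInterval φ a b :=
    (ContDiff.of_le hφ (by norm_cast) : ContDiff ℝ 1 φ).contDiffOn.absolutelyContinuousOnInterval
  have h := hF.integral_mul_deriv_eq_deriv_mul hG
  rw [intervalIntegral.integral_of_le hab, integral_Ioc_eq_integral_Ioo,
    intervalIntegral.integral_same, add_zero] at h
  have e : ∫ x in Ioo a b, deriv (fun x => k + ∫ y in a..x, d y) x * φ x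
      = ∫ x in Ioo a b, d x * φ x := by
    refine integral_congr_ae ?_
    filter_upwards [ae_hasDerivAt_primitive (k := k) hab hd] with x hx
    rw [hx.deriv]
  rw [h, ← e, intervalIntegral.integral_of_le hab, integral_Ioc_eq_integral_Ioo,
    intervalIntegral.integral_of_le hab, integral_Ioc_eq_integral_Ioo]

lemma eq_zero_of_tsupport_subset_Ioo {a b : ℝ} {φ : ℝ → ℝ} (h : tsupport φ ⊆ Ioo a b) {x : ℝ}
    (hx : x ∉ Ioo a b) : φ x = 0 := by
  by_contra h0
  exact hx (h (subset_tsupport _ h0))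

lemma isWeakDeriv_of_primitive {a b k : ℝ} {f d : ℝ → ℝ} (hab : a ≤ b)
    (hd : IntegrableOn d (Ioo a b))
    (hf : f =ᵐ[volume.restrict (Ioo a b)] fun x => k + ∫ y in a..x, d y) :
    IsWeakDeriv a b f d := by
  have hc := continuousOn_primitive (k := k) hab hd
  refine ⟨?_, hd.locallyIntegrableOn, fun φ hφ _ hs => ?_⟩
  · have h1 : IntegrableOn (fun x => k + ∫ y in a..x, d y) (Ioo a b) :=
      (hc.integrableOn_Icc).mono_set Ioo_subset_Icc_self
    exact IntegrableOn.locallyIntegrableOn (h1.congr hf.symm)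
  · have h2 : ∫ x in Ioo a b, f x * deriv φ x
        = ∫ x in Ioo a b, (k + ∫ y in a..x, d y) * deriv φ x := by
      refine integral_congr_ae ?_
      filter_upwards [hf] with x hx
      rw [hx]
    rw [h2, integral_primitive_mul_deriv hab hd hφ,
      eq_zero_of_tsupport_subset_Ioo hs (x := a) (by simp),
      eq_zero_of_tsupport_subset_Ioo hs (x := b) (by simp)]
    ring

/-- The primitive of a compactly supported smooth function with zero mean. -/
lemma exists_primitive_of_integral_eq_zero {a b : ℝ} {ψ : ℝ → ℝ} (hab : a < b)
    (hψ : ContDiff ℝ ∞ ψ) (hc : HasCompactSupport ψ) (hs : tsupport ψ ⊆ Ioo a b)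
    (h0 : ∫ x, ψ x = 0) :
    ∃ φ : ℝ → ℝ, ContDiff ℝ ∞ φ ∧ HasCompactSupport φ ∧ tsupport φ ⊆ Ioo a b ∧
      deriv φ = ψ := by
  have hcont := hψ.continuous
  have hder : ∀ x, HasDerivAt (fun x => ∫ y in a..x, ψ y) (ψ x) x := fun x =>
    intervalIntegral.integral_hasDerivAt_right (hcont.intervalIntegrable _ _)
      (hcont.stronglyMeasurableAtFilter _ _) hcont.continuousAt
  have hd : deriv (fun x => ∫ y in a..x, ψ y) = ψ := funext fun x => (hder x).deriv
  -- The primitive is constant off an interval `[l,r]` containing the support: it is zero on the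
  -- left because it starts at `a`, and zero on the right because the mean vanishes. Compactness of
  -- the support places `[l,r]` strictly inside `(a,b)`; an empty support is given the midpoint.
  obtain ⟨l, r, hlr, hsub, hin⟩ : ∃ l r, l ≤ r ∧ tsupport ψ ⊆ Icc l r ∧ Icc l r ⊆ Ioo a b := by
    rcases (tsupport ψ).eq_empty_or_nonempty with h | h
    · refine ⟨(a + b) / 2, (a + b) / 2, le_rfl, by simp [h], ?_⟩
      intro x hx
      have : x = (a + b) / 2 := le_antisymm hx.2 hx.1
      constructor <;> linarith
    · have hK : IsCompact (tsupport ψ) := hc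
      have h1 := hs (hK.sInf_mem h)
      have h2 := hs (hK.sSup_mem h)
      have hle : ∀ x ∈ tsupport ψ, sInf (tsupport ψ) ≤ x ∧ x ≤ sSup (tsupport ψ) :=
        fun x hx => ⟨csInf_le hK.bddBelow hx, le_csSup hK.bddAbove hx⟩
      refine ⟨sInf (tsupport ψ), sSup (tsupport ψ), (hle _ (hK.sInf_mem h)).2, fun x hx => hle x hx,
        fun x hx => ⟨h1.1.trans_le hx.1, hx.2.trans_lt h2.2⟩⟩
  have hzero : ∀ x, x ∉ Icc l r → ψ x = 0 := fun x hx => by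
    by_contra h
    exact hx (hsub (subset_tsupport _ h))
  have hal : a < l := (hin ⟨le_rfl, hlr⟩).1
  have hleft : ∀ x, x < l → ∫ y in a..x, ψ y = 0 := by
    intro x hx
    refine intervalIntegral.integral_zero_ae (Eventually.of_forall fun y hy => hzero y ?_)
    intro hy'
    rcases le_total a x with h | h
    · rw [uIoc_of_le h] at hy; linarith [hy.2, hy'.1]
    · rw [uIoc_of_ge h] at hy; linarith [hy.2, hy'.1]
  have hright : ∀ x, r < x → ∫ y in a..x, ψ y = 0 := by
    intro x hx
    have hax : a ≤ x := by linarith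
    rw [intervalIntegral.integral_of_le hax, ← h0]
    refine setIntegral_eq_integral_of_forall_compl_eq_zero fun y hy => hzero y ?_
    intro hy'
    exact hy ⟨by linarith [hy'.1], by linarith [hy'.2]⟩
  have hsupp : tsupport (fun x => ∫ y in a..x, ψ y) ⊆ Icc l r := by
    refine closure_minimal (fun x hx => ?_) isClosed_Icc
    by_contra hx'
    rw [mem_Icc, not_and_or, not_le, not_le] at hx'
    exact hx (hx'.elim (hleft x) (hright x))
  refine ⟨fun x => ∫ y in a..x, ψ y, ?_, ?_, hsupp.trans hin, hd⟩
  · rw [contDiff_infty_iff_deriv, hd]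
    exact ⟨fun x => (hder x).differentiableAt, hψ⟩
  · exact HasCompactSupport.of_support_subset_isCompact isCompact_Icc
      ((subset_tsupport _).trans hsupp)

lemma exists_bump {a b : ℝ} (hab : a < b) :
    ∃ ψ : ℝ → ℝ, ContDiff ℝ ∞ ψ ∧ HasCompactSupport ψ ∧ tsupport ψ ⊆ Ioo a b ∧ ∫ x, ψ x = 1 := by
  let f : ContDiffBump ((a + b) / 2) := ⟨(b - a) / 8, (b - a) / 4, by linarith, by linarith⟩
  refine ⟨f.normed volume, f.contDiff_normed, f.hasCompactSupport_normed, ?_, f.integral_normed⟩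
  rw [f.tsupport_normed_eq, Real.closedBall_eq_Icc]
  intro x hx
  have h1 := hx.1
  have h2 := hx.2
  simp only [f] at h1 h2
  constructor <;> linarith

/-- A function with integrable weak derivative is almost everywhere a primitive of it. -/
lemma IsWeakDeriv.exists_eq_primitive {a b : ℝ} {f d : ℝ → ℝ} (hab : a < b)
    (h : IsWeakDeriv a b f d) (hd : IntegrableOn d (Ioo a b)) :
    ∃ k, f =ᵐ[volume.restrict (Ioo a b)] fun x => k + ∫ y in a..x, d y := by
  obtain ⟨hf, -, hw⟩ := h
  set F : ℝ → ℝ := fun x => 0 + ∫ y in a..x, d y with hFdef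
  have hF : IsWeakDeriv a b F d := isWeakDeriv_of_primitive hab.le hd (EventuallyEq.refl _ _)
  -- Du Bois-Reymond: `f₁` has zero weak derivative, and it remains to show that it is constant.
  set f₁ : ℝ → ℝ := fun x => f x - F x with hf₁
  have hloc : LocallyIntegrableOn f₁ (Ioo a b) := hf.sub hF.1
  have hintg : ∀ G : ℝ → ℝ, LocallyIntegrableOn G (Ioo a b) → ∀ ψ : ℝ → ℝ, Continuous ψ →
      HasCompactSupport ψ → tsupport ψ ⊆ Ioo a b → Integrable (fun x => G x * ψ x) := by
    intro G hG ψ hψ hc hs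
    have h1 : IntegrableOn G (tsupport ψ) := hG.integrableOn_compact_subset hs hc
    have h2 : IntegrableOn (fun x => G x * ψ x) (tsupport ψ) :=
      h1.mul_continuousOn hψ.continuousOn hc
    exact (integrableOn_iff_integrable_of_support_subset
      ((Function.support_mul_subset_right _ _).trans (subset_tsupport ψ))).1 h2
  have hset : ∀ G ψ : ℝ → ℝ, tsupport ψ ⊆ Ioo a b →
      ∫ x in Ioo a b, G x * ψ x = ∫ x, G x * ψ x := by
    intro G ψ hs
    refine setIntegral_eq_integral_of_forall_compl_eq_zero fun x hx => ?_
    rw [eq_zero_of_tsupport_subset_Ioo hs hx, mul_zero]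
  have hz : ∀ φ : ℝ → ℝ, ContDiff ℝ ∞ φ → HasCompactSupport φ → tsupport φ ⊆ Ioo a b →
      ∫ x, f₁ x * deriv φ x = 0 := by
    intro φ hφ hc hs
    have hc' : HasCompactSupport (deriv φ) := hc.deriv
    have hs' : tsupport (deriv φ) ⊆ Ioo a b := (tsupport_deriv_subset (f := φ)).trans hs
    have hφ' : Continuous (deriv φ) := hφ.continuous_deriv (by norm_cast)
    have e1 := hw φ hφ hc hs
    have e2 := hF.2.2 φ hφ hc hs
    rw [hset _ _ hs'] at e1 e2
    have : ∫ x, f₁ x * deriv φ x = ∫ x, f x * deriv φ x - F x * deriv φ x := by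
      simp only [hf₁, sub_mul]
    rw [this, integral_sub (hintg f hf _ hφ' hc' hs') (hintg F hF.1 _ hφ' hc' hs'), e1, e2, sub_self]
  obtain ⟨ψ₀, hψ₀, hc₀, hs₀, hi₀⟩ := exists_bump hab
  -- The constant is read off by testing with a bump of unit mass.
  set k := ∫ x, f₁ x * ψ₀ x with hk
  refine ⟨k, ?_⟩
  have hconst : LocallyIntegrableOn (fun _ : ℝ => k) (Ioo a b) :=
    (continuous_const.locallyIntegrable).locallyIntegrableOn _
  have key : ∀ᵐ x, x ∈ Ioo a b → f₁ x - k = 0 := by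
    refine isOpen_Ioo.ae_eq_zero_of_integral_contDiff_smul_eq_zero (hloc.sub hconst) ?_
    intro ψ hψ hc hs
    set c := ∫ x, ψ x with hcdef
    -- Removing the multiple of `ψ₀` with the same mean makes the test function the derivative of an
    -- admissible one, on which `f₁` vanishes.
    have hη : ContDiff ℝ ∞ (fun x => ψ x - c * ψ₀ x) := hψ.sub (contDiff_const.mul hψ₀)
    have hcη : HasCompactSupport (fun x => ψ x - c * ψ₀ x) := hc.sub hc₀.mul_left
    have hsη : tsupport (fun x => ψ x - c * ψ₀ x) ⊆ Ioo a b := by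
      refine (tsupport_sub ψ (fun x => c * ψ₀ x)).trans (union_subset hs ?_)
      exact (tsupport_mul_subset_right (f := fun _ => c) (g := ψ₀)).trans hs₀
    have hiψ : Integrable ψ := hψ.continuous.integrable_of_hasCompactSupport hc
    have hiψ₀ : Integrable ψ₀ := hψ₀.continuous.integrable_of_hasCompactSupport hc₀
    obtain ⟨φ, hφ, hcφ, hsφ, hdφ⟩ := exists_primitive_of_integral_eq_zero hab hη hcη hsη (by
      rw [integral_sub hiψ (hiψ₀.const_mul c), integral_const_mul, hi₀, mul_one, sub_self])
    have e := hz φ hφ hcφ hsφ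
    rw [hdφ] at e
    have i1 := hintg f₁ hloc ψ hψ.continuous hc hs
    have i2 := hintg f₁ hloc ψ₀ hψ₀.continuous hc₀ hs₀
    have e' : ∫ x, f₁ x * ψ x - c * (f₁ x * ψ₀ x) = 0 := by
      rw [← e]; congr 1; funext x; ring
    rw [integral_sub i1 (i2.const_mul c), integral_const_mul, ← hk] at e'
    have : ∫ x, ψ x • (f₁ x - k) = ∫ x, f₁ x * ψ x - k * ψ x := by
      congr 1; funext x; simp only [smul_eq_mul]; ring
    rw [this, integral_sub i1 (hiψ.const_mul k), integral_const_mul, ← hcdef]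
    linarith
  refine (ae_restrict_iff' measurableSet_Ioo).2 ?_
  filter_upwards [key] with x hx hx'
  have := hx hx'
  simp only [hf₁, hFdef] at this
  linarith

/-- Chain rule for the square of a primitive. -/
lemma sq_primitive {a b k x : ℝ} {p : ℝ → ℝ} (hp : IntegrableOn p (Ioo a b))
    (hx : x ∈ Icc a b) :
    (k + ∫ y in a..x, p y) ^ 2
      = k ^ 2 + ∫ y in a..x, 2 * (k + ∫ z in a..y, p z) * p y := by
  have hp' : IntegrableOn p (Ioo a x) := hp.mono_set (Ioo_subset_Ioo_right hx.2)
  have hF := absolutelyContinuous_primitive (k := k) hx.1 hp'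
  have h := hF.integral_deriv_mul_eq_sub hF
  rw [intervalIntegral.integral_same, add_zero] at h
  have : ∫ y in a..x, 2 * (k + ∫ z in a..y, p z) * p y =
      ∫ y in a..x, deriv (fun x => k + ∫ y in a..x, p y) y * (k + ∫ z in a..y, p z) +
        (k + ∫ z in a..y, p z) * deriv (fun x => k + ∫ y in a..x, p y) y := by
    rw [intervalIntegral.integral_of_le hx.1, integral_Ioc_eq_integral_Ioo,
      intervalIntegral.integral_of_le hx.1, integral_Ioc_eq_integral_Ioo]
    refine integral_congr_ae ?_
    filter_upwards [ae_hasDerivAt_primitive (k := k) hx.1 hp'] with y hy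
    rw [hy.deriv]; ring
  rw [this, h]; ring

/-! ### Weak compactness in `L²` -/

/-- Riesz representation turns the functions into functionals in a ball of the dual of `L²`. A
countably generated σ-algebra makes `L²` separable, so the ball is weak-* sequentially compact. The
limit is delivered as a strongly measurable function, so that its slices and primitives can be taken
pointwise later. -/
lemma exists_weakL2_subseq {α : Type*} [MeasurableSpace α] {μ : Measure α}
    [MeasurableSpace.CountablyGenerated α] [SFinite μ] (f : ℕ → α → ℝ)
    (hf : ∀ n, MemLp (f n) 2 μ) {K : ℝ≥0∞} (hK : K ≠ ⊤) (hb : ∀ n, eLpNorm (f n) 2 μ ≤ K) :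
    ∃ (σ : ℕ → ℕ) (f₀ : α → ℝ), StrictMono σ ∧ StronglyMeasurable f₀ ∧
      WeakL2 μ (fun n => f (σ n)) f₀ := by
  have : Fact ((1 : ℝ≥0∞) ≤ 2) := ⟨by norm_num⟩
  have : Fact ((2 : ℝ≥0∞) ≠ ⊤) := ⟨by norm_num⟩
  let E := Lp ℝ 2 μ
  let x : ℕ → E := fun n => (hf n).toLp (f n)
  let y : ℕ → WeakDual ℝ E := fun n =>
    StrongDual.toWeakDual (InnerProductSpace.toDual ℝ E (x n))
  have hy : ∀ n, y n ∈ WeakDual.toStrongDual ⁻¹'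
      Metric.closedBall (0 : StrongDual ℝ E) K.toReal := by
    intro n
    have : ‖InnerProductSpace.toDual ℝ E (x n)‖ ≤ K.toReal := by
      rw [LinearIsometryEquiv.norm_map, Lp.norm_toLp]
      exact ENNReal.toReal_mono hK (hb n)
    rw [mem_preimage, mem_closedBall_zero_iff]
    exact this
  obtain ⟨y₀, -, σ, hσ, hlim⟩ := WeakDual.isSeqCompact_closedBall ℝ E 0 K.toReal hy
  let x₀ : E := (InnerProductSpace.toDual ℝ E).symm (WeakDual.toStrongDual y₀)
  refine ⟨σ, x₀, hσ, Lp.stronglyMeasurable x₀, fun n => hf _, Lp.memLp x₀, fun h hh => ?_⟩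
  have h1 := ((WeakDual.eval_continuous (hh.toLp h)).tendsto y₀).comp hlim
  have e1 : ∀ n, y (σ n) (hh.toLp h) = ∫ a, f (σ n) a * h a ∂μ := by
    intro n
    have : y (σ n) (hh.toLp h) = inner ℝ (x (σ n)) (hh.toLp h) :=
      InnerProductSpace.toDual_apply_apply
    rw [this, L2.inner_def]
    refine integral_congr_ae ?_
    filter_upwards [(hf (σ n)).coeFn_toLp, hh.coeFn_toLp] with a h1 h2
    simp only [x]
    rw [h1, h2]; simp [mul_comm]
  have e2 : y₀ (hh.toLp h) = ∫ a, x₀ a * h a ∂μ := by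
    have : inner ℝ x₀ (hh.toLp h) = WeakDual.toStrongDual y₀ (hh.toLp h) :=
      InnerProductSpace.toDual_symm_apply
    have e3 : y₀ (hh.toLp h) = inner ℝ x₀ (hh.toLp h) := this.symm
    rw [e3, L2.inner_def]
    refine integral_congr_ae ?_
    filter_upwards [hh.coeFn_toLp] with a h2
    rw [h2]; simp [mul_comm]
  rw [← e2]
  refine h1.congr fun n => ?_
  exact e1 n

lemma WeakL2.subseq {α : Type*} [MeasurableSpace α] {μ : Measure α} {f : ℕ → α → ℝ} {f₀ : α → ℝ}
    (h : WeakL2 μ f f₀) {σ : ℕ → ℕ} (hσ : StrictMono σ) : WeakL2 μ (fun n => f (σ n)) f₀ :=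
  ⟨fun _ => h.1 _, h.2.1, fun g hg => (h.2.2 g hg).comp hσ.tendsto_atTop⟩

/-! ### Functions on a rectangle determined by product test functions -/

/-- Rectangles form a π-system generating the product σ-algebra, and the sets of zero integral form
a Dynkin class. The complement step uses that the whole space is itself a rectangle. -/
lemma ae_eq_zero_of_setIntegral_prod {α β : Type*} [MeasurableSpace α] [MeasurableSpace β]
    {μ : Measure (α × β)} {f : α × β → ℝ} (hf : Integrable f μ)
    (h : ∀ A B, MeasurableSet A → MeasurableSet B → ∫ x in A ×ˢ B, f x ∂μ = 0) : f =ᵐ[μ] 0 := by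
  refine hf.ae_eq_zero_of_forall_setIntegral_eq_zero fun s hs _ => ?_
  have huniv : ∫ x, f x ∂μ = 0 := by
    have := h univ univ .univ .univ
    rwa [univ_prod_univ, setIntegral_univ] at this
  refine MeasurableSpace.induction_on_inter generateFrom_prod.symm isPiSystem_prod (by simp)
    ?_ ?_ ?_ s hs
  · rintro - ⟨s, hs, t, ht, rfl⟩
    exact h s t hs ht
  · intro t ht h
    have := integral_add_compl ht hf
    rw [h, huniv] at this
    linarith
  · intro F hdisj hF heq
    rw [integral_iUnion hF hdisj hf.integrableOn]
    simp [heq]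

lemma cyl_eq_prod (T a b : ℝ) :
    cyl T a b = (volume.restrict (Ioo 0 T)).prod (volume.restrict (Ioo a b)) := by
  rw [cyl, Measure.prod_restrict]; rfl

/-- The fundamental lemma of the calculus of variations is applied once per variable. For fixed `ψ`
the arbitrary `φ` removes the time variable up to integration over a set `A`; after exchanging the
integrals the arbitrary `ψ` does the same in space, which leaves zero integrals over rectangles. -/
lemma ae_eq_zero_of_product_test {T a b : ℝ} {f : ℝ × ℝ → ℝ} (hf : Integrable f (cyl T a b))
    (h : ∀ φ ψ : ℝ → ℝ, ContDiff ℝ ∞ φ → HasCompactSupport φ → tsupport φ ⊆ Ioo 0 T →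
      ContDiff ℝ ∞ ψ → HasCompactSupport ψ → tsupport ψ ⊆ Ioo a b →
      ∫ t in Ioo 0 T, φ t * ∫ x in Ioo a b, ψ x * f (t, x) = 0) : f =ᵐ[cyl T a b] 0 := by
  rw [cyl_eq_prod] at hf ⊢
  have hmul : ∀ ψ : ℝ → ℝ, Continuous ψ → HasCompactSupport ψ →
      Integrable (fun z : ℝ × ℝ => ψ z.2 * f z)
        ((volume.restrict (Ioo 0 T)).prod (volume.restrict (Ioo a b))) := by
    intro ψ hψ hc
    obtain ⟨K, hK⟩ := hc.exists_bound_of_continuous hψ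
    exact hf.bdd_mul (hψ.comp continuous_snd).aestronglyMeasurable
      (c := K) (Eventually.of_forall fun z => hK z.2)
  refine ae_eq_zero_of_setIntegral_prod hf fun A B hA hB => ?_
  -- testing in time
  have h1 : ∀ ψ : ℝ → ℝ, ContDiff ℝ ∞ ψ → HasCompactSupport ψ → tsupport ψ ⊆ Ioo a b →
      ∫ t in A, (∫ x in Ioo a b, ψ x * f (t, x)) ∂(volume.restrict (Ioo 0 T)) = 0 := by
    intro ψ hψ hc hs
    have hi := (hmul ψ hψ.continuous hc).integral_prod_left
    have hz : ∀ᵐ t, t ∈ Ioo 0 T → (∫ x in Ioo a b, ψ x * f (t, x)) = 0 := by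
      refine isOpen_Ioo.ae_eq_zero_of_integral_contDiff_smul_eq_zero
        (IntegrableOn.locallyIntegrableOn hi) ?_
      intro φ hφ hcφ hsφ
      have := h φ ψ hφ hcφ hsφ hψ hc hs
      rw [setIntegral_eq_integral_of_forall_compl_eq_zero] at this
      · simpa using this
      · intro x hx
        rw [eq_zero_of_tsupport_subset_Ioo hsφ hx, zero_mul]
    have hz' := (ae_restrict_iff' measurableSet_Ioo).2 hz
    refine integral_eq_zero_of_ae ?_
    exact ae_restrict_of_ae hz'
  -- testing in space
  have hswap : ∀ ψ : ℝ → ℝ, Continuous ψ → HasCompactSupport ψ →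
      ∫ t in A, (∫ x in Ioo a b, ψ x * f (t, x)) ∂(volume.restrict (Ioo 0 T))
        = ∫ x in Ioo a b, ψ x * ∫ t in A, f (t, x) ∂(volume.restrict (Ioo 0 T)) := by
    intro ψ hψ hc
    have hm := (hmul ψ hψ hc).restrict (s := A ×ˢ univ)
    rw [← Measure.prod_restrict, Measure.restrict_univ] at hm
    rw [integral_integral_swap (f := fun t x => ψ x * f (t, x)) hm]
    simp only [integral_const_mul]
  have hfA : Integrable f
      (((volume.restrict (Ioo 0 T)).restrict A).prod (volume.restrict (Ioo a b))) := by
    have hm := hf.restrict (s := A ×ˢ univ)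
    rwa [← Measure.prod_restrict, Measure.restrict_univ] at hm
  have hiA := hfA.integral_prod_right
  have hz : ∀ᵐ x, x ∈ Ioo a b → ∫ t in A, f (t, x) ∂(volume.restrict (Ioo 0 T)) = 0 := by
    refine isOpen_Ioo.ae_eq_zero_of_integral_contDiff_smul_eq_zero
      (IntegrableOn.locallyIntegrableOn hiA) ?_
    intro ψ hψ hc hs
    have := h1 ψ hψ hc hs
    rw [hswap ψ hψ.continuous hc, setIntegral_eq_integral_of_forall_compl_eq_zero] at this
    · simpa using this
    · intro x hx
      rw [eq_zero_of_tsupport_subset_Ioo hs hx, zero_mul]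
  have hz' := (ae_restrict_iff' measurableSet_Ioo).2 hz
  have hAB : Integrable f (((volume.restrict (Ioo 0 T)).restrict A).prod
      ((volume.restrict (Ioo a b)).restrict B)) := by
    have hm := hf.restrict (s := A ×ˢ B)
    rwa [← Measure.prod_restrict] at hm
  rw [← Measure.prod_restrict, integral_prod_symm _ hAB]
  exact integral_eq_zero_of_ae (ae_restrict_of_ae hz')

/-! ### The rescaling map -/

section Rescaling

variable {H : ℝ → ℝ}

lemma one_div_tau_g_pos (hH : DoubleWell H) (ε ξ : ℝ) : 0 < 1 / (tau H ε * g H ε ξ) :=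
  one_div_pos.2 (mul_pos (tau_pos hH ε) (g_pos hH ε ξ))

lemma contDiff_one_div_tau_g (hH : DoubleWell H) (ε : ℝ) :
    ContDiff ℝ ∞ fun ξ => 1 / (tau H ε * g H ε ξ) := by
  have h : ContDiff ℝ ∞ fun ξ => tau H ε * g H ε ξ := by
    unfold g
    exact contDiff_const.mul (contDiff_const.mul (Real.contDiff_exp.comp
      (hH.smooth.neg.div_const ε)))
  exact contDiff_const.div h fun ξ => (mul_pos (tau_pos hH ε) (g_pos hH ε ξ)).ne'

lemma shat_hasDerivAt (hH : DoubleWell H) (ε ξ : ℝ) :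
    HasDerivAt (shat H ε) (1 / (tau H ε * g H ε ξ)) ξ := by
  have hc := (contDiff_one_div_tau_g hH ε).continuous
  exact intervalIntegral.integral_hasDerivAt_right (hc.intervalIntegrable _ _)
    (hc.stronglyMeasurableAtFilter _ _) hc.continuousAt

lemma deriv_shat (hH : DoubleWell H) (ε : ℝ) :
    deriv (shat H ε) = fun ξ => 1 / (tau H ε * g H ε ξ) :=
  funext fun ξ => (shat_hasDerivAt hH ε ξ).deriv

lemma shat_contDiff (hH : DoubleWell H) (ε : ℝ) : ContDiff ℝ ∞ (shat H ε) := by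
  rw [contDiff_infty_iff_deriv, deriv_shat hH]
  exact ⟨fun x => (shat_hasDerivAt hH ε x).differentiableAt, contDiff_one_div_tau_g hH ε⟩

lemma shat_strictMono (hH : DoubleWell H) (ε : ℝ) : StrictMono (shat H ε) :=
  strictMono_of_deriv_pos fun x => by
    rw [deriv_shat hH]; exact one_div_tau_g_pos hH ε x

lemma shat_neg_one (hH : DoubleWell H) (ε : ℝ) : shat H ε (-1) = -kappa H := by
  rw [shat_neg hH, shat_one hH]

lemma shat_image_Icc (hH : DoubleWell H) (ε : ℝ) : shat H ε '' Icc (-1) 1 = S H := by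
  refine Subset.antisymm (fun s ⟨ξ, hξ, h⟩ => h ▸ shat_mem hH ε hξ) ?_
  have := intermediate_value_Icc (by norm_num : (-1 : ℝ) ≤ 1)
    (shat_contDiff hH ε).continuous.continuousOn
  rwa [shat_neg_one hH, shat_one hH] at this

lemma shat_image_Ioo (hH : DoubleWell H) (ε : ℝ) :
    shat H ε '' Ioo (-1) 1 = Ioo (-kappa H) (kappa H) := by
  refine Subset.antisymm ?_ ?_
  · rintro s ⟨ξ, hξ, rfl⟩
    rw [← shat_neg_one hH ε, ← shat_one hH ε]
    exact ⟨shat_strictMono hH ε hξ.1, shat_strictMono hH ε hξ.2⟩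
  · have := intermediate_value_Ioo (by norm_num : (-1 : ℝ) ≤ 1)
      (shat_contDiff hH ε).continuous.continuousOn
    rwa [shat_neg_one hH, shat_one hH] at this

lemma shat_xihat (hH : DoubleWell H) (ε : ℝ) {s : ℝ} (hs : s ∈ S H) :
    shat H ε (xihat H ε s) = s := by
  rw [← shat_image_Icc hH ε] at hs
  exact Function.invFunOn_eq hs

lemma xihat_shat (hH : DoubleWell H) (ε : ℝ) {ξ : ℝ} (hξ : ξ ∈ Xi) :
    xihat H ε (shat H ε ξ) = ξ :=
  (shat_strictMono hH ε).injective (shat_xihat hH ε (shat_mem hH ε hξ))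

lemma xihat_strictMonoOn (hH : DoubleWell H) (ε : ℝ) : StrictMonoOn (xihat H ε) (S H) := by
  intro s hs r hr hsr
  rw [← (shat_strictMono hH ε).lt_iff_lt, shat_xihat hH ε hs, shat_xihat hH ε hr]
  exact hsr

lemma measurable_xihat (hH : DoubleWell H) (ε : ℝ) : Measurable (xihat H ε) := by
  have hS : MeasurableSet (S H) := measurableSet_Icc
  refine measurable_of_restrict_of_restrict_compl hS ?_ ?_
  · refine Monotone.measurable fun s r hsr => ?_
    exact (xihat_strictMonoOn hH ε).monotoneOn s.2 r.2 hsr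
  -- Outside `S` there is no preimage and `Function.invFunOn` takes its default value, the same for
  -- all `s`. The point `κ + 1` merely names that value.
  · have : ∀ s : ((S H)ᶜ : Set ℝ), (S H)ᶜ.domRestrict (xihat H ε) s
        = Function.invFunOn (shat H ε) (Icc (-1) 1) (kappa H + 1) := by
      intro s
      have h1 : ¬ ∃ a ∈ Icc (-1 : ℝ) 1, shat H ε a = s := by
        rintro ⟨a, ha, h⟩
        exact s.2 (h ▸ shat_mem hH ε ha)
      have h2 : ¬ ∃ a ∈ Icc (-1 : ℝ) 1, shat H ε a = kappa H + 1 := by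
        rintro ⟨a, ha, h⟩
        have := (shat_mem hH ε ha).2
        rw [h] at this; linarith
      rw [domRestrict_apply]
      unfold xihat
      rw [Function.invFunOn_neg h1, Function.invFunOn_neg h2]
    rw [funext this]
    exact measurable_const

/-- Change of variables `s = ŝ(ξ)` for nonnegative functions. -/
lemma lintegral_comp_xihat (hH : DoubleWell H) (ε : ℝ) (F : ℝ → ℝ≥0∞) :
    ∫⁻ s in Ioo (-kappa H) (kappa H), F (xihat H ε s)
      = ∫⁻ ξ in Ioo (-1) 1, ENNReal.ofReal (1 / (tau H ε * g H ε ξ)) * F ξ := by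
  rw [← shat_image_Ioo hH ε, lintegral_image_eq_lintegral_abs_deriv_mul measurableSet_Ioo
    (fun x _ => (shat_hasDerivAt hH ε x).hasDerivWithinAt)
    (shat_strictMono hH ε).injective.injOn]
  refine setLIntegral_congr_fun measurableSet_Ioo fun ξ hξ => ?_
  rw [xihat_shat hH ε (Ioo_subset_Icc_self hξ), abs_of_pos (one_div_tau_g_pos hH ε ξ)]

/-- Change of variables `s = ŝ(ξ)`. -/
lemma integral_eq_integral_shat (hH : DoubleWell H) (ε : ℝ) (F : ℝ → ℝ) :
    ∫ s in Ioo (-kappa H) (kappa H), F s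
      = ∫ ξ in Ioo (-1) 1, 1 / (tau H ε * g H ε ξ) * F (shat H ε ξ) := by
  rw [← shat_image_Ioo hH ε, integral_image_eq_integral_abs_deriv_smul measurableSet_Ioo
    (fun x _ => (shat_hasDerivAt hH ε x).hasDerivWithinAt)
    (shat_strictMono hH ε).injective.injOn]
  refine setIntegral_congr_fun measurableSet_Ioo fun ξ _ => ?_
  simp only [smul_eq_mul]
  rw [abs_of_pos (one_div_tau_g_pos hH ε ξ)]

/-- The change of variables has a density, so null sets pull back to null sets. This is what carries
almost-everywhere bounds and representations from `ξ` to `s`. -/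
lemma xihat_quasiMeasurePreserving (hH : DoubleWell H) (ε : ℝ) :
    Measure.QuasiMeasurePreserving (xihat H ε) (volume.restrict (Ioo (-kappa H) (kappa H)))
      (volume.restrict (Ioo (-1) 1)) := by
  refine ⟨measurable_xihat hH ε, Measure.AbsolutelyContinuous.mk fun A hA h0 => ?_⟩
  rw [Measure.map_apply (measurable_xihat hH ε) hA, ← lintegral_indicator_one
    (measurable_xihat hH ε hA)]
  have : ∀ s, (xihat H ε ⁻¹' A).indicator (1 : ℝ → ℝ≥0∞) s
      = A.indicator (1 : ℝ → ℝ≥0∞) (xihat H ε s) := fun s => rfl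
  simp only [this]
  rw [lintegral_comp_xihat hH]
  refine (lintegral_eq_zero_iff' ?_).2 ?_
  · refine AEMeasurable.mul ?_ ?_
    · exact (contDiff_one_div_tau_g hH ε).continuous.measurable.ennreal_ofReal.aemeasurable
    · exact (measurable_one.indicator hA).aemeasurable
  · have : ∀ᵐ ξ ∂volume.restrict (Ioo (-1 : ℝ) 1), ξ ∉ A := measure_eq_zero_iff_ae_notMem.1 h0
    filter_upwards [this] with ξ hξ
    simp [hξ]

lemma cyl_quasiMeasurePreserving (hH : DoubleWell H) (T ε : ℝ) :
    Measure.QuasiMeasurePreserving (fun z : ℝ × ℝ => (z.1, xihat H ε z.2))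
      (cyl T (-kappa H) (kappa H)) (cyl T (-1) 1) := by
  rw [cyl_eq_prod, cyl_eq_prod]
  refine ⟨measurable_fst.prodMk ((measurable_xihat hH ε).comp measurable_snd), ?_⟩
  have := (Measure.map_prod_map (volume.restrict (Ioo 0 T))
    (volume.restrict (Ioo (-kappa H) (kappa H))) measurable_id (measurable_xihat hH ε)).symm
  rw [Measure.map_id] at this
  exact (this ▸ Measure.AbsolutelyContinuous.rfl.prod
    (xihat_quasiMeasurePreserving hH ε).absolutelyContinuous)

/-- Change of variables on the cylinder. -/
lemma lintegral_cyl_comp_xihat (hH : DoubleWell H) (T ε : ℝ) {F : ℝ × ℝ → ℝ≥0∞}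
    (hF : Measurable F) :
    ∫⁻ z, F (z.1, xihat H ε z.2) ∂cyl T (-kappa H) (kappa H)
      = ∫⁻ t in Ioo 0 T, ∫⁻ ξ in Ioo (-1) 1,
          ENNReal.ofReal (1 / (tau H ε * g H ε ξ)) * F (t, ξ) := by
  have hm : Measurable fun z : ℝ × ℝ => F (z.1, xihat H ε z.2) :=
    hF.comp (measurable_fst.prodMk ((measurable_xihat hH ε).comp measurable_snd))
  rw [cyl_eq_prod, lintegral_prod _ hm.aemeasurable]
  refine lintegral_congr fun t => ?_
  exact lintegral_comp_xihat hH ε fun ξ => F (t, ξ)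

end Rescaling

/-! ### Concentration -/

/-- Laplace's principle in its crudest form: the numerator is at most a constant times `e^{M/ε}`,
the denominator at least a constant times `e^{M'/ε}`, and `M < M'`. It is used with `F = H` for the
rescaling and with `F = -H` for the invariant measure. -/
lemma tendsto_exp_ratio {F : ℝ → ℝ} (hF : Continuous F) {a b c d p q M M' : ℝ} (hab : a ≤ b)
    (hcd : c < d) (hpc : p ≤ c) (hdq : d ≤ q) (hM : ∀ x ∈ Icc a b, F x ≤ M)
    (hM' : ∀ x ∈ Icc c d, M' ≤ F x) (hMM' : M < M') {ε : ℕ → ℝ} (hε : ∀ n, 0 < ε n)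
    (hε0 : Tendsto ε atTop (𝓝 0)) :
    Tendsto (fun n => (∫ x in a..b, Real.exp (F x / ε n)) / ∫ x in p..q, Real.exp (F x / ε n))
      atTop (𝓝 0) := by
  have hi : ∀ n a b, IntervalIntegrable (fun x => Real.exp (F x / ε n)) volume a b := fun n a b =>
    (by fun_prop : Continuous fun x => Real.exp (F x / ε n)).intervalIntegrable _ _
  have hlow : ∀ n, (d - c) * Real.exp (M' / ε n) ≤ ∫ x in p..q, Real.exp (F x / ε n) := by
    intro n
    calc (d - c) * Real.exp (M' / ε n) = ∫ x in c..d, Real.exp (M' / ε n) := by simp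
      _ ≤ ∫ x in c..d, Real.exp (F x / ε n) := by
        refine intervalIntegral.integral_mono_on hcd.le (by simp) (hi n _ _) fun x hx => ?_
        exact Real.exp_le_exp.2 (div_le_div_of_nonneg_right (hM' x hx) (hε n).le)
      _ ≤ ∫ x in p..q, Real.exp (F x / ε n) :=
        intervalIntegral.integral_mono_interval hpc hcd.le hdq
          (Eventually.of_forall fun x => (Real.exp_pos _).le) (hi n _ _)
  have hup : ∀ n, ∫ x in a..b, Real.exp (F x / ε n) ≤ (b - a) * Real.exp (M / ε n) := by
    intro n
    calc ∫ x in a..b, Real.exp (F x / ε n) ≤ ∫ x in a..b, Real.exp (M / ε n) := by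
          refine intervalIntegral.integral_mono_on hab (hi n _ _) (by simp) fun x hx => ?_
          exact Real.exp_le_exp.2 (div_le_div_of_nonneg_right (hM x hx) (hε n).le)
      _ = (b - a) * Real.exp (M / ε n) := by simp
  have hbound : ∀ n, (∫ x in a..b, Real.exp (F x / ε n)) / ∫ x in p..q, Real.exp (F x / ε n)
      ≤ (b - a) / (d - c) * Real.exp (-((M' - M) * (ε n)⁻¹)) := by
    intro n
    have hdc : 0 < d - c := sub_pos.2 hcd
    calc _ ≤ ((b - a) * Real.exp (M / ε n)) / ((d - c) * Real.exp (M' / ε n)) :=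
          div_le_div₀ (mul_nonneg (sub_nonneg.2 hab) (Real.exp_pos _).le) (hup n)
            (mul_pos hdc (Real.exp_pos _)) (hlow n)
      _ = (b - a) / (d - c) * Real.exp (-((M' - M) * (ε n)⁻¹)) := by
          rw [mul_div_mul_comm, ← Real.exp_sub]
          congr 2
          rw [div_eq_mul_inv, div_eq_mul_inv]; ring
  have hlim : Tendsto (fun n => (b - a) / (d - c) * Real.exp (-((M' - M) * (ε n)⁻¹)))
      atTop (𝓝 0) := by
    have h1 : Tendsto (fun n => (ε n)⁻¹) atTop atTop :=
      tendsto_inv_nhdsGT_zero.comp (tendsto_nhdsWithin_iff.2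
        ⟨hε0, Eventually.of_forall fun n => hε n⟩)
    have h2 := Real.tendsto_exp_neg_atTop_nhds_zero.comp
      (h1.const_mul_atTop (sub_pos.2 hMM'))
    simpa using h2.const_mul ((b - a) / (d - c))
  refine squeeze_zero (fun n => ?_) hbound hlim
  refine div_nonneg (intervalIntegral.integral_nonneg hab fun x _ => (Real.exp_pos _).le) ?_
  exact (mul_nonneg (sub_pos.2 hcd).le (Real.exp_pos _).le).trans (hlow n)

section Concentration

variable {H : ℝ → ℝ}

/-- Away from the origin the rescaled coordinate converges to an end point. -/
lemma tendsto_shat (hH : DoubleWell H) {ε : ℕ → ℝ} (hε : ∀ n, 0 < ε n)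
    (hε0 : Tendsto ε atTop (𝓝 0)) {δ : ℝ} (hδ : 0 < δ) (hδ1 : δ ≤ 1) :
    Tendsto (fun n => shat H (ε n) δ) atTop (𝓝 (kappa H)) := by
  have hc : Continuous H := hH.smooth.continuous
  obtain ⟨x₀, hx₀, hmax⟩ := isCompact_Icc.exists_isMaxOn (nonempty_Icc.2 hδ1) hc.continuousOn
  have hM : H x₀ < 1 := hH.lt_one x₀ ⟨by linarith [hx₀.1], hx₀.2⟩ (by linarith [hx₀.1])
  -- A level strictly between the maximum of `H` on `[δ,1]` and the saddle value `1`; by continuity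
  -- `H` exceeds it on some `[0,r']`.
  set M' := (H x₀ + 1) / 2
  have hM0 : M' < H 0 := by rw [hH.zero]; simp only [M']; linarith
  obtain ⟨r, hr, hr'⟩ := Metric.eventually_nhds_iff.1
    (hc.continuousAt.eventually (lt_mem_nhds hM0))
  set r' := min (r / 2) 1
  have hr'0 : 0 < r' := lt_min (by linarith) one_pos
  have hrat := tendsto_exp_ratio hc hδ1 hr'0 (le_refl 0) (min_le_right _ _ : r' ≤ 1)
    (fun x hx => hmax hx) (M' := M') (fun x hx => (hr' (by
      rw [Real.dist_eq, sub_zero, abs_of_nonneg hx.1]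
      have : r' ≤ r / 2 := min_le_left _ _
      linarith [hx.2])).le) (by simp only [M']; linarith) hε hε0
  have hZ : ∀ n, 0 < Z H (ε n) := by
    intro n
    have h1 := g_pos hH (ε n) 0
    unfold g at h1
    exact inv_pos.1 (pos_of_mul_pos_left h1 (Real.exp_pos _).le)
  have hform : ∀ n a b, ∫ η in a..b, 1 / (tau H (ε n) * g H (ε n) η)
      = Z H (ε n) / tau H (ε n) * ∫ η in a..b, Real.exp (H η / ε n) := by
    intro n a b
    rw [← intervalIntegral.integral_const_mul]
    refine intervalIntegral.integral_congr fun η _ => ?_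
    simp only [g]
    rw [neg_div, Real.exp_neg]
    have := (hZ n).ne'
    have := (tau_pos hH (ε n)).ne'
    field_simp
  have hi : ∀ n a b, IntervalIntegrable (fun η => 1 / (tau H (ε n) * g H (ε n) η)) volume a b :=
    fun n a b => (contDiff_one_div_tau_g hH (ε n)).continuous.intervalIntegrable _ _
  -- The normalisation `ŝ(1) = κ` removes the prefactor `Z/τ`, so the asymptotics of `τ` are never
  -- needed.
  have heq : ∀ n, kappa H - kappa H * ((∫ x in δ..1, Real.exp (H x / ε n)) /
      ∫ x in (0 : ℝ)..1, Real.exp (H x / ε n)) = shat H (ε n) δ := by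
    intro n
    have h1 : kappa H = Z H (ε n) / tau H (ε n) * ∫ x in (0 : ℝ)..1, Real.exp (H x / ε n) := by
      rw [← shat_one hH (ε n), ← hform]; rfl
    have h2 : shat H (ε n) δ + ∫ η in δ..1, 1 / (tau H (ε n) * g H (ε n) η) = kappa H := by
      rw [← shat_one hH (ε n)]
      exact intervalIntegral.integral_add_adjacent_intervals (hi n _ _) (hi n _ _)
    rw [hform] at h2
    have h3 : (∫ x in (0 : ℝ)..1, Real.exp (H x / ε n)) ≠ 0 := by
      intro h; rw [h, mul_zero] at h1; exact (kappa_pos hH).ne' h1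
    have h4 : kappa H * ((∫ x in δ..1, Real.exp (H x / ε n)) /
      ∫ x in (0 : ℝ)..1, Real.exp (H x / ε n))
        = Z H (ε n) / tau H (ε n) * ∫ x in δ..1, Real.exp (H x / ε n) := by
      rw [h1]; field_simp
    linarith
  have := (hrat.const_mul (kappa H)).const_sub (kappa H)
  rw [mul_zero, sub_zero] at this
  exact this.congr heq

lemma measurableEmbedding_Xi : MeasurableEmbedding (Subtype.val : Xi → ℝ) :=
  MeasurableEmbedding.subtype_coe measurableSet_Icc

lemma lintegral_gam (hH : DoubleWell H) (ε : ℝ) {F : ℝ → ℝ≥0∞} (hF : Measurable F) :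
    ∫⁻ x : Xi, F x ∂gam H ε = ∫⁻ ξ in Ioo (-1) 1, ENNReal.ofReal (g H ε ξ) * F ξ := by
  have hg : Measurable fun ξ : Xi => ENNReal.ofReal (g H ε ξ) :=
    ((g_continuous hH ε).measurable.comp measurable_subtype_coe).ennreal_ofReal
  have h0 := lintegral_withDensity_eq_lintegral_mul (leb Xi) hg (hF.comp measurable_subtype_coe)
  simp only [Function.comp_def] at h0
  rw [gam, h0, leb]
  have := lintegral_subtype_comap (s := Xi) measurableSet_Icc
    (fun ξ => ENNReal.ofReal (g H ε ξ) * F ξ) (μ := volume)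
  simp only [Pi.mul_apply]
  rw [this]
  exact setLIntegral_congr Ioo_ae_eq_Icc.symm

lemma integral_gam (hH : DoubleWell H) (ε : ℝ) (F : ℝ → ℝ) :
    ∫ x : Xi, F x ∂gam H ε = ∫ ξ in Ioo (-1) 1, g H ε ξ * F ξ := by
  have hg : Measurable fun ξ : Xi => (g H ε ξ).toNNReal :=
    ((g_continuous hH ε).measurable.comp measurable_subtype_coe).real_toNNReal
  have h1 : gam H ε = (leb Xi).withDensity fun ξ => ((g H ε ξ).toNNReal : ℝ≥0∞) := rfl
  rw [h1, integral_withDensity_eq_integral_smul hg, leb]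
  have := integral_subtype_comap (s := Xi) measurableSet_Icc
    (fun ξ => (g H ε ξ).toNNReal • F ξ) (μ := volume)
  rw [this]
  rw [setIntegral_congr_set Ioo_ae_eq_Icc.symm]
  refine integral_congr_ae (Eventually.of_forall fun ξ => ?_)
  simp only [NNReal.smul_def, smul_eq_mul]
  rw [Real.coe_toNNReal _ (g_pos hH ε ξ).le]

lemma ae_gam_iff (hH : DoubleWell H) (ε : ℝ) {P : ℝ → Prop} :
    (∀ᵐ x : Xi ∂gam H ε, P x) ↔ ∀ᵐ ξ ∂volume.restrict (Ioo (-1) 1), P ξ := by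
  have hg : Measurable fun ξ : Xi => ENNReal.ofReal (g H ε ξ) :=
    ((g_continuous hH ε).measurable.comp measurable_subtype_coe).ennreal_ofReal
  have h1 : (∀ᵐ x : Xi ∂gam H ε, P x) ↔ ∀ᵐ x : Xi ∂leb Xi, P x := by
    rw [gam, ae_withDensity_iff hg]
    refine eventually_congr (Eventually.of_forall fun x => ?_)
    have : ENNReal.ofReal (g H ε x) ≠ 0 := (ENNReal.ofReal_pos.2 (g_pos hH ε x)).ne'
    simp [this]
  rw [h1, leb, ← measurableEmbedding_Xi.ae_map_iff, map_comap_subtype_coe measurableSet_Icc,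
    Measure.restrict_congr_set Ioo_ae_eq_Icc]

lemma integral_g (hH : DoubleWell H) (ε : ℝ) : ∫ ξ in Ioo (-1) 1, g H ε ξ = 1 := by
  have hZ : 0 < Z H ε := by
    have h1 := g_pos hH ε 0
    unfold g at h1
    exact inv_pos.1 (pos_of_mul_pos_left h1 (Real.exp_pos _).le)
  rw [← integral_Ioc_eq_integral_Ioo, ← intervalIntegral.integral_of_le (by norm_num)]
  simp only [g]
  rw [intervalIntegral.integral_const_mul]
  exact inv_mul_cancel₀ hZ.ne'

lemma isProbabilityMeasure_gam (hH : DoubleWell H) (ε : ℝ) : IsProbabilityMeasure (gam H ε) := by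
  refine ⟨?_⟩
  have h := lintegral_gam hH ε (F := fun _ => 1) measurable_const
  simp only [lintegral_one, mul_one] at h
  rw [h, ← ofReal_integral_eq_lintegral_ofReal, integral_g hH, ENNReal.ofReal_one]
  · exact ((g_continuous hH ε).continuousOn.integrableOn_Icc).mono_set Ioo_subset_Icc_self
  · exact Eventually.of_forall fun ξ => (g_pos hH ε ξ).le

/-- On `[-η,η]` the potential stays above a positive minimum, whereas near the well `1` it is below
half of that minimum; the Laplace estimate for `-H` compares the two regions. -/
lemma tendsto_gam_core (hH : DoubleWell H) {ε : ℕ → ℝ} (hε : ∀ n, 0 < ε n)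
    (hε0 : Tendsto ε atTop (𝓝 0)) {η : ℝ} (hη : 0 ≤ η) (hη1 : η < 1) :
    Tendsto (fun n => (gam H (ε n)).real {x : Xi | |(x : ℝ)| < η}) atTop (𝓝 0) := by
  have hc : Continuous H := hH.smooth.continuous
  obtain ⟨x₀, hx₀, hmin⟩ := isCompact_Icc.exists_isMinOn
    (nonempty_Icc.2 (by linarith : -η ≤ η)) hc.continuousOn
  have hM : 0 < H x₀ := hH.pos x₀ ⟨by linarith [hx₀.1], by linarith [hx₀.2]⟩
  have hM1 : H 1 < H x₀ / 2 := by rw [hH.one]; linarith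
  obtain ⟨r, hr, hr'⟩ := Metric.eventually_nhds_iff.1
    (hc.continuousAt.eventually (gt_mem_nhds hM1))
  set r' := min (r / 2) 1
  have hr'0 : 0 < r' := lt_min (by linarith) one_pos
  have hr'1 : r' ≤ 1 := min_le_right _ _
  have hrat := tendsto_exp_ratio hc.neg (by linarith : -η ≤ η) (by linarith : 1 - r' < 1)
    (by linarith : (-1 : ℝ) ≤ 1 - r') (le_refl 1)
    (M := -H x₀) (fun x hx => neg_le_neg (hmin hx)) (M' := -(H x₀ / 2))
    (fun x hx => neg_le_neg (hr' (by
      rw [Real.dist_eq, abs_sub_comm, abs_of_nonneg (by linarith [hx.2])]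
      have : r' ≤ r / 2 := min_le_left _ _
      linarith [hx.1])).le) (by linarith) hε hε0
  refine squeeze_zero (fun n => measureReal_nonneg) (fun n => ?_) hrat
  have hp := isProbabilityMeasure_gam hH (ε n)
  have hms : MeasurableSet {x : Xi | |(x : ℝ)| < η} :=
    measurableSet_lt (measurable_subtype_coe.abs) measurable_const
  have h1 : (gam H (ε n)).real {x : Xi | |(x : ℝ)| < η}
      = ∫ x : Xi, (Ioo (-η) η).indicator (fun _ => (1 : ℝ)) x ∂gam H (ε n) := by
    rw [← integral_indicator_one hms]
    refine integral_congr_ae (Eventually.of_forall fun x => ?_)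
    simp [indicator_apply, abs_lt]
  have h2 : ∀ ξ, g H (ε n) ξ * (Ioo (-η) η).indicator (fun _ => (1 : ℝ)) ξ
      = (Ioo (-η) η).indicator (g H (ε n)) ξ := by
    intro ξ; by_cases h : ξ ∈ Ioo (-η) η <;> simp [h]
  rw [h1, integral_gam hH]
  simp only [h2]
  rw [setIntegral_indicator measurableSet_Ioo, inter_eq_right.2
    (Ioo_subset_Ioo (by linarith) hη1.le), ← integral_Ioc_eq_integral_Ioo,
    ← intervalIntegral.integral_of_le (by linarith)]
  simp only [g]
  rw [intervalIntegral.integral_const_mul, mul_comm, div_eq_mul_inv]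
  rfl

lemma integrable_of_continuous_Xi {μ : Measure Xi} [IsFiniteMeasure μ] {ψ : Xi → ℝ}
    (hψ : Continuous ψ) : Integrable ψ μ :=
  (BoundedContinuousFunction.mkOfCompact ⟨ψ, hψ⟩).integrable μ

/-- The integral is split at `|x| = η`: outside, the integrand is eventually small and `γ` is a
probability measure; inside, the integrand is bounded and `γ` of the core vanishes. -/
lemma tendsto_integral_gam_zero (hH : DoubleWell H) {ε : ℕ → ℝ} (hε : ∀ n, 0 < ε n)
    (hε0 : Tendsto ε atTop (𝓝 0)) {ψ : ℕ → Xi → ℝ} {M : ℝ} (hc : ∀ n, Continuous (ψ n))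
    (h0 : ∀ n x, 0 ≤ ψ n x) (hM : ∀ n x, ψ n x ≤ M)
    (hψ : ∀ e > 0, ∃ η ∈ Ico (0 : ℝ) 1, ∀ᶠ n in atTop, ∀ x : Xi, η ≤ |(x : ℝ)| → ψ n x ≤ e) :
    Tendsto (fun n => ∫ x, ψ n x ∂gam H (ε n)) atTop (𝓝 0) := by
  have hintg : ∀ n, 0 ≤ ∫ x, ψ n x ∂gam H (ε n) := fun n => integral_nonneg (h0 n)
  have hM0 : 0 ≤ M := (h0 0 ⟨0, by norm_num⟩).trans (hM 0 _)
  rw [Metric.tendsto_atTop']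
  intro e he
  obtain ⟨η, hη, hev⟩ := hψ (e / 2) (by linarith)
  have hcore := (tendsto_gam_core hH hε hε0 hη.1 hη.2).const_mul M
  rw [mul_zero] at hcore
  obtain ⟨N, hN⟩ := eventually_atTop.1 (hev.and (hcore.eventually (gt_mem_nhds (by linarith :
    (0 : ℝ) < e / 2))))
  refine ⟨N, fun n hn => ?_⟩
  obtain ⟨h1, h2⟩ := hN n hn.le
  have hp := isProbabilityMeasure_gam hH (ε n)
  have hms : MeasurableSet {x : Xi | |(x : ℝ)| < η} :=
    measurableSet_lt (measurable_subtype_coe.abs) measurable_const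
  rw [Real.dist_eq, sub_zero, abs_of_nonneg (hintg n)]
  calc ∫ x, ψ n x ∂gam H (ε n)
      ≤ ∫ x, (e / 2 + {x : Xi | |(x : ℝ)| < η}.indicator (fun _ => M) x) ∂gam H (ε n) := by
        refine integral_mono (integrable_of_continuous_Xi (hc n))
          ((integrable_const _).add ((integrable_const _).indicator hms)) fun x => ?_
        by_cases hx : |(x : ℝ)| < η
        · simp only [mem_ofPred_eq, hx, indicator_of_mem]
          linarith [hM n x]
        · simp only [mem_ofPred_eq, hx, not_false_eq_true, indicator_of_notMem, add_zero]
          exact h1 x (not_lt.1 hx)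
    _ = e / 2 + M * (gam H (ε n)).real {x : Xi | |(x : ℝ)| < η} := by
        rw [integral_add (integrable_const _) ((integrable_const _).indicator hms),
          integral_indicator_const _ hms]
        simp [mul_comm]
    _ < e := by linarith

lemma continuous_shat_Xi (hH : DoubleWell H) (ε : ℝ) : Continuous fun x : Xi => shat H ε x :=
  (shat_contDiff hH ε).continuous.comp continuous_subtype_val

/-- Measures dominated by `γ_n` concentrate at the two wells; the weights are determined by the
mass and by the mean of the rescaled coordinate. -/
lemma tendsto_integral_of_dominated (hH : DoubleWell H) {ε : ℕ → ℝ} (hε : ∀ n, 0 < ε n)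
    (hε0 : Tendsto ε atTop (𝓝 0)) {μ : ℕ → Measure Xi} [∀ n, IsFiniteMeasure (μ n)] {m C F : ℝ}
    (hmass : ∀ n, (μ n).real univ = m)
    (hdom : ∀ n, ∀ ψ : Xi → ℝ, Continuous ψ → (∀ x, 0 ≤ ψ x) →
      ∫ x, ψ x ∂μ n ≤ C * ∫ x, ψ x ∂gam H (ε n))
    (hF : Tendsto (fun n => ∫ x : Xi, shat H (ε n) x ∂μ n) atTop (𝓝 F))
    {Φ : ℕ → Xi → ℝ} {M α β : ℝ} (hc : ∀ n, Continuous (Φ n)) (hM : ∀ n x, |Φ n x| ≤ M)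
    (hα : ∀ e > 0, ∃ η ∈ Ico (0 : ℝ) 1, ∀ᶠ n in atTop, ∀ x : Xi, (x : ℝ) ≤ -η → |Φ n x - α| ≤ e)
    (hβ : ∀ e > 0, ∃ η ∈ Ico (0 : ℝ) 1, ∀ᶠ n in atTop, ∀ x : Xi, η ≤ (x : ℝ) → |Φ n x - β| ≤ e) :
    Tendsto (fun n => ∫ x, Φ n x ∂μ n) atTop
      (𝓝 (α * ((m - F / kappa H) / 2) + β * ((m + F / kappa H) / 2))) := by
  have hk := kappa_pos hH
  -- The affine function of `ŝ` with value `α` at `-κ` and `β` at `κ`. Its integral is computed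
  -- exactly from mass and mean, while `Φ - L` is small near both wells and so, by domination,
  -- negligible for `μ`.
  set L : ℕ → Xi → ℝ := fun n x => (α + β) / 2 + (β - α) / 2 * (shat H (ε n) x / kappa H) with hL
  have hLc : ∀ n, Continuous (L n) := fun n =>
    continuous_const.add (continuous_const.mul ((continuous_shat_Xi hH _).div_const _))
  have hsb : ∀ n (x : Xi), |shat H (ε n) x / kappa H| ≤ 1 := by
    intro n x
    have := shat_mem hH (ε n) x.2
    rw [abs_div, abs_of_pos hk, div_le_one hk, abs_le]
    exact this
  have hLint : ∀ n, ∫ x, L n x ∂μ n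
      = (α + β) / 2 * m + (β - α) / 2 * ((∫ x : Xi, shat H (ε n) x ∂μ n) / kappa H) := by
    intro n
    simp only [hL]
    rw [integral_add (integrable_const _) ((integrable_of_continuous_Xi
      ((continuous_shat_Xi hH _).div_const _)).const_mul _), integral_const_mul, integral_const, hmass n,
      ← integral_div, smul_eq_mul, mul_comm]
  have hLlim : Tendsto (fun n => ∫ x, L n x ∂μ n) atTop
      (𝓝 (α * ((m - F / kappa H) / 2) + β * ((m + F / kappa H) / 2))) := by
    have := ((hF.div_const (kappa H)).const_mul ((β - α) / 2)).const_add ((α + β) / 2 * m)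
    refine (this.congr fun n => (hLint n).symm).trans_eq ?_
    congr 1; ring
  have hzero : Tendsto (fun n => ∫ x, |Φ n x - L n x| ∂gam H (ε n)) atTop (𝓝 0) := by
    refine tendsto_integral_gam_zero hH hε hε0 (M := M + (|α + β| / 2 + |β - α| / 2))
      (fun n => ((hc n).sub (hLc n)).abs) (fun n x => abs_nonneg _) (fun n x => ?_) fun e he => ?_
    · refine (abs_sub _ _).trans (add_le_add (hM n x) ((abs_add_le _ _).trans ?_))
      rw [abs_mul, abs_div, abs_div, abs_two]
      have := mul_le_mul_of_nonneg_left (hsb n x) (by positivity : 0 ≤ |β - α| / 2)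
      linarith
    · obtain ⟨η₁, h1, ev1⟩ := hα (e / 2) (by linarith)
      obtain ⟨η₂, h2, ev2⟩ := hβ (e / 2) (by linarith)
      -- The third entry only keeps `η` positive, as the convergence of `ŝ(η)` to `κ` requires.
      set η := max (max η₁ η₂) (1 / 2) with hη
      have hη0 : 0 < η := lt_of_lt_of_le (by norm_num) (le_max_right _ _)
      have hη1 : η < 1 := max_lt (max_lt h1.2 h2.2) (by norm_num)
      have hs := tendsto_shat hH hε hε0 hη0 hη1.le
      have hs' : Tendsto (fun n => |β - α| / 2 * (1 - shat H (ε n) η / kappa H)) atTop (𝓝 0) := by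
        have := ((hs.div_const (kappa H)).const_sub 1).const_mul (|β - α| / 2)
        rwa [div_self hk.ne', sub_self, mul_zero] at this
      refine ⟨η, ⟨hη0.le, hη1⟩, ?_⟩
      filter_upwards [ev1, ev2, hs'.eventually (gt_mem_nhds (by linarith : (0 : ℝ) < e / 2))]
        with n e1 e2 e3 x hx
      have hmono := (shat_strictMono hH (ε n)).monotone
      rcases le_abs.1 hx with hx | hx
      · have b1 := e2 x (((le_max_right η₁ η₂).trans (le_max_left _ _)).trans hx)
        have b2 : |β - L n x| ≤ e / 2 := by
          have : β - L n x = (β - α) / 2 * (1 - shat H (ε n) x / kappa H) := by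
            simp only [hL]; ring
          rw [this, abs_mul, abs_div, abs_two]
          refine le_trans (mul_le_mul_of_nonneg_left ?_ (by positivity)) e3.le
          rw [abs_of_nonneg (by linarith [(abs_le.1 (hsb n x)).2])]
          have := div_le_div_of_nonneg_right (hmono hx) hk.le
          linarith
        have := abs_sub_le (Φ n x) β (L n x)
        linarith
      · have hx' : (x : ℝ) ≤ -η := by linarith
        have b1 := e1 x (hx'.trans (neg_le_neg ((le_max_left η₁ η₂).trans (le_max_left _ _))))
        have b2 : |α - L n x| ≤ e / 2 := by
          have : α - L n x = -((β - α) / 2 * (1 + shat H (ε n) x / kappa H)) := by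
            simp only [hL]; ring
          rw [this, abs_neg, abs_mul, abs_div, abs_two]
          refine le_trans (mul_le_mul_of_nonneg_left ?_ (by positivity)) e3.le
          rw [abs_of_nonneg (by linarith [(abs_le.1 (hsb n x)).1])]
          have := div_le_div_of_nonneg_right (hmono hx') hk.le
          rw [shat_neg hH, neg_div] at this
          linarith
        have := abs_sub_le (Φ n x) α (L n x)
        linarith
  have hdiff : Tendsto (fun n => ∫ x, Φ n x ∂μ n - ∫ x, L n x ∂μ n) atTop (𝓝 0) := by
    have hz := hzero.const_mul C
    rw [mul_zero] at hz
    refine squeeze_zero_norm (fun n => ?_) hz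
    rw [← integral_sub (integrable_of_continuous_Xi (hc n)) (integrable_of_continuous_Xi (hLc n))]
    exact (abs_integral_le_integral_abs).trans
      (hdom n _ ((hc n).sub (hLc n)).abs fun x => abs_nonneg _)
  have := hdiff.add hLlim
  rw [zero_add] at this
  exact this.congr fun n => by ring

/-- The density `g` is even and `ŝ` is odd. Hence `γ` itself falls under
`tendsto_integral_of_dominated` with mean zero, which gives equal weights to the two wells. -/
lemma integral_shat_gam (hH : DoubleWell H) (ε : ℝ) : ∫ x : Xi, shat H ε x ∂gam H ε = 0 := by
  rw [integral_gam hH, ← integral_Ioc_eq_integral_Ioo,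
    ← intervalIntegral.integral_of_le (by norm_num)]
  have h := intervalIntegral.integral_comp_neg (a := -1) (b := 1)
    (fun ξ => g H ε ξ * shat H ε ξ)
  have he : ∀ η, g H ε (-η) = g H ε η := fun η => by simp [g, hH.even]
  simp only [he, shat_neg hH, neg_neg, mul_neg] at h
  rw [intervalIntegral.integral_neg] at h
  linarith

end Concentration

/-! ### Densities of a single curve and their consequences at every time -/

lemma ae_cyl_mem (T a b : ℝ) : ∀ᵐ z ∂cyl T a b, z.1 ∈ Ioo 0 T ∧ z.2 ∈ Ioo a b := by
  have h : MeasurableSet (Ioo 0 T ×ˢ Ioo a b) := measurableSet_Ioo.prod measurableSet_Ioo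
  filter_upwards [ae_restrict_mem h] with z hz
  exact hz

section SingleCurve

variable {H : ℝ → ℝ} {ε T m C : ℝ} {ρ : ℝ → FiniteMeasure Xi} {u v : ℝ → ℝ → ℝ}

lemma lintegral_of_isDensity (hH : DoubleWell H) {μ : Measure Xi} {f : ℝ → ℝ} (hf : Measurable f)
    (h : IsDensity μ (gam H ε) f) {F : ℝ → ℝ≥0∞} (hF : Measurable F) :
    ∫⁻ x : Xi, F x ∂μ
      = ∫⁻ ξ in Ioo (-1) 1, ENNReal.ofReal (g H ε ξ) * (ENNReal.ofReal (f ξ) * F ξ) := by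
  have h0 := lintegral_withDensity_eq_lintegral_mul (gam H ε)
    (hf.comp measurable_subtype_coe).ennreal_ofReal (hF.comp measurable_subtype_coe)
  simp only [Function.comp_def] at h0
  have h2 := lintegral_gam hH ε (F := fun ξ => ENNReal.ofReal (f ξ) * F ξ)
    (hf.ennreal_ofReal.mul hF)
  rw [h.2, h0, ← h2]
  rfl

lemma integral_of_isDensity (hH : DoubleWell H) {μ : Measure Xi} {f : ℝ → ℝ} (hf : Measurable f)
    (h : IsDensity μ (gam H ε) f) (F : ℝ → ℝ) :
    ∫ x : Xi, F x ∂μ = ∫ ξ in Ioo (-1) 1, g H ε ξ * (f ξ * F ξ) := by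
  have h1 : μ = (gam H ε).withDensity fun x => ((f x).toNNReal : ℝ≥0∞) := h.2
  have hm : Measurable fun x : Xi => (f x).toNNReal :=
    (hf.comp measurable_subtype_coe).real_toNNReal
  rw [h1, integral_withDensity_eq_integral_smul hm, ← integral_gam hH ε (fun ξ => f ξ * F ξ)]
  refine integral_congr_ae ?_
  filter_upwards [h.1] with x hx
  rw [NNReal.smul_def, smul_eq_mul, Real.coe_toNNReal _ hx]

lemma ae_nonneg_of_isDensity (hH : DoubleWell H) {μ : Measure Xi} {f : ℝ → ℝ}
    (h : IsDensity μ (gam H ε) f) : ∀ᵐ ξ ∂volume.restrict (Ioo (-1) 1), 0 ≤ f ξ :=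
  (ae_gam_iff hH ε).1 h.1

/-- The infimum defining `dissipation` ranges over its own choice of density; uniqueness allows the
given one to replace it. -/
lemma ae_eq_of_isDensity (hH : DoubleWell H) {μ : Measure Xi} {f f' : ℝ → ℝ} (hf : Measurable f)
    (hf' : Measurable f') [IsFiniteMeasure μ] (h : IsDensity μ (gam H ε) f)
    (h' : IsDensity μ (gam H ε) f') : f =ᵐ[volume.restrict (Ioo (-1) 1)] f' := by
  have hp := isProbabilityMeasure_gam hH ε
  have hm : Measurable fun x : Xi => ENNReal.ofReal (f x) :=
    (hf.comp measurable_subtype_coe).ennreal_ofReal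
  have hm' : Measurable fun x : Xi => ENNReal.ofReal (f' x) :=
    (hf'.comp measurable_subtype_coe).ennreal_ofReal
  have he : (gam H ε).withDensity (fun x => ENNReal.ofReal (f x))
      = (gam H ε).withDensity fun x => ENNReal.ofReal (f' x) := by rw [← h.2, ← h'.2]
  have := (withDensity_eq_iff hm.aemeasurable hm'.aemeasurable (by
    have h3 := measure_ne_top μ univ
    rwa [h.2, withDensity_apply _ .univ, Measure.restrict_univ] at h3)).1 he
  refine (ae_gam_iff hH ε (P := fun ξ => f ξ = f' ξ)).1 ?_
  filter_upwards [this, h.1, h'.1] with x hx h1 h2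
  exact (ENNReal.ofReal_eq_ofReal_iff h1 h2).1 hx

/-- The uniform bounds on the density as a function on the cylinder. -/
lemma ae_cyl_bounds (hH : DoubleWell H) (hC : 0 ≤ C) (hu_meas : Measurable (Function.uncurry u))
    (hu : ∀ t ∈ Icc 0 T, IsDensity (ρ t : Measure Xi) (gam H ε) (u t))
    (hb : eLpNorm (Function.uncurry u) ∞ (cyl T (-1) 1) ≤ ENNReal.ofReal C) :
    ∀ᵐ z ∂cyl T (-1) 1, 0 ≤ Function.uncurry u z ∧ Function.uncurry u z ≤ C := by
  have h1 : ∀ᵐ z ∂cyl T (-1) 1, 0 ≤ Function.uncurry u z := by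
    rw [cyl_eq_prod, Measure.ae_prod_iff_ae_ae (measurableSet_le measurable_const hu_meas)]
    refine (ae_restrict_iff' measurableSet_Ioo).2 (Eventually.of_forall fun t ht => ?_)
    exact ae_nonneg_of_isDensity hH (hu t (Ioo_subset_Icc_self ht))
  rw [eLpNorm_exponent_top] at hb
  filter_upwards [h1, ae_le_eLpNormEssSup (f := Function.uncurry u) (μ := cyl T (-1) 1)]
    with z hz hz'
  refine ⟨hz, ?_⟩
  have h2 := hz'.trans hb
  rw [← ofReal_norm, ENNReal.ofReal_le_ofReal_iff hC] at h2
  exact (le_abs_self _).trans h2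

lemma ae_slice_bounds (hu_meas : Measurable (Function.uncurry u))
    (hb : ∀ᵐ z ∂cyl T (-1) 1, 0 ≤ Function.uncurry u z ∧ Function.uncurry u z ≤ C) :
    ∀ᵐ t ∂volume.restrict (Ioo 0 T), ∀ᵐ ξ ∂volume.restrict (Ioo (-1) 1),
      0 ≤ u t ξ ∧ u t ξ ≤ C := by
  rwa [cyl_eq_prod, Measure.ae_prod_iff_ae_ae] at hb
  exact (measurableSet_le measurable_const hu_meas).inter
    (measurableSet_le hu_meas measurable_const)

lemma continuousOn_integral {K : Set ℝ} [CompactSpace K] {ρ : ℝ → FiniteMeasure K} {s : Set ℝ}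
    (hρ : ContinuousOn ρ s) {ψ : K → ℝ} (hψ : Continuous ψ) :
    ContinuousOn (fun t => ∫ x, ψ x ∂(ρ t : Measure K)) s := by
  intro t ht
  exact (FiniteMeasure.tendsto_iff_forall_integral_tendsto.1 (hρ t ht))
    (BoundedContinuousFunction.mkOfCompact ⟨ψ, hψ⟩)

/-- The bound on the density gives a domination at every time, by continuity. -/
lemma integral_le_of_bounds (hH : DoubleWell H) (hT : 0 < T) (hρ : ContinuousOn ρ (Icc 0 T))
    (hu_meas : Measurable (Function.uncurry u))
    (hu : ∀ t ∈ Icc 0 T, IsDensity (ρ t : Measure Xi) (gam H ε) (u t))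
    (hb : ∀ᵐ z ∂cyl T (-1) 1, 0 ≤ Function.uncurry u z ∧ Function.uncurry u z ≤ C)
    {t : ℝ} (ht : t ∈ Icc 0 T) {ψ : Xi → ℝ} (hψ : Continuous ψ) (h0 : ∀ x, 0 ≤ ψ x) :
    ∫ x, ψ x ∂(ρ t : Measure Xi) ≤ C * ∫ x, ψ x ∂gam H ε := by
  have hp := isProbabilityMeasure_gam hH ε
  have hae : ∀ᵐ t ∂volume.restrict (Ioo 0 T),
      ∫ x, ψ x ∂(ρ t : Measure Xi) ≤ C * ∫ x, ψ x ∂gam H ε := by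
    filter_upwards [ae_slice_bounds hu_meas hb, ae_restrict_mem measurableSet_Ioo] with t hbt ht
    have hd := hu t (Ioo_subset_Icc_self ht)
    have hbt' := (ae_gam_iff hH ε).2 hbt
    have h1 : (ρ t : Measure Xi) = (gam H ε).withDensity fun x => ((u t x).toNNReal : ℝ≥0∞) :=
      hd.2
    have hm : Measurable fun x : Xi => (u t x).toNNReal :=
      (hu_meas.of_uncurry_left.comp measurable_subtype_coe).real_toNNReal
    rw [h1, integral_withDensity_eq_integral_smul hm, ← integral_const_mul]
    refine integral_mono_of_nonneg (Eventually.of_forall fun x => ?_)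
      ((integrable_of_continuous_Xi hψ).const_mul C) ?_
    · exact smul_nonneg (by positivity) (h0 x)
    · filter_upwards [hbt'] with x hx
      rw [NNReal.smul_def, smul_eq_mul, Real.coe_toNNReal _ hx.1]
      exact mul_le_mul_of_nonneg_right hx.2 (h0 x)
  have hcont := continuousOn_integral hρ hψ
  -- The inequality holds on a set of full measure in `(0,T)`, which is dense in `[0,T]` because
  -- nonempty open sets have positive measure. Both sides being continuous in time, it extends to
  -- every `t`.
  have hdense : t ∈ closure {t | t ∈ Ioo 0 T ∧
      ∫ x, ψ x ∂(ρ t : Measure Xi) ≤ C * ∫ x, ψ x ∂gam H ε} := by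
    have hcl : closure (Ioo 0 T) = Icc 0 T := closure_Ioo hT.ne
    rw [← hcl] at ht
    refine (closure_mono ?_ : closure (Ioo 0 T) ⊆ _) ht |> fun h => by
      rwa [closure_closure] at h
    intro r hr
    rw [mem_closure_iff]
    intro o ho hro
    by_contra hne
    have hsub : o ∩ Ioo 0 T ⊆ {t | ¬ (t ∈ Ioo 0 T →
        ∫ x, ψ x ∂(ρ t : Measure Xi) ≤ C * ∫ x, ψ x ∂gam H ε)} := by
      intro y hy hy'
      exact hne ⟨y, hy.1, hy.2, hy' hy.2⟩
    have hz : volume (o ∩ Ioo 0 T) = 0 :=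
      measure_mono_null hsub ((ae_restrict_iff' measurableSet_Ioo).1 hae)
    exact ((ho.inter isOpen_Ioo).measure_pos volume ⟨r, hro, hr⟩).ne' hz
  have hcw : ContinuousWithinAt (fun t => ∫ x, ψ x ∂(ρ t : Measure Xi)) {t | t ∈ Ioo 0 T ∧
      ∫ x, ψ x ∂(ρ t : Measure Xi) ≤ C * ∫ x, ψ x ∂gam H ε} t :=
    (hcont t ht).mono fun y hy => Ioo_subset_Icc_self hy.1
  have := hcw.mem_closure_image hdense
  have hsub : (fun t => ∫ x, ψ x ∂(ρ t : Measure Xi)) '' {t | t ∈ Ioo 0 T ∧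
      ∫ x, ψ x ∂(ρ t : Measure Xi) ≤ C * ∫ x, ψ x ∂gam H ε} ⊆ Iic (C * ∫ x, ψ x ∂gam H ε) := by
    rintro _ ⟨y, hy, rfl⟩
    exact hy.2
  exact closure_minimal hsub isClosed_Iic this

/-! #### The flux -/

/-- The flux `u v g` in the original variable. -/
def flux (H : ℝ → ℝ) (ε : ℝ) (u v : ℝ → ℝ → ℝ) (z : ℝ × ℝ) : ℝ :=
  g H ε z.2 * (u z.1 z.2 * v z.1 z.2)

lemma measurable_flux (hH : DoubleWell H) (hu : Measurable (Function.uncurry u))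
    (hv : Measurable (Function.uncurry v)) : Measurable (flux H ε u v) :=
  ((g_continuous hH ε).measurable.comp measurable_snd).mul (hu.mul hv)

lemma integrable_flux (hH : DoubleWell H) (hu_meas : Measurable (Function.uncurry u))
    (hu : ∀ t ∈ Icc 0 T, IsDensity (ρ t : Measure Xi) (gam H ε) (u t))
    (hv : IsVelocity 0 T ρ v) : Integrable (flux H ε u v) (cyl T (-1) 1) := by
  have hm := measurable_flux (ε := ε) hH hu_meas hv.2.1
  refine ⟨hm.aestronglyMeasurable, ?_⟩
  rw [hasFiniteIntegral_iff_enorm, cyl_eq_prod, lintegral_prod _ hm.enorm.aemeasurable]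
  refine lt_of_le_of_lt (le_of_eq ?_) hv.2.2.1
  refine setLIntegral_congr_fun measurableSet_Ioo fun t ht => ?_
  have hd := hu t (Ioo_subset_Icc_self ht)
  simp only
  rw [lintegral_of_isDensity hH hu_meas.of_uncurry_left hd
    (F := fun x => ‖v t x‖ₑ) (hv.2.1.of_uncurry_left.enorm)]
  refine lintegral_congr_ae ?_
  filter_upwards [ae_nonneg_of_isDensity hH hd] with ξ hξ
  simp only [flux]
  rw [enorm_mul, enorm_mul, Real.enorm_of_nonneg (g_pos hH ε ξ).le, Real.enorm_of_nonneg hξ]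

/-- Multiplying by such a function gives compact support in space without changing values or
derivatives on `Ξ`. Test functions in `ξ` or `s` can then be arbitrary smooth functions, in
particular primitives and the coordinate itself. -/
lemma exists_cutoff : ∃ χ : ℝ → ℝ, ContDiff ℝ ∞ χ ∧ HasCompactSupport χ ∧
    ∀ x ∈ Icc (-1 : ℝ) 1, χ =ᶠ[𝓝 x] 1 := by
  let f : ContDiffBump (0 : ℝ) := ⟨2, 3, by norm_num, by norm_num⟩
  refine ⟨f, f.contDiff, f.hasCompactSupport, fun x hx => ?_⟩
  refine f.eventuallyEq_one_of_mem_ball ?_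
  rw [mem_ball_zero_iff, Real.norm_eq_abs]
  exact (abs_le.2 hx).trans_lt (by norm_num)

/-- The continuity equation tested with products. -/
lemma continuityEq_product (hH : DoubleWell H) (hu_meas : Measurable (Function.uncurry u))
    (hu : ∀ t ∈ Icc 0 T, IsDensity (ρ t : Measure Xi) (gam H ε) (u t))
    (hv : IsVelocity 0 T ρ v) {φ B : ℝ → ℝ} (hφ : ContDiff ℝ ∞ φ) (hcφ : HasCompactSupport φ)
    (hsφ : tsupport φ ⊆ Ioo 0 T) (hB : ContDiff ℝ ∞ B) :
    (∫ t in Ioo 0 T, deriv φ t * ∫ x : Xi, B x ∂(ρ t : Measure Xi))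
      + ∫ t in Ioo 0 T, φ t * ∫ ξ in Ioo (-1) 1, deriv B ξ * flux H ε u v (t, ξ) = 0 := by
  obtain ⟨χ, hχ, hcχ, hχ1⟩ := exists_cutoff
  have hsupp : tsupport (fun z : ℝ × ℝ => φ z.1 * (χ z.2 * B z.2)) ⊆ tsupport φ ×ˢ tsupport χ := by
    refine closure_minimal (fun z hz => ?_) ((isClosed_tsupport _).prod (isClosed_tsupport _))
    rw [Function.mem_support] at hz
    exact ⟨subset_tsupport _ (left_ne_zero_of_mul hz),
      subset_tsupport _ (left_ne_zero_of_mul (right_ne_zero_of_mul hz))⟩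
  have hce := hv.2.2.2 (fun z => φ z.1 * (χ z.2 * B z.2))
    ((hφ.comp contDiff_fst).mul ((hχ.comp contDiff_snd).mul (hB.comp contDiff_snd)))
    (HasCompactSupport.of_support_subset_isCompact (hcφ.isCompact.prod hcχ.isCompact)
      ((subset_tsupport _).trans hsupp))
    (hsupp.trans (prod_mono hsφ (subset_univ _)))
  have hd1 : ∀ t, ∀ x : Xi, deriv (fun r => φ r * (χ x * B x)) t = deriv φ t * B x := by
    intro t x
    rw [deriv_mul_const (hφ.differentiable (by norm_cast) t), (hχ1 x x.2).eq_of_nhds]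
    simp
  have hd2 : ∀ t, ∀ x : Xi, deriv (fun y => φ t * (χ y * B y)) x = φ t * deriv B x := by
    intro t x
    have : (fun y => φ t * (χ y * B y)) =ᶠ[𝓝 (x : ℝ)] fun y => φ t * B y := by
      filter_upwards [hχ1 x x.2] with y hy
      rw [hy]; simp
    rw [this.deriv_eq, deriv_const_mul _ (hB.differentiable (by norm_cast) _)]
  simp only [hd1, hd2] at hce
  have hB' : Continuous (deriv B) := hB.continuous_deriv (by norm_cast)
  have hflux := integrable_flux hH hu_meas hu hv
  have h2 : ∀ t ∈ Ioo 0 T, ∫ x : Xi, φ t * deriv B x * v t x ∂(ρ t : Measure Xi)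
      = φ t * ∫ ξ in Ioo (-1) 1, deriv B ξ * flux H ε u v (t, ξ) := by
    intro t ht
    rw [integral_of_isDensity hH hu_meas.of_uncurry_left (hu t (Ioo_subset_Icc_self ht))
      (fun x => φ t * deriv B x * v t x), ← integral_const_mul]
    refine integral_congr_ae (Eventually.of_forall fun ξ => ?_)
    simp only [flux]; ring
  have hφ'c : Continuous (deriv φ) := hφ.continuous_deriv (by norm_cast)
  have hi1 : Integrable (fun t => deriv φ t * ∫ x : Xi, B x ∂(ρ t : Measure Xi))
      (volume.restrict (Ioo 0 T)) := by
    have hcont : ContinuousOn (fun t => deriv φ t * ∫ x : Xi, B x ∂(ρ t : Measure Xi)) (Icc 0 T) :=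
      hφ'c.continuousOn.mul (continuousOn_integral hv.1 (hB.continuous.comp continuous_subtype_val))
    exact (hcont.integrableOn_Icc).mono_set Ioo_subset_Icc_self
  have hi2 : Integrable (fun t => φ t * ∫ ξ in Ioo (-1) 1, deriv B ξ * flux H ε u v (t, ξ))
      (volume.restrict (Ioo 0 T)) := by
    obtain ⟨K, hK⟩ := hcφ.exists_bound_of_continuous hφ.continuous
    obtain ⟨K', hK'⟩ := isCompact_Icc.exists_bound_of_continuousOn
      (hB'.continuousOn (s := Icc (-1) 1))
    have hprod : Integrable (fun z : ℝ × ℝ => deriv B z.2 * flux H ε u v z) (cyl T (-1) 1) := by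
      refine hflux.bdd_mul (hB'.comp continuous_snd).aestronglyMeasurable (c := K') ?_
      filter_upwards [ae_cyl_mem T (-1) 1] with z hz
      exact hK' _ (Ioo_subset_Icc_self hz.2)
    rw [cyl_eq_prod] at hprod
    exact hprod.integral_prod_left.bdd_mul hφ.continuous.aestronglyMeasurable (c := K)
      (Eventually.of_forall hK)
  rw [← integral_add hi1 hi2]
  refine Eq.trans ?_ hce
  refine setIntegral_congr_fun measurableSet_Ioo fun t ht => ?_
  rw [h2 t ht, integral_const_mul]

/-- The flux is determined by the curve. -/
lemma flux_unique (hH : DoubleWell H) (hu_meas : Measurable (Function.uncurry u))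
    (hu : ∀ t ∈ Icc 0 T, IsDensity (ρ t : Measure Xi) (gam H ε) (u t))
    {v' : ℝ → ℝ → ℝ} (hv : IsVelocity 0 T ρ v) (hv' : IsVelocity 0 T ρ v') :
    flux H ε u v =ᵐ[cyl T (-1) 1] flux H ε u v' := by
  have hi := integrable_flux hH hu_meas hu hv
  have hi' := integrable_flux hH hu_meas hu hv'
  have hz : (fun z => flux H ε u v z - flux H ε u v' z) =ᵐ[cyl T (-1) 1] 0 := by
    refine ae_eq_zero_of_product_test (hi.sub hi') fun φ ψ hφ hcφ hsφ hψ hcψ _ => ?_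
    -- An arbitrary `ψ` is the derivative of its primitive `B`, which is admissible even though it
    -- need not have compact support.
    have hder : ∀ x, HasDerivAt (fun x => ∫ y in (0 : ℝ)..x, ψ y) (ψ x) x := fun x =>
      intervalIntegral.integral_hasDerivAt_right (hψ.continuous.intervalIntegrable _ _)
        (hψ.continuous.stronglyMeasurableAtFilter _ _) hψ.continuous.continuousAt
    have hd : deriv (fun x => ∫ y in (0 : ℝ)..x, ψ y) = ψ := funext fun x => (hder x).deriv
    have hB : ContDiff ℝ ∞ fun x => ∫ y in (0 : ℝ)..x, ψ y := by
      rw [contDiff_infty_iff_deriv, hd]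
      exact ⟨fun x => (hder x).differentiableAt, hψ⟩
    have e1 := continuityEq_product hH hu_meas hu hv hφ hcφ hsφ hB
    have e2 := continuityEq_product hH hu_meas hu hv' hφ hcφ hsφ hB
    rw [hd] at e1 e2
    obtain ⟨K, hK⟩ := hcφ.exists_bound_of_continuous hφ.continuous
    obtain ⟨K', hK'⟩ := hcψ.exists_bound_of_continuous hψ.continuous
    have hprod : ∀ f : ℝ × ℝ → ℝ, Integrable f (cyl T (-1) 1) →
        Integrable (fun z : ℝ × ℝ => ψ z.2 * f z)
          ((volume.restrict (Ioo 0 T)).prod (volume.restrict (Ioo (-1) 1))) := by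
      intro f hf
      rw [← cyl_eq_prod]
      exact hf.bdd_mul (hψ.continuous.comp continuous_snd).aestronglyMeasurable (c := K')
        (Eventually.of_forall fun z => hK' _)
    have hintg : ∀ f : ℝ × ℝ → ℝ, Integrable f (cyl T (-1) 1) →
        Integrable (fun t => φ t * ∫ ξ in Ioo (-1) 1, ψ ξ * f (t, ξ))
          (volume.restrict (Ioo 0 T)) := fun f hf =>
      (hprod f hf).integral_prod_left.bdd_mul hφ.continuous.aestronglyMeasurable (c := K)
        (Eventually.of_forall hK)
    have e3 : ∫ t in Ioo 0 T, φ t * ∫ x in Ioo (-1) 1, ψ x *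
          (flux H ε u v (t, x) - flux H ε u v' (t, x))
        = (∫ t in Ioo 0 T, φ t * ∫ x in Ioo (-1) 1, ψ x * flux H ε u v (t, x))
          - ∫ t in Ioo 0 T, φ t * ∫ x in Ioo (-1) 1, ψ x * flux H ε u v' (t, x) := by
      rw [← integral_sub (hintg _ hi) (hintg _ hi')]
      refine integral_congr_ae ?_
      filter_upwards [(hprod _ hi).prod_right_ae, (hprod _ hi').prod_right_ae] with t h1 h2
      rw [← mul_sub, ← integral_sub h1 h2]
      simp only [mul_sub]
    rw [e3]; linarith
  filter_upwards [hz] with z hz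
  exact sub_eq_zero.1 hz

/-- Bounds on the two parts of the dissipation, with the given velocity and density. -/
lemma exists_sqrt_deriv (hH : DoubleWell H) (hu_meas : Measurable (Function.uncurry u))
    (hu : ∀ t ∈ Icc 0 T, IsDensity (ρ t : Measure Xi) (gam H ε) (u t))
    (hv : IsVelocity 0 T ρ v) {J : ℝ≥0∞} (hJ : dissipation H ε ρ 0 T < J) :
    ∃ p : ℝ → ℝ → ℝ, Measurable (Function.uncurry p) ∧
      (∀ᵐ t ∂volume.restrict (Ioo 0 T),
        IsWeakDeriv (-1) 1 (fun ξ => Real.sqrt (u t ξ)) (p t)) ∧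
      (∫⁻ t in Ioo 0 T, ∫⁻ ξ in Ioo (-1) 1,
        ENNReal.ofReal (1 / (2 * tau H ε) * (g H ε ξ * (u t ξ * v t ξ ^ 2)))) ≤ J ∧
      (∫⁻ t in Ioo 0 T, ∫⁻ ξ in Ioo (-1) 1,
        ENNReal.ofReal (2 * tau H ε * (g H ε ξ * p t ξ ^ 2))) ≤ J := by
  -- The strict inequality extracts an actual triple `(v', u', p)` below the level `J`; the rest
  -- transfers its estimates to the given `u` and `v`.
  simp only [dissipation, iInf_lt_iff] at hJ
  obtain ⟨v', u', p, hv', hp, hJ⟩ := hJ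
  have ht := tau_pos hH ε
  have hfl := flux_unique hH hu_meas hu hv hv'
  have hfl' : ∀ᵐ t ∂volume.restrict (Ioo 0 T), ∀ᵐ ξ ∂volume.restrict (Ioo (-1) 1),
      flux H ε u v (t, ξ) = flux H ε u v' (t, ξ) := by
    rw [cyl_eq_prod] at hfl
    exact Measure.ae_ae_of_ae_prod hfl
  refine ⟨p, hp.2.1, ?_, ?_, ?_⟩
  · filter_upwards [hp.2.2, ae_restrict_mem measurableSet_Ioo] with t ⟨h1, h2, h3, h4⟩ htT
    have hae := ae_eq_of_isDensity hH hp.1.of_uncurry_left hu_meas.of_uncurry_left h1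
      (hu t (Ioo_subset_Icc_self htT))
    have hae' : (fun ξ => Real.sqrt (u' t ξ)) =ᵐ[volume.restrict (Ioo (-1) 1)]
        fun ξ => Real.sqrt (u t ξ) := by
      filter_upwards [hae] with ξ hξ
      rw [hξ]
    refine ⟨?_, h3, fun φ hφ hc hs => ?_⟩
    · rw [locallyIntegrableOn_iff isOpen_Ioo.isLocallyClosed] at h2 ⊢
      intro k hk hkc
      exact (h2 k hk hkc).congr (ae_mono (Measure.restrict_mono hk le_rfl) hae')
    · rw [← h4 φ hφ hc hs]
      refine integral_congr_ae ?_
      filter_upwards [hae'] with ξ hξ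
      rw [hξ]
  · refine le_trans ?_ hJ.le
    refine lintegral_mono_ae ?_
    filter_upwards [hfl', ae_restrict_mem measurableSet_Ioo] with t hft htT
    refine le_trans ?_ le_self_add
    have hd := hu t (Ioo_subset_Icc_self htT)
    rw [lintegral_of_isDensity hH hu_meas.of_uncurry_left hd
      (F := fun ξ => ENNReal.ofReal (v' t ξ ^ 2))
      (hv'.2.1.of_uncurry_left.pow_const 2).ennreal_ofReal, ← lintegral_const_mul']
    swap; · exact ENNReal.ofReal_ne_top
    refine lintegral_mono_ae ?_
    filter_upwards [hft, ae_nonneg_of_isDensity hH hd] with ξ h1 h2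
    have hgp := (g_pos hH ε ξ)
    -- Only `u v` is determined, so `v` and `v'` may differ where `u = 0`. The product `u v²`
    -- vanishes there and agrees elsewhere.
    have h3 : u t ξ * v t ξ ^ 2 = u t ξ * v' t ξ ^ 2 := by
      simp only [flux] at h1
      have h4 := mul_left_cancel₀ hgp.ne' h1
      rcases eq_or_ne (u t ξ) 0 with h0 | h0
      · rw [h0, zero_mul, zero_mul]
      · rw [mul_left_cancel₀ h0 h4]
    rw [h3, ENNReal.ofReal_mul (by positivity), ENNReal.ofReal_mul hgp.le, ENNReal.ofReal_mul h2]
  · refine le_trans ?_ hJ.le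
    refine lintegral_mono fun t => ?_
    refine le_trans ?_ le_add_self
    rw [lintegral_gam hH ε (F := fun ξ => ENNReal.ofReal (p t ξ ^ 2))
      (hp.2.1.of_uncurry_left.pow_const 2).ennreal_ofReal, ← lintegral_const_mul']
    swap; · exact ENNReal.ofReal_ne_top
    refine lintegral_mono fun ξ => ?_
    rw [ENNReal.ofReal_mul (by positivity), ENNReal.ofReal_mul (g_pos hH ε ξ).le]

end SingleCurve

/-! ### Square integrable functions -/

lemma eLpNorm_two_le {α : Type*} [MeasurableSpace α] {μ : Measure α} {f : α → ℝ} {K : ℝ≥0∞}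
    (h : ∫⁻ x, ENNReal.ofReal (f x ^ 2) ∂μ ≤ K) : eLpNorm f 2 μ ≤ K ^ (1 / 2 : ℝ) := by
  rw [eLpNorm_eq_lintegral_rpow_enorm_toReal (by norm_num) (by norm_num)]
  simp only [ENNReal.toReal_ofNat]
  refine ENNReal.rpow_le_rpow (le_trans (le_of_eq ?_) h) (by norm_num)
  refine lintegral_congr fun x => ?_
  rw [← ofReal_norm, ENNReal.ofReal_rpow_of_nonneg (norm_nonneg _) (by norm_num)]
  congr 1
  rw [Real.rpow_two, Real.norm_eq_abs, sq_abs]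

lemma memLp_two_slice {T a b : ℝ} {f : ℝ → ℝ → ℝ}
    (h : MemLp (Function.uncurry f) 2 (cyl T a b)) :
    ∀ᵐ t ∂volume.restrict (Ioo 0 T), MemLp (f t) 2 (volume.restrict (Ioo a b)) := by
  rw [cyl_eq_prod] at h
  filter_upwards [h.1.prodMk_left, h.integrable_sq.prod_right_ae] with t h1 h2
  exact (memLp_two_iff_integrable_sq h1).2 h2

lemma integrableOn_of_memLp_two {a b : ℝ} {f : ℝ → ℝ}
    (h : MemLp f 2 (volume.restrict (Ioo a b))) : IntegrableOn f (Ioo a b) :=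
  h.integrable (by norm_num)

instance isFiniteMeasure_cyl (T a b : ℝ) : IsFiniteMeasure (cyl T a b) := by
  rw [cyl_eq_prod]; infer_instance

/-- The oscillation of a primitive of a square integrable function over a short interval. -/
lemma abs_integral_le_sqrt {a b x y r : ℝ} {d : ℝ → ℝ} (hr : 0 < r)
    (hd : MemLp d 2 (volume.restrict (Ioo a b))) (hx : x ∈ Icc a b) (hy : y ∈ Icc a b)
    (hxy : |y - x| ≤ r) :
    |∫ s in x..y, d s| ≤ Real.sqrt r / 2 * (1 + ∫ s in Ioo a b, d s ^ 2) := by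
  wlog hle : x ≤ y generalizing x y
  · rw [intervalIntegral.integral_symm, abs_neg]
    exact this hy hx (by rwa [abs_sub_comm]) (not_le.1 hle).le
  have hsub : Ioo x y ⊆ Ioo a b := Ioo_subset_Ioo hx.1 hy.2
  have hsq := hd.integrable_sq
  have hs := Real.sqrt_pos.2 hr
  have hsr : Real.sqrt r * Real.sqrt r = r := Real.mul_self_sqrt hr.le
  have hi : IntegrableOn d (Ioo x y) := (integrableOn_of_memLp_two hd).mono_set hsub
  have hi2 : IntegrableOn (fun s => d s ^ 2) (Ioo x y) := IntegrableOn.mono_set hsq hsub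
  rw [intervalIntegral.integral_of_le hle, integral_Ioc_eq_integral_Ioo]
  calc |∫ s in Ioo x y, d s| ≤ ∫ s in Ioo x y, |d s| := abs_integral_le_integral_abs
    -- Young's inequality with weight `√r` instead of Cauchy–Schwarz: the resulting bound is linear
    -- in the slice energy `∫ d²`, hence directly integrable in time.
    _ ≤ ∫ s in Ioo x y, (1 / (2 * Real.sqrt r) + Real.sqrt r / 2 * d s ^ 2) := by
        refine integral_mono hi.abs ((integrable_const _).add (hi2.const_mul _)) fun s => ?_
        simp only
        rw [← sq_abs (d s)]
        have h1 : 0 ≤ (Real.sqrt r * |d s| - 1) ^ 2 / (2 * Real.sqrt r) := by positivity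
        have h2 : (Real.sqrt r * |d s| - 1) ^ 2 / (2 * Real.sqrt r)
            = 1 / (2 * Real.sqrt r) + Real.sqrt r / 2 * |d s| ^ 2 - |d s| := by
          field_simp; ring
        linarith
    _ = (y - x) * (1 / (2 * Real.sqrt r)) + Real.sqrt r / 2 * ∫ s in Ioo x y, d s ^ 2 := by
        rw [integral_add (integrable_const _) (hi2.const_mul _), integral_const_mul]
        simp [hle]
    _ ≤ Real.sqrt r / 2 + Real.sqrt r / 2 * ∫ s in Ioo a b, d s ^ 2 := by
        refine add_le_add ?_ (mul_le_mul_of_nonneg_left ?_ (by positivity))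
        · have h1 : y - x ≤ r := (le_abs_self _).trans hxy
          calc (y - x) * (1 / (2 * Real.sqrt r)) ≤ r * (1 / (2 * Real.sqrt r)) :=
                mul_le_mul_of_nonneg_right h1 (by positivity)
            _ = (Real.sqrt r * Real.sqrt r) * (1 / (2 * Real.sqrt r)) := by rw [hsr]
            _ = Real.sqrt r / 2 := by field_simp
        · exact setIntegral_mono_set hsq (Eventually.of_forall fun s => sq_nonneg _)
            hsub.eventuallyLE
    _ = _ := by ring

section SingleCurve

variable {H : ℝ → ℝ} {ε T m C : ℝ} {ρ : ℝ → FiniteMeasure Xi} {u v p : ℝ → ℝ → ℝ}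

/-! ### Estimates in the rescaled variable -/

/-- The derivative `∂_s û = 2 √u ∂_ξ√u τ g` in the rescaled variable. -/
def slope (H : ℝ → ℝ) (ε : ℝ) (u p : ℝ → ℝ → ℝ) (t s : ℝ) : ℝ :=
  2 * Real.sqrt (u t (xihat H ε s)) * p t (xihat H ε s) * (tau H ε * g H ε (xihat H ε s))

lemma measurable_slope (hH : DoubleWell H) (hu : Measurable (Function.uncurry u))
    (hp : Measurable (Function.uncurry p)) : Measurable (Function.uncurry (slope H ε u p)) := by
  have hx : Measurable fun z : ℝ × ℝ => (z.1, xihat H ε z.2) :=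
    measurable_fst.prodMk ((measurable_xihat hH ε).comp measurable_snd)
  have h1 := hu.comp hx
  have h2 := hp.comp hx
  have h3 : Measurable fun z : ℝ × ℝ => tau H ε * g H ε (xihat H ε z.2) :=
    measurable_const.mul ((g_continuous hH ε).measurable.comp
      ((measurable_xihat hH ε).comp measurable_snd))
  exact ((h1.sqrt.const_mul 2).mul h2).mul h3

/-- The factor `1/(τ g)` in `v̂` and the factor `τ g²` in `ĝ` leave a single `g`: the flux is
transported without a Jacobian. -/
lemma what_eq_flux (hH : DoubleWell H) (t s : ℝ) :
    what H ε u v t s = flux H ε u v (t, xihat H ε s) := by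
  have h1 := (tau_pos hH ε).ne'
  have h2 := (g_pos hH ε (xihat H ε s)).ne'
  simp only [what, uhat, vhat, ghat, flux]
  field_simp

lemma measurable_what (hH : DoubleWell H) (hu : Measurable (Function.uncurry u))
    (hv : Measurable (Function.uncurry v)) :
    Measurable (Function.uncurry (what H ε u v)) := by
  have h : Function.uncurry (what H ε u v)
      = flux H ε u v ∘ fun z : ℝ × ℝ => (z.1, xihat H ε z.2) := by
    funext z; exact what_eq_flux hH z.1 z.2
  rw [h]
  exact (measurable_flux hH hu hv).comp
    (measurable_fst.prodMk ((measurable_xihat hH ε).comp measurable_snd))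

/-- After the change of variables the squared slope becomes `u · 4 τ g p²`. One factor `u` is
bounded by `C`, and `2 τ g p²` is the density of the second term of the dissipation; hence the
constant `2 C`. -/
lemma eLpNorm_slope_le (hH : DoubleWell H) (hC : 0 ≤ C)
    (hu_meas : Measurable (Function.uncurry u)) (hp : Measurable (Function.uncurry p))
    (hb : ∀ᵐ z ∂cyl T (-1) 1, 0 ≤ Function.uncurry u z ∧ Function.uncurry u z ≤ C) {J : ℝ≥0∞}
    (hJ : (∫⁻ t in Ioo 0 T, ∫⁻ ξ in Ioo (-1) 1,
        ENNReal.ofReal (2 * tau H ε * (g H ε ξ * p t ξ ^ 2))) ≤ J) :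
    eLpNorm (Function.uncurry (slope H ε u p)) 2 (cyl T (-kappa H) (kappa H))
      ≤ (ENNReal.ofReal (2 * C) * J) ^ (1 / 2 : ℝ) := by
  refine eLpNorm_two_le ?_
  have ht := tau_pos hH ε
  have hF : Measurable fun z : ℝ × ℝ => ENNReal.ofReal
      ((2 * Real.sqrt (u z.1 z.2) * p z.1 z.2 * (tau H ε * g H ε z.2)) ^ 2) :=
    ((((hu_meas.sqrt.const_mul 2).mul hp).mul (((g_continuous hH ε).measurable.comp
      measurable_snd).const_mul _)).pow_const 2).ennreal_ofReal
  have h := lintegral_cyl_comp_xihat hH T ε hF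
  refine (le_of_eq h).trans ?_
  refine le_trans ?_ (mul_le_mul_right hJ _)
  rw [← lintegral_const_mul' _ _ ENNReal.ofReal_ne_top]
  refine lintegral_mono_ae ?_
  filter_upwards [ae_slice_bounds hu_meas hb] with t hbt
  rw [← lintegral_const_mul' _ _ ENNReal.ofReal_ne_top]
  refine lintegral_mono_ae ?_
  filter_upwards [hbt] with ξ hξ
  have hg := g_pos hH ε ξ
  rw [← ENNReal.ofReal_mul (by positivity), ← ENNReal.ofReal_mul (by positivity)]
  refine ENNReal.ofReal_le_ofReal ?_
  have h1 : 1 / (tau H ε * g H ε ξ) *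
      (2 * Real.sqrt (u t ξ) * p t ξ * (tau H ε * g H ε ξ)) ^ 2
      = Real.sqrt (u t ξ) ^ 2 * (4 * tau H ε * g H ε ξ * p t ξ ^ 2) := by
    field_simp
    ring
  rw [h1, Real.sq_sqrt hξ.1]
  calc u t ξ * (4 * tau H ε * g H ε ξ * p t ξ ^ 2)
      ≤ C * (4 * tau H ε * g H ε ξ * p t ξ ^ 2) :=
        mul_le_mul_of_nonneg_right hξ.2 (by positivity)
    _ = _ := by ring

/-- After the change of variables the squared flux becomes `u · (u v² g / τ)`. Bounding one factor
`u` by `C` leaves twice the density of the kinetic term of the dissipation. -/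
lemma eLpNorm_what_le (hH : DoubleWell H) (hC : 0 ≤ C)
    (hu_meas : Measurable (Function.uncurry u)) (hv : Measurable (Function.uncurry v))
    (hb : ∀ᵐ z ∂cyl T (-1) 1, 0 ≤ Function.uncurry u z ∧ Function.uncurry u z ≤ C) {J : ℝ≥0∞}
    (hJ : (∫⁻ t in Ioo 0 T, ∫⁻ ξ in Ioo (-1) 1,
        ENNReal.ofReal (1 / (2 * tau H ε) * (g H ε ξ * (u t ξ * v t ξ ^ 2)))) ≤ J) :
    eLpNorm (Function.uncurry (what H ε u v)) 2 (cyl T (-kappa H) (kappa H))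
      ≤ (ENNReal.ofReal (2 * C) * J) ^ (1 / 2 : ℝ) := by
  refine eLpNorm_two_le ?_
  have ht := tau_pos hH ε
  have hF : Measurable fun z : ℝ × ℝ => ENNReal.ofReal (flux H ε u v z ^ 2) :=
    ((measurable_flux hH hu_meas hv).pow_const 2).ennreal_ofReal
  have h := lintegral_cyl_comp_xihat hH T ε hF
  have h0 : ∫⁻ z, ENNReal.ofReal (Function.uncurry (what H ε u v) z ^ 2)
      ∂cyl T (-kappa H) (kappa H) = ∫⁻ z, ENNReal.ofReal (flux H ε u v (z.1, xihat H ε z.2) ^ 2)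
      ∂cyl T (-kappa H) (kappa H) := by
    refine lintegral_congr fun z => ?_
    rw [← what_eq_flux hH]; rfl
  refine (le_of_eq (h0.trans h)).trans ?_
  refine le_trans ?_ (mul_le_mul_right hJ _)
  rw [← lintegral_const_mul' _ _ ENNReal.ofReal_ne_top]
  refine lintegral_mono_ae ?_
  filter_upwards [ae_slice_bounds hu_meas hb] with t hbt
  rw [← lintegral_const_mul' _ _ ENNReal.ofReal_ne_top]
  refine lintegral_mono_ae ?_
  filter_upwards [hbt] with ξ hξ
  have hg := g_pos hH ε ξ
  rw [← ENNReal.ofReal_mul (by positivity), ← ENNReal.ofReal_mul (by positivity)]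
  refine ENNReal.ofReal_le_ofReal ?_
  have h1 : 1 / (tau H ε * g H ε ξ) * flux H ε u v (t, ξ) ^ 2
      = u t ξ * (u t ξ * (v t ξ ^ 2 * g H ε ξ / tau H ε)) := by
    simp only [flux]
    field_simp
  rw [h1]
  calc u t ξ * (u t ξ * (v t ξ ^ 2 * g H ε ξ / tau H ε))
      ≤ C * (u t ξ * (v t ξ ^ 2 * g H ε ξ / tau H ε)) :=
        mul_le_mul_of_nonneg_right hξ.2 (mul_nonneg hξ.1 (by positivity))
    _ = _ := by field_simp

lemma integral_comp_xihat_of_le (hH : DoubleWell H) (ε : ℝ) (q : ℝ → ℝ) {ξ : ℝ}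
    (hξ : ξ ∈ Icc (-1 : ℝ) 1) :
    ∫ s in (-kappa H)..(shat H ε ξ), q (xihat H ε s) * (tau H ε * g H ε (xihat H ε s))
      = ∫ y in (-1)..ξ, q y := by
  have hmono := shat_strictMono hH ε
  have himg : shat H ε '' Ioo (-1) ξ = Ioo (-kappa H) (shat H ε ξ) := by
    rw [← shat_neg_one hH ε]
    refine Subset.antisymm ?_
      (intermediate_value_Ioo hξ.1 (shat_contDiff hH ε).continuous.continuousOn)
    rintro s ⟨y, hy, rfl⟩
    exact ⟨hmono hy.1, hmono hy.2⟩
  rw [intervalIntegral.integral_of_le (shat_mem hH ε hξ).1, integral_Ioc_eq_integral_Ioo, ← himg,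
    integral_image_eq_integral_abs_deriv_smul measurableSet_Ioo
    (fun x _ => (shat_hasDerivAt hH ε x).hasDerivWithinAt) hmono.injective.injOn,
    intervalIntegral.integral_of_le hξ.1, integral_Ioc_eq_integral_Ioo]
  refine setIntegral_congr_fun measurableSet_Ioo fun y hy => ?_
  have h1 := mul_pos (tau_pos hH ε) (g_pos hH ε y)
  simp only [smul_eq_mul]
  rw [xihat_shat hH ε ⟨hy.1.le, hy.2.le.trans hξ.2⟩, abs_of_pos (one_div_tau_g_pos hH ε y)]
  rw [mul_left_comm, one_div_mul_cancel h1.ne', mul_one]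

/-- For almost every time the density is a primitive of the slope in the rescaled variable. -/
lemma ae_eq_primitive_slope (hH : DoubleWell H) (hu_meas : Measurable (Function.uncurry u))
    (hp : Measurable (Function.uncurry p))
    (hb : ∀ᵐ z ∂cyl T (-1) 1, 0 ≤ Function.uncurry u z ∧ Function.uncurry u z ≤ C)
    (hw : ∀ᵐ t ∂volume.restrict (Ioo 0 T),
        IsWeakDeriv (-1) 1 (fun ξ => Real.sqrt (u t ξ)) (p t)) {J : ℝ≥0∞} (hJt : J ≠ ⊤)
    (hJ : (∫⁻ t in Ioo 0 T, ∫⁻ ξ in Ioo (-1) 1,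
        ENNReal.ofReal (2 * tau H ε * (g H ε ξ * p t ξ ^ 2))) ≤ J) :
    ∀ᵐ t ∂volume.restrict (Ioo 0 T), ∃ k, ∀ᵐ ξ ∂volume.restrict (Ioo (-1) 1),
      u t ξ = k + ∫ s in (-kappa H)..(shat H ε ξ), slope H ε u p t s := by
  have ht := tau_pos hH ε
  have hmeas : Measurable fun z : ℝ × ℝ =>
      ENNReal.ofReal (2 * tau H ε * (g H ε z.2 * p z.1 z.2 ^ 2)) :=
    ((((g_continuous hH ε).measurable.comp measurable_snd).mul
      (hp.pow_const 2)).const_mul _).ennreal_ofReal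
  have hfin : ∀ᵐ t ∂volume.restrict (Ioo 0 T), ∫⁻ ξ in Ioo (-1) 1,
      ENNReal.ofReal (2 * tau H ε * (g H ε ξ * p t ξ ^ 2)) < ⊤ :=
    ae_lt_top hmeas.lintegral_prod_right' (lt_of_le_of_lt hJ hJt.lt_top).ne
  -- On `Ξ` the weight `g` is bounded below by its minimum, so for almost every time the finite
  -- weighted energy makes `p(t,·)` integrable. No uniformity in `ε` is needed at this point.
  obtain ⟨x₀, -, hmin⟩ := isCompact_Icc.exists_isMinOn
    (nonempty_Icc.2 (by norm_num : (-1 : ℝ) ≤ 1)) (g_continuous hH ε).continuousOn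
  have hc := g_pos hH ε x₀
  filter_upwards [hfin, hw, ae_slice_bounds hu_meas hb] with t hft hwt hbt
  have hpt : Measurable (p t) := hp.of_uncurry_left
  have hintg : IntegrableOn (p t) (Ioo (-1) 1) := by
    have h1 : IntegrableOn (fun ξ => 2 * tau H ε * (g H ε ξ * p t ξ ^ 2)) (Ioo (-1) 1) := by
      refine ⟨(measurable_const.mul ((g_continuous hH ε).measurable.mul
        (hpt.pow_const 2))).aestronglyMeasurable, ?_⟩
      rw [hasFiniteIntegral_iff_ofReal (Eventually.of_forall fun ξ => ?_)]
      · exact hft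
      · have := g_pos hH ε ξ
        simp only [Pi.zero_apply]; positivity
    have h2 : IntegrableOn (fun ξ => 1 + 1 / (2 * tau H ε * g H ε x₀) *
        (2 * tau H ε * (g H ε ξ * p t ξ ^ 2))) (Ioo (-1) 1) :=
      (integrable_const _).add (h1.const_mul _)
    refine Integrable.mono' h2 hpt.aestronglyMeasurable ?_
    filter_upwards [ae_restrict_mem measurableSet_Ioo] with ξ hξ
    have hle : g H ε x₀ ≤ g H ε ξ := hmin (Ioo_subset_Icc_self hξ)
    have h3 : 1 / (2 * tau H ε * g H ε x₀) * (2 * tau H ε * (g H ε ξ * p t ξ ^ 2))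
        = g H ε ξ / g H ε x₀ * p t ξ ^ 2 := by field_simp
    have h4 : 1 ≤ g H ε ξ / g H ε x₀ := (one_le_div hc).2 hle
    have h5 := mul_le_mul_of_nonneg_right h4 (sq_nonneg (p t ξ))
    rw [h3, Real.norm_eq_abs]
    have h6 : |p t ξ| ≤ 1 + p t ξ ^ 2 := by
      rw [← sq_abs]; nlinarith [sq_nonneg (|p t ξ| - 1), abs_nonneg (p t ξ)]
    linarith
  obtain ⟨k, hk⟩ := hwt.exists_eq_primitive (by norm_num) hintg
  -- The function `√u` is a primitive of `p` with initial value `k`; squaring it by the chain rule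
  -- gives initial value `k²` and derivative `2 √u p`.
  refine ⟨k ^ 2, ?_⟩
  filter_upwards [hk, hbt, ae_restrict_mem measurableSet_Ioo] with ξ h1 h2 h3
  have h3' := Ioo_subset_Icc_self h3
  have h4 := integral_comp_xihat_of_le hH ε (fun y => 2 * Real.sqrt (u t y) * p t y) h3'
  simp only [slope]
  rw [h4, ← Real.sq_sqrt h2.1, h1, sq_primitive hintg h3']
  congr 1
  rw [intervalIntegral.integral_of_le h3'.1, integral_Ioc_eq_integral_Ioo,
    intervalIntegral.integral_of_le h3'.1, integral_Ioc_eq_integral_Ioo]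
  refine integral_congr_ae ?_
  have hsub : Ioo (-1) ξ ⊆ Ioo (-1) 1 := Ioo_subset_Ioo_right h3'.2
  filter_upwards [ae_mono (Measure.restrict_mono hsub le_rfl) hk] with y hy
  rw [hy]

/-- The continuity equation in the rescaled variable, tested with products. -/
lemma continuityEq_rescaled (hH : DoubleWell H) (hu_meas : Measurable (Function.uncurry u))
    (hu : ∀ t ∈ Icc 0 T, IsDensity (ρ t : Measure Xi) (gam H ε) (u t))
    (hv : IsVelocity 0 T ρ v) {φ B : ℝ → ℝ} (hφ : ContDiff ℝ ∞ φ) (hcφ : HasCompactSupport φ)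
    (hsφ : tsupport φ ⊆ Ioo 0 T) (hB : ContDiff ℝ ∞ B) :
    (∫ t in Ioo 0 T, deriv φ t * ∫ x : Xi, B (shat H ε x) ∂(ρ t : Measure Xi))
      + ∫ t in Ioo 0 T, φ t * ∫ s in Ioo (-kappa H) (kappa H),
          deriv B s * what H ε u v t s = 0 := by
  have h := continuityEq_product hH hu_meas hu hv hφ hcφ hsφ (hB.comp (shat_contDiff hH ε))
  have e : ∀ t, ∫ ξ in Ioo (-1) 1, deriv (B ∘ shat H ε) ξ * flux H ε u v (t, ξ)
      = ∫ s in Ioo (-kappa H) (kappa H), deriv B s * what H ε u v t s := by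
    intro t
    rw [integral_eq_integral_shat hH ε]
    refine setIntegral_congr_fun measurableSet_Ioo fun ξ hξ => ?_
    rw [what_eq_flux hH, xihat_shat hH ε (Ioo_subset_Icc_self hξ),
      deriv_comp _ (hB.differentiable (by norm_cast) _)
        (shat_hasDerivAt hH ε ξ).differentiableAt, deriv_shat hH]
    ring
  simp only [e] at h
  exact h

/-- The mean of the rescaled coordinate moves by the total rescaled flux. -/
lemma integral_shat_eq (hH : DoubleWell H) (hT : 0 < T)
    (hu_meas : Measurable (Function.uncurry u))
    (hu : ∀ t ∈ Icc 0 T, IsDensity (ρ t : Measure Xi) (gam H ε) (u t))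
    (hv : IsVelocity 0 T ρ v)
    (hw : Integrable (Function.uncurry (what H ε u v)) (cyl T (-kappa H) (kappa H)))
    {t : ℝ} (ht : t ∈ Icc 0 T) :
    ∫ x : Xi, shat H ε x ∂(ρ t : Measure Xi) = (∫ x : Xi, shat H ε x ∂(ρ 0 : Measure Xi))
      + ∫ r in (0 : ℝ)..t, ∫ s in Ioo (-kappa H) (kappa H), what H ε u v r s := by
  set F : ℝ → ℝ := fun t => ∫ x : Xi, shat H ε x ∂(ρ t : Measure Xi) with hF
  set G : ℝ → ℝ := fun r => ∫ s in Ioo (-kappa H) (kappa H), what H ε u v r s with hG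
  have hFc : ContinuousOn F (Icc 0 T) := continuousOn_integral hv.1 (continuous_shat_Xi hH ε)
  have hGi : IntegrableOn G (Ioo 0 T) := by
    rw [cyl_eq_prod] at hw
    exact hw.integral_prod_left
  have hwd : IsWeakDeriv 0 T F G := by
    refine ⟨?_, hGi.locallyIntegrableOn, fun φ hφ hc hs => ?_⟩
    · exact ((hFc.integrableOn_Icc).mono_set Ioo_subset_Icc_self).locallyIntegrableOn
    -- Testing with `B(s) = s`, whose derivative is `1`, exhibits the total flux as the weak time
    -- derivative of the mean.
    · have h := continuityEq_rescaled hH hu_meas hu hv hφ hc hs contDiff_id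
      simp only [deriv_id, one_mul, id] at h
      rw [eq_neg_iff_add_eq_zero]
      simpa only [mul_comm] using h
  obtain ⟨k, hk⟩ := hwd.exists_eq_primitive hT hGi
  have hk' : F =ᵐ[volume.restrict (Icc 0 T)] fun x => k + ∫ y in (0 : ℝ)..x, G y := by
    rwa [← Measure.restrict_congr_set Ioo_ae_eq_Icc]
  -- Both functions are continuous on `[0,T]`, so almost-everywhere equality becomes equality at
  -- every time, including `t = 0`, which identifies the constant.
  have heq := Measure.eqOn_Icc_of_ae_eq volume hT.ne hk' hFc (continuousOn_primitive hT.le hGi)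
  have h0 := heq (left_mem_Icc.2 hT.le)
  have h1 := heq ht
  simp only [intervalIntegral.integral_same, add_zero] at h0
  rw [← h0] at h1
  exact h1

end SingleCurve

/-! ### Integrals over the cylinder -/

lemma integral_cyl_mul {T a b : ℝ} {f : ℝ × ℝ → ℝ} (hf : Integrable f (cyl T a b)) {φ ψ : ℝ → ℝ}
    (hφ : Measurable φ) (hψ : Measurable ψ) {K L : ℝ} (hK : ∀ t, |φ t| ≤ K)
    (hL : ∀ s ∈ Ioo a b, |ψ s| ≤ L) :
    Integrable (fun z => f z * (φ z.1 * ψ z.2)) (cyl T a b) ∧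
      Integrable (fun t => φ t * ∫ s in Ioo a b, ψ s * f (t, s)) (volume.restrict (Ioo 0 T)) ∧
      ∫ z, f z * (φ z.1 * ψ z.2) ∂cyl T a b
        = ∫ t in Ioo 0 T, φ t * ∫ s in Ioo a b, ψ s * f (t, s) := by
  have hi : Integrable (fun z => f z * (φ z.1 * ψ z.2)) (cyl T a b) := by
    refine hf.mul_bdd (c := K * L)
      ((hφ.comp measurable_fst).mul (hψ.comp measurable_snd)).aestronglyMeasurable ?_
    filter_upwards [ae_cyl_mem T a b] with z hz
    rw [norm_mul]
    exact mul_le_mul (hK _) (hL _ hz.2) (norm_nonneg _) ((abs_nonneg _).trans (hK 0))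
  have hi' := hi
  rw [cyl_eq_prod] at hi'
  have e : ∀ t, ∫ s in Ioo a b, f (t, s) * (φ t * ψ s) = φ t * ∫ s in Ioo a b, ψ s * f (t, s) := by
    intro t
    rw [← integral_const_mul]
    refine integral_congr_ae (Eventually.of_forall fun s => ?_)
    simp only; ring
  refine ⟨hi, ?_, ?_⟩
  · have := hi'.integral_prod_left
    simpa only [e] using this
  · rw [cyl_eq_prod, integral_prod _ hi']
    simp only [e]

lemma integral_cyl_mul_fst {T a b : ℝ} {f : ℝ × ℝ → ℝ} (hf : Integrable f (cyl T a b)) {φ : ℝ → ℝ}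
    (hφ : Measurable φ) {K : ℝ} (hK : ∀ t, |φ t| ≤ K) :
    ∫ z, f z * φ z.1 ∂cyl T a b = ∫ t in Ioo 0 T, φ t * ∫ s in Ioo a b, f (t, s) := by
  have := (integral_cyl_mul hf hφ (measurable_const (a := (1 : ℝ))) hK (L := 1) (by simp)).2.2
  simpa only [mul_one, one_mul] using this

lemma memLp_of_bounded {α : Type*} [MeasurableSpace α] {μ : Measure α} [IsFiniteMeasure μ]
    {h : α → ℝ} (hm : Measurable h) {K : ℝ} (hK : ∀ x, |h x| ≤ K) (p : ℝ≥0∞) : MemLp h p μ :=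
  MemLp.of_bound hm.aestronglyMeasurable K (Eventually.of_forall hK)

/-- The primitive `∫_a^s f(t,σ) dσ`, in a form that is jointly measurable. -/
def prim (a b : ℝ) (f : ℝ × ℝ → ℝ) (t s : ℝ) : ℝ := ∫ σ in Ioo a b, (Iio s).indicator
  (fun σ => f (t, σ)) σ

lemma prim_eq {a b s : ℝ} (f : ℝ × ℝ → ℝ) (t : ℝ) (hs : s ∈ Icc a b) :
    prim a b f t s = ∫ σ in a..s, f (t, σ) := by
  rw [prim, setIntegral_indicator measurableSet_Iio, intervalIntegral.integral_of_le hs.1,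
    integral_Ioc_eq_integral_Ioo]
  congr 2
  ext x
  simp only [mem_inter_iff, mem_Ioo, mem_Iio]
  constructor
  · rintro ⟨⟨h1, _⟩, h3⟩; exact ⟨h1, h3⟩
  · rintro ⟨h1, h2⟩; exact ⟨⟨h1, h2.trans_le hs.2⟩, h2⟩

lemma measurable_prim_integrand {f : ℝ × ℝ → ℝ} (hf : Measurable f) :
    Measurable fun x : (ℝ × ℝ) × ℝ => (Iio x.1.2).indicator (fun σ => f (x.1.1, σ)) x.2 := by
  have hset : MeasurableSet {x : (ℝ × ℝ) × ℝ | x.2 < x.1.2} :=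
    measurableSet_lt measurable_snd (measurable_snd.comp measurable_fst)
  have hm : Measurable fun x : (ℝ × ℝ) × ℝ => f (x.1.1, x.2) :=
    hf.comp ((measurable_fst.comp measurable_fst).prodMk measurable_snd)
  exact hm.indicator hset

lemma stronglyMeasurable_prim {a b : ℝ} {f : ℝ × ℝ → ℝ} (hf : Measurable f) :
    StronglyMeasurable fun z : ℝ × ℝ => prim a b f z.1 z.2 :=
  (measurable_prim_integrand hf).stronglyMeasurable.integral_prod_right
    (f := fun (z : ℝ × ℝ) σ => (Iio z.2).indicator (fun σ => f (z.1, σ)) σ)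

lemma abs_prim_le {a b : ℝ} {f : ℝ × ℝ → ℝ} {t : ℝ}
    (hf : IntegrableOn (fun σ => f (t, σ)) (Ioo a b)) (s : ℝ) :
    |prim a b f t s| ≤ ∫ σ in Ioo a b, |f (t, σ)| := by
  refine (abs_integral_le_integral_abs).trans ?_
  refine integral_mono (hf.indicator measurableSet_Iio).abs hf.abs fun σ => ?_
  simp only [indicator]
  split_ifs
  · exact le_rfl
  · simp

lemma integrable_prim {T a b a' b' : ℝ} {f : ℝ × ℝ → ℝ} (hm : Measurable f)
    (hf : Integrable f (cyl T a b)) {θ : ℝ → ℝ} (hθ : Measurable θ) :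
    Integrable (fun z : ℝ × ℝ => prim a b f z.1 (θ z.2)) (cyl T a' b') := by
  have hf' := hf
  rw [cyl_eq_prod] at hf' ⊢
  have hI := hf'.abs.integral_prod_left.comp_fst (volume.restrict (Ioo a' b'))
  refine hI.mono' ?_ ?_
  · exact ((stronglyMeasurable_prim hm).comp_measurable
      (measurable_fst.prodMk (hθ.comp measurable_snd))).aestronglyMeasurable
  · have h1 : ∀ᵐ z ∂(volume.restrict (Ioo 0 T)).prod (volume.restrict (Ioo a' b')),
        IntegrableOn (fun σ => f (z.1, σ)) (Ioo a b) :=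
      Measure.quasiMeasurePreserving_fst.ae hf'.prod_right_ae
    filter_upwards [h1] with z hz
    exact abs_prim_le hz _

/-- Fubini for a primitive. -/
lemma exists_integral_prim_mul {h : ℝ × ℝ → ℝ} (T a b : ℝ) (hh : Measurable h) {K : ℝ} (hK : ∀ z, |h z| ≤ K) :
    ∃ h' : ℝ × ℝ → ℝ, Measurable h' ∧ (∃ K', ∀ z, |h' z| ≤ K') ∧
      ∀ f : ℝ × ℝ → ℝ, Measurable f → Integrable f (cyl T a b) →
        ∫ z, prim a b f z.1 z.2 * h z ∂cyl T a b = ∫ z, f z * h' z ∂cyl T a b := by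
  have hm' : Measurable fun x : (ℝ × ℝ) × ℝ => (Ioi x.1.2).indicator (fun s => h (x.1.1, s)) x.2 := by
    have hset : MeasurableSet {x : (ℝ × ℝ) × ℝ | x.1.2 < x.2} :=
      measurableSet_lt (measurable_snd.comp measurable_fst) measurable_snd
    have hm : Measurable fun x : (ℝ × ℝ) × ℝ => h (x.1.1, x.2) :=
      hh.comp ((measurable_fst.comp measurable_fst).prodMk measurable_snd)
    exact hm.indicator hset
  have hK0 : 0 ≤ K := (abs_nonneg _).trans (hK (0, 0))
  have hb : ∀ t σ s, |(Ioi σ).indicator (fun s => h (t, s)) s| ≤ K := by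
    intro t σ s
    simp only [indicator]
    split_ifs
    · exact hK _
    · simpa using hK0
  -- The adjoint of integration from the left end point is integration up to the right end point:
  -- `h'(t,σ) = ∫_σ^b h(t,s) ds`.
  refine ⟨fun z => ∫ s in Ioo a b, (Ioi z.2).indicator (fun s => h (z.1, s)) s, ?_, ?_, ?_⟩
  · exact (hm'.stronglyMeasurable.integral_prod_right
      (f := fun (z : ℝ × ℝ) s => (Ioi z.2).indicator (fun s => h (z.1, s)) s)).measurable
  · refine ⟨K * (volume.restrict (Ioo a b)).real univ, fun z => ?_⟩
    rw [← Real.norm_eq_abs]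
    exact norm_integral_le_of_norm_le_const (Eventually.of_forall fun s => hb z.1 z.2 s)
  · intro f hm hf
    have hp := integrable_prim (a' := a) (b' := b) hm hf measurable_id
    have hph : Integrable (fun z : ℝ × ℝ => prim a b f z.1 z.2 * h z) (cyl T a b) :=
      hp.mul_bdd hh.aestronglyMeasurable (c := K) (Eventually.of_forall hK)
    have hfh : Integrable (fun z : ℝ × ℝ => f z *
        ∫ s in Ioo a b, (Ioi z.2).indicator (fun s => h (z.1, s)) s) (cyl T a b) := by
      refine hf.mul_bdd (c := K * (volume.restrict (Ioo a b)).real univ) ?_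
        (Eventually.of_forall fun z => ?_)
      · exact (hm'.stronglyMeasurable.integral_prod_right
          (f := fun (z : ℝ × ℝ) s =>
            (Ioi z.2).indicator (fun s => h (z.1, s)) s)).aestronglyMeasurable
      · exact norm_integral_le_of_norm_le_const (Eventually.of_forall fun s => hb z.1 z.2 s)
    rw [cyl_eq_prod] at hf hph hfh ⊢
    rw [integral_prod _ hph, integral_prod _ hfh]
    refine integral_congr_ae ?_
    filter_upwards [hf.prod_right_ae] with t ht
    simp only [prim]
    have hintg : Integrable (Function.uncurry fun s σ => (Iio s).indicator
        (fun σ => f (t, σ)) σ * h (t, s))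
        ((volume.restrict (Ioo a b)).prod (volume.restrict (Ioo a b))) := by
      have h1 : Integrable (fun z : ℝ × ℝ => f (t, z.2))
          ((volume.restrict (Ioo a b)).prod (volume.restrict (Ioo a b))) := ht.comp_snd _
      have hset : MeasurableSet {z : ℝ × ℝ | z.2 < z.1} :=
        measurableSet_lt measurable_snd measurable_fst
      have h2 := (h1.indicator hset).mul_bdd (c := K)
        (g := fun z : ℝ × ℝ => h (t, z.1))
        ((hh.comp (measurable_const.prodMk measurable_fst)).aestronglyMeasurable)
        (Eventually.of_forall fun z => hK _)
      exact h2
    calc ∫ s in Ioo a b, (∫ σ in Ioo a b, (Iio s).indicator (fun σ => f (t, σ)) σ) * h (t, s)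
        = ∫ s in Ioo a b, ∫ σ in Ioo a b, (Iio s).indicator (fun σ => f (t, σ)) σ * h (t, s) := by
          simp only [integral_mul_const]
      _ = ∫ σ in Ioo a b, ∫ s in Ioo a b, (Iio s).indicator (fun σ => f (t, σ)) σ * h (t, s) :=
          integral_integral_swap hintg
      _ = ∫ σ in Ioo a b, f (t, σ) * ∫ s in Ioo a b,
            (Ioi σ).indicator (fun s => h (t, s)) s := by
          refine integral_congr_ae (Eventually.of_forall fun σ => ?_)
          simp only
          rw [← integral_const_mul]
          refine integral_congr_ae (Eventually.of_forall fun s => ?_)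
          by_cases hz : σ < s <;> simp [indicator, hz]

/-! ### Strong convergence -/

/-- For the traces: `X n` is the integral of a cutoff against `ρ_n(t)`, `f n` the trace, `q n` the
integral of the cutoff against `γ_n`, and `r n * b n` the oscillation error. Pointwise convergence
of `X n` becomes `L¹` convergence by domination, and dividing by `q n → 1/2` gives the limit `2 X₀`
of the traces. -/
lemma tendsto_integral_abs_sub {α : Type*} [MeasurableSpace α] {μ : Measure α} [IsFiniteMeasure μ]
    {f X b : ℕ → α → ℝ} {X₀ : α → ℝ} {q r : ℕ → ℝ} {M K : ℝ}
    (hf : ∀ n, Integrable (f n) μ) (hXm : ∀ n, AEStronglyMeasurable (X n) μ)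
    (hX₀m : AEStronglyMeasurable X₀ μ)
    (hXb : ∀ n, ∀ᵐ t ∂μ, |X n t| ≤ M) (hX₀b : ∀ᵐ t ∂μ, |X₀ t| ≤ M)
    (hX : ∀ᵐ t ∂μ, Tendsto (fun n => X n t) atTop (𝓝 (X₀ t)))
    (hb : ∀ n, Integrable (b n) μ) (hbK : ∀ n, ∫ t, b n t ∂μ ≤ K)
    (hr0 : ∀ n, 0 ≤ r n) (hr : Tendsto r atTop (𝓝 0)) (hq : Tendsto q atTop (𝓝 (1 / 2)))
    (hest : ∀ n, ∀ᵐ t ∂μ, |X n t - f n t * q n| ≤ r n * b n t) :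
    Tendsto (fun n => ∫ t, |f n t - 2 * X₀ t| ∂μ) atTop (𝓝 0) := by
  have hXi : ∀ n, Integrable (X n) μ := fun n =>
    Integrable.of_bound (hXm n) M (hXb n)
  have hX₀i : Integrable X₀ μ := Integrable.of_bound hX₀m M hX₀b
  have hdc : Tendsto (fun n => ∫ t, |X n t - X₀ t| ∂μ) atTop (𝓝 0) := by
    have := tendsto_integral_of_dominated_convergence (μ := μ) (F := fun n t => |X n t - X₀ t|)
      (f := fun _ => 0) (fun _ => 2 * M) (fun n => ((hXm n).sub hX₀m).norm) (integrable_const _)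
      (fun n => ?_) ?_
    · simpa using this
    · filter_upwards [hXb n, hX₀b] with t h1 h2
      rw [Real.norm_eq_abs, abs_abs]
      exact (abs_sub _ _).trans (by linarith)
    · filter_upwards [hX] with t ht
      have := (ht.sub_const (X₀ t)).abs
      simpa using this
  have hlim : Tendsto (fun n => 4 * (r n * K + ∫ t, |X n t - X₀ t| ∂μ
      + |1 - 2 * q n| * ∫ t, |X₀ t| ∂μ)) atTop (𝓝 0) := by
    have h1 : Tendsto (fun n => |1 - 2 * q n|) atTop (𝓝 0) := by
      have := ((hq.const_mul 2).const_sub 1).abs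
      simpa using this
    have := (((hr.mul_const K).add hdc).add (h1.mul_const (∫ t, |X₀ t| ∂μ))).const_mul 4
    simpa using this
  refine squeeze_zero' (Eventually.of_forall fun n => integral_nonneg fun t => abs_nonneg _)
    ?_ hlim
  -- Once `q n > 1/4`, division by it costs a factor of at most `4`.
  filter_upwards [hq.eventually (lt_mem_nhds (by norm_num : (1 / 4 : ℝ) < 1 / 2))] with n hqn
  have hI0 : Integrable (fun t => |X n t - X₀ t|) μ := ((hXi n).sub hX₀i).abs
  have hI1 : Integrable (fun t => r n * b n t + |X n t - X₀ t|) μ :=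
    ((hb n).const_mul _).add hI0
  have hI2 : Integrable (fun t => |1 - 2 * q n| * |X₀ t|) μ := hX₀i.abs.const_mul _
  calc ∫ t, |f n t - 2 * X₀ t| ∂μ
      ≤ ∫ t, 4 * (r n * b n t + |X n t - X₀ t| + |1 - 2 * q n| * |X₀ t|) ∂μ := by
        refine integral_mono_ae ((hf n).sub (hX₀i.const_mul 2)).abs ((hI1.add hI2).const_mul 4) ?_
        filter_upwards [hest n] with t ht
        have h1 : |q n * (f n t - 2 * X₀ t)|
            ≤ r n * b n t + |X n t - X₀ t| + |1 - 2 * q n| * |X₀ t| := by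
          have : q n * (f n t - 2 * X₀ t)
              = (-(X n t - f n t * q n) + (X n t - X₀ t)) + (1 - 2 * q n) * X₀ t := by ring
          rw [this]
          refine (abs_add_le _ _).trans (add_le_add ((abs_add_le _ _).trans ?_) (abs_mul _ _).le)
          rw [abs_neg]
          exact add_le_add ht le_rfl
        rw [abs_mul, abs_of_pos (by linarith)] at h1
        have h2 : 1 / 4 * |f n t - 2 * X₀ t| ≤ q n * |f n t - 2 * X₀ t| :=
          mul_le_mul_of_nonneg_right hqn.le (abs_nonneg _)
        linarith
    _ = 4 * (r n * ∫ t, b n t ∂μ + ∫ t, |X n t - X₀ t| ∂μ + |1 - 2 * q n| * ∫ t, |X₀ t| ∂μ) := by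
        rw [integral_const_mul, integral_add hI1 hI2,
          integral_add ((hb n).const_mul _) hI0, integral_const_mul,
          integral_const_mul]
    _ ≤ _ := by
        have := mul_le_mul_of_nonneg_left (hbK n) (hr0 n)
        linarith

lemma strongL1_of_tendsto {α : Type*} [MeasurableSpace α] {μ : Measure α} {f : ℕ → α → ℝ}
    {f₀ : α → ℝ} (hf : ∀ n, Integrable (f n) μ) (hf₀ : Integrable f₀ μ)
    (h : Tendsto (fun n => ∫ t, |f n t - f₀ t| ∂μ) atTop (𝓝 0)) : StrongL1 μ f f₀ := by
  refine ⟨fun n => memLp_one_iff_integrable.2 (hf n), memLp_one_iff_integrable.2 hf₀, ?_⟩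
  have := ENNReal.tendsto_ofReal h
  rw [ENNReal.ofReal_zero] at this
  refine this.congr fun n => ?_
  rw [eLpNorm_one_eq_lintegral_enorm]
  exact ofReal_integral_norm_eq_lintegral_enorm ((hf n).sub hf₀)

/-! ### Traces of a single curve -/

section Traces

variable {H : ℝ → ℝ} {ε T C : ℝ} {u d : ℝ → ℝ → ℝ}

/-- The value at `-1` of the continuous representative of `u`. -/
def traceLeft (H : ℝ → ℝ) (ε : ℝ) (u d : ℝ → ℝ → ℝ) (t : ℝ) : ℝ :=
  ∫ x in Ioo (-1) 1, 1 / 2 * (u t x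
    - prim (-kappa H) (kappa H) (Function.uncurry d) t (shat H ε x))

/-- The value at `1` of the continuous representative of `u`. -/
def traceRight (H : ℝ → ℝ) (ε : ℝ) (u d : ℝ → ℝ → ℝ) (t : ℝ) : ℝ :=
  traceLeft H ε u d t + ∫ s in Ioo (-kappa H) (kappa H), d t s

lemma integrable_of_ae_bounds {a b : ℝ} {f : ℝ × ℝ → ℝ} (hf : Measurable f)
    (hb : ∀ᵐ z ∂cyl T a b, 0 ≤ f z ∧ f z ≤ C) (p : ℝ≥0∞) : MemLp f p (cyl T a b) := by
  refine MemLp.of_bound hf.aestronglyMeasurable C ?_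
  filter_upwards [hb] with z hz
  rw [Real.norm_eq_abs, abs_of_nonneg hz.1]
  exact hz.2

/-- For each time the left trace is only known as some constant `k`. Writing it as an average over
`Ξ`, of length `2`, gives a formula whose measurability and integrability in `t` come from Fubini.
-/
lemma integrable_traceLeft (hH : DoubleWell H) (hu : Measurable (Function.uncurry u))
    (hb : ∀ᵐ z ∂cyl T (-1) 1, 0 ≤ Function.uncurry u z ∧ Function.uncurry u z ≤ C)
    (hd : Measurable (Function.uncurry d))
    (hd2 : MemLp (Function.uncurry d) 2 (cyl T (-kappa H) (kappa H))) :
    Integrable (traceLeft H ε u d) (volume.restrict (Ioo 0 T)) := by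
  have h1 : Integrable (Function.uncurry u) (cyl T (-1) 1) :=
    (integrable_of_ae_bounds hu hb 1).integrable le_rfl
  have h2 := integrable_prim (a' := -1) (b' := 1) hd (hd2.integrable (by norm_num))
    (shat_contDiff hH ε).continuous.measurable
  have h3 := (h1.sub h2).const_mul (1 / 2)
  rw [cyl_eq_prod] at h3
  exact h3.integral_prod_left

lemma integrable_integral_slice {a b : ℝ} {f : ℝ × ℝ → ℝ} (hf : Integrable f (cyl T a b)) :
    Integrable (fun t => ∫ s in Ioo a b, f (t, s)) (volume.restrict (Ioo 0 T)) := by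
  rw [cyl_eq_prod] at hf
  exact hf.integral_prod_left

lemma integrable_traceRight (hH : DoubleWell H) (hu : Measurable (Function.uncurry u))
    (hb : ∀ᵐ z ∂cyl T (-1) 1, 0 ≤ Function.uncurry u z ∧ Function.uncurry u z ≤ C)
    (hd : Measurable (Function.uncurry d))
    (hd2 : MemLp (Function.uncurry d) 2 (cyl T (-kappa H) (kappa H))) :
    Integrable (traceRight H ε u d) (volume.restrict (Ioo 0 T)) :=
  (integrable_traceLeft hH hu hb hd hd2).add
    (integrable_integral_slice (hd2.integrable (by norm_num)))

/-- The representation of `u` by its left trace. -/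
lemma ae_eq_traceLeft (hH : DoubleWell H)
    (hrep : ∀ᵐ t ∂volume.restrict (Ioo 0 T), ∃ k, ∀ᵐ ξ ∂volume.restrict (Ioo (-1) 1),
      u t ξ = k + ∫ s in (-kappa H)..(shat H ε ξ), d t s) :
    ∀ᵐ t ∂volume.restrict (Ioo 0 T), ∀ᵐ ξ ∂volume.restrict (Ioo (-1) 1),
      u t ξ = traceLeft H ε u d t + ∫ s in (-kappa H)..(shat H ε ξ), d t s := by
  filter_upwards [hrep] with t ⟨k, hk⟩
  have h : traceLeft H ε u d t = k := by
    have : traceLeft H ε u d t = ∫ x in Ioo (-1 : ℝ) 1, 1 / 2 * k := by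
      refine integral_congr_ae ?_
      filter_upwards [hk, ae_restrict_mem measurableSet_Ioo] with ξ h1 h2
      rw [prim_eq _ _ (shat_mem hH ε (Ioo_subset_Icc_self h2)), h1]
      simp [Function.uncurry]
    rw [this, setIntegral_const]
    norm_num [Measure.real]
    ring
  rw [h]
  exact hk

lemma continuousOn_rep (hH : DoubleWell H) {d : ℝ → ℝ} {k : ℝ}
    (hd : IntegrableOn d (Ioo (-kappa H) (kappa H))) :
    ContinuousOn (fun ξ => k + ∫ s in (-kappa H)..(shat H ε ξ), d s) (Icc (-1) 1) := by
  have hk := kappa_pos hH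
  exact (continuousOn_primitive (k := k) (by linarith) hd).comp
    (shat_contDiff hH ε).continuous.continuousOn fun ξ hξ => shat_mem hH ε hξ

lemma intervalIntegral_eq_Ioo {a b : ℝ} (hab : a ≤ b) (f : ℝ → ℝ) :
    ∫ s in a..b, f s = ∫ s in Ioo a b, f s := by
  rw [intervalIntegral.integral_of_le hab, integral_Ioc_eq_integral_Ioo]

lemma hasTraces_trace (hH : DoubleWell H)
    (hd2 : MemLp (Function.uncurry d) 2 (cyl T (-kappa H) (kappa H)))
    (hrep : ∀ᵐ t ∂volume.restrict (Ioo 0 T), ∃ k, ∀ᵐ ξ ∂volume.restrict (Ioo (-1) 1),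
      u t ξ = k + ∫ s in (-kappa H)..(shat H ε ξ), d t s) :
    ∀ᵐ t ∂volume.restrict (Ioo 0 T),
      HasTraces (-1) 1 (u t) (traceLeft H ε u d t) (traceRight H ε u d t) := by
  have hk := kappa_pos hH
  filter_upwards [ae_eq_traceLeft hH hrep, memLp_two_slice hd2] with t h1 h2
  refine ⟨_, continuousOn_rep (ε := ε) (k := traceLeft H ε u d t) hH
    (integrableOn_of_memLp_two h2), h1, ?_, ?_⟩
  · simp only [shat_neg_one hH, intervalIntegral.integral_same, add_zero]
  · simp only [shat_one hH]
    rw [intervalIntegral_eq_Ioo (by linarith)]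
    rfl

/-- The rescaled density is a primitive. -/
lemma ae_uhat_eq (hH : DoubleWell H)
    (hrep : ∀ᵐ t ∂volume.restrict (Ioo 0 T), ∃ k, ∀ᵐ ξ ∂volume.restrict (Ioo (-1) 1),
      u t ξ = k + ∫ s in (-kappa H)..(shat H ε ξ), d t s) :
    ∀ᵐ t ∂volume.restrict (Ioo 0 T), ∀ᵐ s ∂volume.restrict (Ioo (-kappa H) (kappa H)),
      uhat H ε u t s = traceLeft H ε u d t + ∫ r in (-kappa H)..s, d t r := by
  filter_upwards [ae_eq_traceLeft hH hrep] with t h1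
  filter_upwards [(xihat_quasiMeasurePreserving hH ε).ae h1, ae_restrict_mem measurableSet_Ioo]
    with s h2 h3
  rw [shat_xihat hH ε (Ioo_subset_Icc_self h3)] at h2
  exact h2

lemma measurable_uhat (hH : DoubleWell H) (hu : Measurable (Function.uncurry u)) :
    Measurable (Function.uncurry (uhat H ε u)) :=
  hu.comp (measurable_fst.prodMk ((measurable_xihat hH ε).comp measurable_snd))

lemma ae_uhat_bounds (hH : DoubleWell H)
    (hb : ∀ᵐ z ∂cyl T (-1) 1, 0 ≤ Function.uncurry u z ∧ Function.uncurry u z ≤ C) :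
    ∀ᵐ z ∂cyl T (-kappa H) (kappa H), 0 ≤ Function.uncurry (uhat H ε u) z ∧
      Function.uncurry (uhat H ε u) z ≤ C :=
  (cyl_quasiMeasurePreserving hH T ε).ae hb

lemma isL2W12_uhat (hH : DoubleWell H) (hu : Measurable (Function.uncurry u))
    (hb : ∀ᵐ z ∂cyl T (-1) 1, 0 ≤ Function.uncurry u z ∧ Function.uncurry u z ≤ C)
    (hd2 : MemLp (Function.uncurry d) 2 (cyl T (-kappa H) (kappa H)))
    (hrep : ∀ᵐ t ∂volume.restrict (Ioo 0 T), ∃ k, ∀ᵐ ξ ∂volume.restrict (Ioo (-1) 1),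
      u t ξ = k + ∫ s in (-kappa H)..(shat H ε ξ), d t s) :
    IsL2W12 T (-kappa H) (kappa H) (uhat H ε u) d := by
  have hk := kappa_pos hH
  refine ⟨integrable_of_ae_bounds (measurable_uhat hH hu) (ae_uhat_bounds hH hb) 2, hd2, ?_⟩
  filter_upwards [ae_uhat_eq hH hrep, memLp_two_slice hd2] with t h1 h2
  exact isWeakDeriv_of_primitive (by linarith) (integrableOn_of_memLp_two h2) h1

/-- Oscillation of the density near the wells. -/
lemma ae_abs_sub_trace_le (hH : DoubleWell H) {δ : ℝ} (hδ1 : δ < 1)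
    (hd2 : MemLp (Function.uncurry d) 2 (cyl T (-kappa H) (kappa H)))
    (hrep : ∀ᵐ t ∂volume.restrict (Ioo 0 T), ∃ k, ∀ᵐ ξ ∂volume.restrict (Ioo (-1) 1),
      u t ξ = k + ∫ s in (-kappa H)..(shat H ε ξ), d t s) :
    ∀ᵐ t ∂volume.restrict (Ioo 0 T), ∀ᵐ ξ ∂volume.restrict (Ioo (-1) 1),
      (ξ ≤ -δ → |u t ξ - traceLeft H ε u d t| ≤ Real.sqrt (kappa H - shat H ε δ) / 2 *
        (1 + ∫ s in Ioo (-kappa H) (kappa H), d t s ^ 2)) ∧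
      (δ ≤ ξ → |u t ξ - traceRight H ε u d t| ≤ Real.sqrt (kappa H - shat H ε δ) / 2 *
        (1 + ∫ s in Ioo (-kappa H) (kappa H), d t s ^ 2)) := by
  have hk := kappa_pos hH
  have hmono := shat_strictMono hH ε
  have hr : 0 < kappa H - shat H ε δ := by
    rw [← shat_one hH ε]; linarith [hmono hδ1]
  filter_upwards [ae_eq_traceLeft hH hrep, memLp_two_slice hd2] with t h1 h2
  filter_upwards [h1, ae_restrict_mem measurableSet_Ioo] with ξ h3 h4
  have hmem := shat_mem hH ε (Ioo_subset_Icc_self h4)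
  have hi := integrableOn_of_memLp_two h2
  have hintg : ∀ x y, x ∈ S H → y ∈ S H → IntervalIntegrable (d t) volume x y := by
    intro x y hx hy
    have : IntervalIntegrable (d t) volume (-kappa H) (kappa H) :=
      (intervalIntegrable_iff_integrableOn_Ioo_of_le (by linarith)).2 hi
    refine this.mono_set ?_
    rw [uIcc_of_le (by linarith : -kappa H ≤ kappa H)]
    exact uIcc_subset_Icc hx hy
  have hl : -kappa H ∈ S H := ⟨le_rfl, by linarith⟩
  have hr' : kappa H ∈ S H := ⟨by linarith, le_rfl⟩
  constructor
  · intro hξ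
    have h5 := hmono.monotone hξ
    rw [shat_neg hH] at h5
    rw [h3, add_sub_cancel_left]
    refine abs_integral_le_sqrt hr h2 hl hmem ?_
    rw [abs_of_nonneg (by linarith [hmem.1])]
    linarith
  · intro hξ
    have h5 := hmono.monotone hξ
    have h6 : u t ξ - traceRight H ε u d t = ∫ s in (kappa H)..(shat H ε ξ), d t s := by
      rw [h3, traceRight, ← intervalIntegral_eq_Ioo (by linarith),
        ← intervalIntegral.integral_interval_sub_left (hintg _ _ hl hmem) (hintg _ _ hl hr')]
      ring
    rw [h6]
    refine abs_integral_le_sqrt hr h2 hr' hmem ?_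
    rw [abs_sub_comm, abs_of_nonneg (by linarith [hmem.2])]
    linarith

/-- Local averages near a well are close to the trace. -/
lemma abs_integral_sub_mul_le (hH : DoubleWell H) {μ : Measure Xi} [IsFiniteMeasure μ] {f : ℝ → ℝ}
    (hf : Measurable f) (hμ : IsDensity μ (gam H ε) f) {χ : ℝ → ℝ} (hχ : Continuous χ)
    (h0 : ∀ ξ ∈ Icc (-1 : ℝ) 1, 0 ≤ χ ξ) (h1 : ∀ ξ ∈ Icc (-1 : ℝ) 1, χ ξ ≤ 1) {k B : ℝ}
    (hB : 0 ≤ B)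
    (hk : ∀ᵐ ξ ∂volume.restrict (Ioo (-1) 1), χ ξ ≠ 0 → |f ξ - k| ≤ B) :
    |∫ x : Xi, χ x ∂μ - k * ∫ x : Xi, χ x ∂gam H ε| ≤ B := by
  have hg := g_continuous hH ε
  have hgi : IntegrableOn (g H ε) (Ioo (-1) 1) :=
    (hg.continuousOn.integrableOn_Icc).mono_set Ioo_subset_Icc_self
  have hgχ : IntegrableOn (fun ξ => g H ε ξ * χ ξ) (Ioo (-1) 1) :=
    ((hg.mul hχ).continuousOn.integrableOn_Icc).mono_set Ioo_subset_Icc_self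
  have hest : ∀ᵐ ξ ∂volume.restrict (Ioo (-1) 1),
      ‖g H ε ξ * (f ξ * χ ξ) - k * (g H ε ξ * χ ξ)‖ ≤ B * g H ε ξ := by
    filter_upwards [hk, ae_restrict_mem measurableSet_Ioo] with ξ h2 h3
    have h3' := Ioo_subset_Icc_self h3
    have e : g H ε ξ * (f ξ * χ ξ) - k * (g H ε ξ * χ ξ) = (χ ξ * (f ξ - k)) * g H ε ξ := by ring
    rw [e, norm_mul, Real.norm_of_nonneg (g_pos hH ε ξ).le]
    refine mul_le_mul_of_nonneg_right ?_ (g_pos hH ε ξ).le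
    rw [Real.norm_eq_abs, abs_mul, abs_of_nonneg (h0 ξ h3')]
    rcases eq_or_ne (χ ξ) 0 with hz | hz
    · rw [hz, zero_mul]; exact hB
    · calc χ ξ * |f ξ - k| ≤ 1 * B := mul_le_mul (h1 ξ h3') (h2 hz) (abs_nonneg _) zero_le_one
        _ = B := one_mul B
  have hdiff : IntegrableOn (fun ξ => g H ε ξ * (f ξ * χ ξ) - k * (g H ε ξ * χ ξ)) (Ioo (-1) 1) := by
    refine Integrable.mono' (hgi.const_mul B) ?_ hest
    exact ((hg.measurable.mul (hf.mul hχ.measurable)).sub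
      ((hg.measurable.mul hχ.measurable).const_mul k)).aestronglyMeasurable
  have hfi : IntegrableOn (fun ξ => g H ε ξ * (f ξ * χ ξ)) (Ioo (-1) 1) := by
    refine (hdiff.add (hgχ.const_mul k)).congr (Eventually.of_forall fun ξ => ?_)
    simp
  rw [integral_of_isDensity hH hf hμ χ, integral_gam hH ε χ, ← integral_const_mul,
    ← integral_sub hfi (hgχ.const_mul k), ← Real.norm_eq_abs]
  refine (norm_integral_le_of_norm_le (hgi.const_mul B) hest).trans ?_
  rw [integral_const_mul, integral_g hH, mul_one]

end Traces

/-- A sequence of curves with uniform estimates whose slopes and rescaled fluxes converge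
weakly and whose initial means converge. -/
structure CurveSeq (H : ℝ → ℝ) (T m C K : ℝ) (ε : ℕ → ℝ) (ρ : ℕ → ℝ → FiniteMeasure Xi)
    (u v d : ℕ → ℝ → ℝ → ℝ) (d₀ W : ℝ × ℝ → ℝ) (F₀ : ℝ) : Prop where
  well : DoubleWell H
  T_pos : 0 < T
  eps_pos : ∀ n, 0 < ε n
  eps_lim : Tendsto ε atTop (𝓝 0)
  u_meas : ∀ n, Measurable (Function.uncurry (u n))
  density : ∀ n, ∀ t ∈ Icc 0 T, IsDensity (ρ n t : Measure Xi) (gam H (ε n)) (u n t)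
  velocity : ∀ n, IsVelocity 0 T (ρ n) (v n)
  mass : ∀ n, ∀ t ∈ Icc 0 T, (ρ n t : Measure Xi).real univ = m
  bounds : ∀ n, ∀ᵐ z ∂cyl T (-1) 1,
    0 ≤ Function.uncurry (u n) z ∧ Function.uncurry (u n) z ≤ C
  d_meas : ∀ n, Measurable (Function.uncurry (d n))
  d_sq : ∀ n, ∫ z, Function.uncurry (d n) z ^ 2 ∂cyl T (-kappa H) (kappa H) ≤ K
  d_rep : ∀ n, ∀ᵐ t ∂volume.restrict (Ioo 0 T), ∃ k, ∀ᵐ ξ ∂volume.restrict (Ioo (-1) 1),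
    u n t ξ = k + ∫ s in (-kappa H)..(shat H (ε n) ξ), d n t s
  d_weak : WeakL2 (cyl T (-kappa H) (kappa H)) (fun n => Function.uncurry (d n)) d₀
  w_weak : WeakL2 (cyl T (-kappa H) (kappa H))
    (fun n => Function.uncurry (what H (ε n) (u n) (v n))) W
  d₀_meas : Measurable d₀
  W_meas : Measurable W
  mean_lim : Tendsto (fun n => ∫ x : Xi, shat H (ε n) x ∂(ρ n 0 : Measure Xi)) atTop (𝓝 F₀)

/-- The limit of the mean of the rescaled coordinate. -/
def limMean (H : ℝ → ℝ) (W : ℝ × ℝ → ℝ) (F₀ t : ℝ) : ℝ :=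
  F₀ + ∫ r in (0 : ℝ)..t, ∫ s in Ioo (-kappa H) (kappa H), W (r, s)

/-- The limit density, written as an affine function of the position. -/
def limDensity (H : ℝ → ℝ) (m : ℝ) (W : ℝ × ℝ → ℝ) (F₀ t x : ℝ) : ℝ :=
  m + x * (limMean H W F₀ t / kappa H)

/-! ### Passage to the limit: measures at every time, regularity and the limit flux -/

namespace CurveSeq

variable {H : ℝ → ℝ} {T m C K : ℝ} {ε : ℕ → ℝ} {ρ : ℕ → ℝ → FiniteMeasure Xi}
  {u v d : ℕ → ℝ → ℝ → ℝ} {d₀ W : ℝ × ℝ → ℝ} {F₀ : ℝ}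

/-! #### Convergence at every time -/

/-- The indicator of `(0,t) × S` is an admissible test function for the weak convergence of `ŵ`, and
pairing with it produces exactly the increment of the mean. Thus the convergence holds at each `t`
along one common subsequence. -/
lemma tendsto_mean (h : CurveSeq H T m C K ε ρ u v d d₀ W F₀) {t : ℝ} (ht : t ∈ Icc 0 T) :
    Tendsto (fun n => ∫ x : Xi, shat H (ε n) x ∂(ρ n t : Measure Xi)) atTop
      (𝓝 (limMean H W F₀ t)) := by
  have hφ : Measurable ((Ioo 0 t).indicator (1 : ℝ → ℝ)) :=
    measurable_one.indicator measurableSet_Ioo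
  have hK : ∀ r, |(Ioo 0 t).indicator (1 : ℝ → ℝ) r| ≤ 1 := by
    intro r; by_cases hr : r ∈ Ioo 0 t <;> simp [hr]
  have key : ∀ f : ℝ × ℝ → ℝ, Integrable f (cyl T (-kappa H) (kappa H)) →
      ∫ z, f z * (Ioo 0 t).indicator (1 : ℝ → ℝ) z.1 ∂cyl T (-kappa H) (kappa H)
        = ∫ r in (0 : ℝ)..t, ∫ s in Ioo (-kappa H) (kappa H), f (r, s) := by
    intro f hf
    rw [integral_cyl_mul_fst hf hφ hK, intervalIntegral_eq_Ioo ht.1]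
    have e : ∀ r, (Ioo 0 t).indicator (1 : ℝ → ℝ) r * ∫ s in Ioo (-kappa H) (kappa H), f (r, s)
        = (Ioo 0 t).indicator (fun r => ∫ s in Ioo (-kappa H) (kappa H), f (r, s)) r := by
      intro r; by_cases hr : r ∈ Ioo 0 t <;> simp [hr]
    simp only [e]
    rw [setIntegral_indicator measurableSet_Ioo,
      inter_eq_right.2 (Ioo_subset_Ioo_right ht.2)]
  have hlim := h.w_weak.2.2 (fun z => (Ioo 0 t).indicator (1 : ℝ → ℝ) z.1)
    (memLp_of_bounded (hφ.comp measurable_fst) (fun z => hK z.1) 2)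
  rw [key _ (h.w_weak.2.1.integrable (by norm_num))] at hlim
  refine (h.mean_lim.add hlim).congr fun n => ?_
  have hi := (h.w_weak.1 n).integrable (by norm_num : (1 : ℝ≥0∞) ≤ 2)
  rw [key _ hi, integral_shat_eq h.well h.T_pos (h.u_meas n) (h.density n) (h.velocity n) hi ht]
  rfl

lemma integral_le (h : CurveSeq H T m C K ε ρ u v d d₀ W F₀) (n : ℕ) {t : ℝ} (ht : t ∈ Icc 0 T)
    (ψ : Xi → ℝ) (hψ : Continuous ψ) (h0 : ∀ x, 0 ≤ ψ x) :
    ∫ x, ψ x ∂(ρ n t : Measure Xi) ≤ C * ∫ x, ψ x ∂gam H (ε n) :=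
  integral_le_of_bounds h.well h.T_pos (h.velocity n).1 (h.u_meas n) (h.density n) (h.bounds n)
    ht hψ h0

lemma abs_limMean_le (h : CurveSeq H T m C K ε ρ u v d d₀ W F₀) {t : ℝ} (ht : t ∈ Icc 0 T) :
    |limMean H W F₀ t| ≤ kappa H * m := by
  refine le_of_tendsto (h.tendsto_mean ht).abs (Eventually.of_forall fun n => ?_)
  rw [← Real.norm_eq_abs, ← h.mass n t ht]
  refine norm_integral_le_of_norm_le_const (Eventually.of_forall fun x => ?_)
  rw [Real.norm_eq_abs, abs_le]
  exact shat_mem h.well (ε n) x.2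

/-- Since `|ŝ| ≤ κ`, the limit mean is at most `κ m` in absolute value; this is what makes both
weights nonnegative. -/
lemma limDensity_bounds (h : CurveSeq H T m C K ε ρ u v d d₀ W F₀) {t x : ℝ} (ht : t ∈ Icc 0 T)
    (hx : x ∈ Icc (-1 : ℝ) 1) : 0 ≤ limDensity H m W F₀ t x ∧ limDensity H m W F₀ t x ≤ 2 * m := by
  have hk := kappa_pos h.well
  have h1 : |limMean H W F₀ t / kappa H| ≤ m := by
    rw [abs_div, abs_of_pos hk, div_le_iff₀ hk, mul_comm]
    exact h.abs_limMean_le ht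
  have h2 : |x * (limMean H W F₀ t / kappa H)| ≤ m := by
    rw [abs_mul]
    calc |x| * |limMean H W F₀ t / kappa H| ≤ 1 * m :=
          mul_le_mul (abs_le.2 hx) h1 (abs_nonneg _) zero_le_one
      _ = m := one_mul m
  have h3 := abs_le.1 h2
  unfold limDensity
  constructor <;> linarith

lemma tendsto_integral (h : CurveSeq H T m C K ε ρ u v d d₀ W F₀) {t : ℝ} (ht : t ∈ Icc 0 T)
    {Φ : ℕ → Xi → ℝ} {M α β : ℝ} (hc : ∀ n, Continuous (Φ n)) (hM : ∀ n x, |Φ n x| ≤ M)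
    (hα : ∀ e > 0, ∃ η ∈ Ico (0 : ℝ) 1, ∀ᶠ n in atTop, ∀ x : Xi, (x : ℝ) ≤ -η → |Φ n x - α| ≤ e)
    (hβ : ∀ e > 0, ∃ η ∈ Ico (0 : ℝ) 1, ∀ᶠ n in atTop, ∀ x : Xi, η ≤ (x : ℝ) → |Φ n x - β| ≤ e) :
    Tendsto (fun n => ∫ x, Φ n x ∂(ρ n t : Measure Xi)) atTop
      (𝓝 (α * (limDensity H m W F₀ t (-1) / 2) + β * (limDensity H m W F₀ t 1 / 2))) := by
  have := tendsto_integral_of_dominated h.well h.eps_pos h.eps_lim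
    (μ := fun n => (ρ n t : Measure Xi)) (fun n => h.mass n t ht) (fun n => h.integral_le n ht)
    (h.tendsto_mean ht) hc hM hα hβ
  refine this.trans_eq ?_
  unfold limDensity
  congr 1; ring

lemma exists_near_of_continuous {Φ : Xi → ℝ} (hΦ : Continuous Φ) :
    (∃ M, ∀ x, |Φ x| ≤ M) ∧
    (∀ e > 0, ∃ η ∈ Ico (0 : ℝ) 1, ∀ x : Xi, (x : ℝ) ≤ -η → |Φ x - Φ ⟨-1, by norm_num⟩| ≤ e) ∧
    (∀ e > 0, ∃ η ∈ Ico (0 : ℝ) 1, ∀ x : Xi, η ≤ (x : ℝ) → |Φ x - Φ ⟨1, by norm_num⟩| ≤ e) := by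
  refine ⟨?_, fun e he => ?_, fun e he => ?_⟩
  · obtain ⟨M, hM⟩ := isCompact_univ.exists_bound_of_continuousOn hΦ.continuousOn
    exact ⟨M, fun x => hM x (mem_univ _)⟩
  · obtain ⟨r, hr, hr'⟩ := Metric.continuous_iff.1 hΦ ⟨-1, by norm_num⟩ e he
    refine ⟨max 0 (1 - r / 2), ⟨le_max_left _ _, max_lt one_pos (by linarith)⟩, fun x hx => ?_⟩
    have h1 : 1 - r / 2 ≤ -x := by linarith [le_max_right 0 (1 - r / 2)]
    refine (hr' x ?_).le
    rw [Subtype.dist_eq, Real.dist_eq, abs_of_nonneg (by linarith [x.2.1])]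
    simp only; linarith
  · obtain ⟨r, hr, hr'⟩ := Metric.continuous_iff.1 hΦ ⟨1, by norm_num⟩ e he
    refine ⟨max 0 (1 - r / 2), ⟨le_max_left _ _, max_lt one_pos (by linarith)⟩, fun x hx => ?_⟩
    have h1 : 1 - r / 2 ≤ x := (le_max_right 0 (1 - r / 2)).trans hx
    refine (hr' x ?_).le
    rw [Subtype.dist_eq, Real.dist_eq, abs_sub_comm, abs_of_nonneg (by linarith [x.2.2])]
    simp only; linarith

lemma tendsto_integral_fixed (h : CurveSeq H T m C K ε ρ u v d d₀ W F₀) {t : ℝ}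
    (ht : t ∈ Icc 0 T) {Φ : Xi → ℝ} (hΦ : Continuous Φ) :
    Tendsto (fun n => ∫ x, Φ x ∂(ρ n t : Measure Xi)) atTop
      (𝓝 (Φ ⟨-1, by norm_num⟩ * (limDensity H m W F₀ t (-1) / 2)
        + Φ ⟨1, by norm_num⟩ * (limDensity H m W F₀ t 1 / 2))) := by
  obtain ⟨⟨M, hM⟩, hα, hβ⟩ := exists_near_of_continuous hΦ
  refine h.tendsto_integral ht (fun _ => hΦ) (fun _ => hM) (fun e he => ?_) (fun e he => ?_)
  · obtain ⟨η, hη, h1⟩ := hα e he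
    exact ⟨η, hη, Eventually.of_forall fun _ => h1⟩
  · obtain ⟨η, hη, h1⟩ := hβ e he
    exact ⟨η, hη, Eventually.of_forall fun _ => h1⟩

/-- The integrand varies with `n`, but `ŝ_n(1/2) → κ` makes it uniformly close to the end-point
values on `|x| ≥ 1/2`. Therefore `η = 1/2` serves for every tolerance. -/
lemma tendsto_integral_rescaled (h : CurveSeq H T m C K ε ρ u v d d₀ W F₀) {t : ℝ}
    (ht : t ∈ Icc 0 T) {Φ : S H → ℝ} (hΦ : Continuous Φ) :
    Tendsto (fun n => ∫ x, Φ (rescale h.well (ε n) x) ∂(ρ n t : Measure Xi)) atTop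
      (𝓝 (Φ ⟨-kappa H, le_refl _, neg_le_self (kappa_nonneg H)⟩
          * (limDensity H m W F₀ t (-1) / 2)
        + Φ ⟨kappa H, neg_le_self (kappa_nonneg H), le_refl _⟩
          * (limDensity H m W F₀ t 1 / 2))) := by
  obtain ⟨M, hM⟩ := isCompact_univ.exists_bound_of_continuousOn hΦ.continuousOn
  have hs := tendsto_shat h.well h.eps_pos h.eps_lim (δ := 1 / 2) (by norm_num) (by norm_num)
  have hresc : ∀ n, Continuous (rescale h.well (ε n)) := fun n =>
    (continuous_shat_Xi h.well (ε n)).subtype_mk _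
  refine h.tendsto_integral ht (fun n => hΦ.comp (hresc n)) (M := M)
    (fun n x => hM _ (mem_univ _)) (fun e he => ?_) (fun e he => ?_)
  · obtain ⟨r, hr, hr'⟩ := Metric.continuous_iff.1 hΦ
      ⟨-kappa H, le_refl _, neg_le_self (kappa_nonneg H)⟩ e he
    refine ⟨1 / 2, by norm_num, ?_⟩
    filter_upwards [hs.eventually (lt_mem_nhds (by linarith : kappa H - r < kappa H))] with n hn x hx
    refine (hr' _ ?_).le
    have h1 := (shat_strictMono h.well (ε n)).monotone hx
    rw [shat_neg h.well] at h1
    have h2 := (shat_mem h.well (ε n) x.2).1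
    rw [Subtype.dist_eq, Real.dist_eq]
    simp only [rescale]
    rw [abs_of_nonneg (by linarith)]
    linarith
  · obtain ⟨r, hr, hr'⟩ := Metric.continuous_iff.1 hΦ
      ⟨kappa H, neg_le_self (kappa_nonneg H), le_refl _⟩ e he
    refine ⟨1 / 2, by norm_num, ?_⟩
    filter_upwards [hs.eventually (lt_mem_nhds (by linarith : kappa H - r < kappa H))] with n hn x hx
    refine (hr' _ ?_).le
    have h1 := (shat_strictMono h.well (ε n)).monotone hx
    have h2 := (shat_mem h.well (ε n) x.2).2
    rw [Subtype.dist_eq, Real.dist_eq]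
    simp only [rescale]
    rw [abs_sub_comm, abs_of_nonneg (by linarith)]
    linarith

/-! #### Regularity of the limit in time -/

lemma integrable_limFlux (h : CurveSeq H T m C K ε ρ u v d d₀ W F₀) :
    IntegrableOn (fun r => ∫ s in Ioo (-kappa H) (kappa H), W (r, s)) (Ioo 0 T) :=
  integrable_integral_slice (h.w_weak.2.1.integrable (by norm_num))

lemma continuousOn_limMean (h : CurveSeq H T m C K ε ρ u v d d₀ W F₀) :
    ContinuousOn (limMean H W F₀) (Icc 0 T) :=
  continuousOn_primitive h.T_pos.le h.integrable_limFlux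

lemma limDensity_eq_primitive (H : ℝ → ℝ) (m : ℝ) (W : ℝ × ℝ → ℝ) (F₀ t x : ℝ) :
    limDensity H m W F₀ t x = (m + x * (F₀ / kappa H)) + ∫ r in (0 : ℝ)..t,
      x / kappa H * ∫ s in Ioo (-kappa H) (kappa H), W (r, s) := by
  rw [intervalIntegral.integral_const_mul]
  unfold limDensity limMean
  ring

lemma continuousOn_limDensity (h : CurveSeq H T m C K ε ρ u v d d₀ W F₀) (x : ℝ) :
    ContinuousOn (fun t => limDensity H m W F₀ t x) (Icc 0 T) :=
  continuousOn_const.add (continuousOn_const.mul (h.continuousOn_limMean.div_const _))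

lemma absolutelyContinuous_limDensity (h : CurveSeq H T m C K ε ρ u v d d₀ W F₀) (x : ℝ) :
    AbsolutelyContinuousOnInterval (fun t => limDensity H m W F₀ t x) 0 T := by
  simp only [limDensity_eq_primitive]
  exact absolutelyContinuous_primitive h.T_pos.le (h.integrable_limFlux.const_mul _)

lemma ae_hasDerivAt_limDensity (h : CurveSeq H T m C K ε ρ u v d d₀ W F₀) (x : ℝ) :
    ∀ᵐ t ∂volume.restrict (Ioo 0 T), HasDerivAt (fun t => limDensity H m W F₀ t x)
      (x / kappa H * ∫ s in Ioo (-kappa H) (kappa H), W (t, s)) t := by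
  simp only [limDensity_eq_primitive]
  exact ae_hasDerivAt_primitive h.T_pos.le (h.integrable_limFlux.const_mul _)

lemma integral_limDensity_mul_deriv (h : CurveSeq H T m C K ε ρ u v d d₀ W F₀) (x : ℝ)
    {φ : ℝ → ℝ} (hφ : ContDiff ℝ ∞ φ) (hs : tsupport φ ⊆ Ioo 0 T) :
    ∫ t in Ioo 0 T, limDensity H m W F₀ t x * deriv φ t
      = -(x / kappa H * ∫ t in Ioo 0 T, φ t * ∫ s in Ioo (-kappa H) (kappa H), W (t, s)) := by
  simp only [limDensity_eq_primitive]
  rw [integral_primitive_mul_deriv h.T_pos.le (h.integrable_limFlux.const_mul _) hφ,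
    eq_zero_of_tsupport_subset_Ioo hs (x := 0) (by simp),
    eq_zero_of_tsupport_subset_Ioo hs (x := T) (by simp), ← integral_const_mul]
  simp only [mul_zero, sub_zero, zero_sub]
  congr 2
  funext t; ring

/-- The limit flux is constant in space. -/
lemma ae_limFlux_eq (h : CurveSeq H T m C K ε ρ u v d d₀ W F₀) :
    W =ᵐ[cyl T (-kappa H) (kappa H)]
      fun z => 1 / (2 * kappa H) * ∫ s in Ioo (-kappa H) (kappa H), W (z.1, s) := by
  have hk := kappa_pos h.well
  have hWi : Integrable W (cyl T (-kappa H) (kappa H)) := h.w_weak.2.1.integrable (by norm_num)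
  have hωi : Integrable (fun z : ℝ × ℝ => 1 / (2 * kappa H) *
      ∫ s in Ioo (-kappa H) (kappa H), W (z.1, s)) (cyl T (-kappa H) (kappa H)) := by
    have := (h.integrable_limFlux.const_mul (1 / (2 * kappa H))).comp_fst
      (volume.restrict (Ioo (-kappa H) (kappa H)))
    rw [cyl_eq_prod]; exact this
  have hz := ae_eq_zero_of_product_test (hWi.sub hωi) fun φ ψ hφ hcφ hsφ hψ hcψ _ => ?_
  · filter_upwards [hz] with z hz
    exact sub_eq_zero.1 hz
  have hder : ∀ x, HasDerivAt (fun x => ∫ y in (0 : ℝ)..x, ψ y) (ψ x) x := fun x =>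
    intervalIntegral.integral_hasDerivAt_right (hψ.continuous.intervalIntegrable _ _)
      (hψ.continuous.stronglyMeasurableAtFilter _ _) hψ.continuous.continuousAt
  set B : ℝ → ℝ := fun x => ∫ y in (0 : ℝ)..x, ψ y with hBdef
  have hd : deriv B = ψ := funext fun x => (hder x).deriv
  have hB : ContDiff ℝ ∞ B := by
    rw [contDiff_infty_iff_deriv, hd]
    exact ⟨fun x => (hder x).differentiableAt, hψ⟩
  -- The limit measures see `B` only at `±κ`, so this difference is all that remains of `ψ`.
  have hBd : B (kappa H) - B (-kappa H) = ∫ s in Ioo (-kappa H) (kappa H), ψ s := by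
    rw [← intervalIntegral_eq_Ioo (by linarith), intervalIntegral.integral_interval_sub_left
      (hψ.continuous.intervalIntegrable _ _) (hψ.continuous.intervalIntegrable _ _)]
  obtain ⟨Lφ, hLφ⟩ := hcφ.exists_bound_of_continuous hφ.continuous
  obtain ⟨Lφ', hLφ'⟩ := hcφ.deriv.exists_bound_of_continuous
    (hφ.continuous_deriv (by norm_cast))
  obtain ⟨Lψ, hLψ⟩ := hcψ.exists_bound_of_continuous hψ.continuous
  have hfub : ∀ f : ℝ × ℝ → ℝ, Integrable f (cyl T (-kappa H) (kappa H)) → _ := fun f hf =>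
    integral_cyl_mul hf hφ.continuous.measurable hψ.continuous.measurable hLφ fun s _ => hLψ s
  -- the flux term converges
  have hlim2 := h.w_weak.2.2 (fun z => φ z.1 * ψ z.2) (memLp_of_bounded
    ((hφ.continuous.measurable.comp measurable_fst).mul
      (hψ.continuous.measurable.comp measurable_snd)) (K := Lφ * Lψ) (fun z => by
      rw [Pi.mul_apply, abs_mul]
      exact mul_le_mul (hLφ _) (hLψ _) (abs_nonneg _) ((abs_nonneg _).trans (hLφ 0))) 2)
  -- the time derivative converges
  obtain ⟨M, hM⟩ := (isCompact_Icc (a := -kappa H) (b := kappa H)).exists_bound_of_continuousOn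
    hB.continuous.continuousOn
  have hlim1 : Tendsto (fun n => ∫ t in Ioo 0 T, deriv φ t *
      ∫ x : Xi, B (shat H (ε n) x) ∂(ρ n t : Measure Xi)) atTop
      (𝓝 (∫ t in Ioo 0 T, deriv φ t * (B (-kappa H) * (limDensity H m W F₀ t (-1) / 2)
        + B (kappa H) * (limDensity H m W F₀ t 1 / 2)))) := by
    refine tendsto_integral_of_dominated_convergence (fun _ => Lφ' * (M * m)) (fun n => ?_)
      (integrable_const _) (fun n => ?_) ?_
    · have hc := (hφ.continuous_deriv (by norm_cast)).continuousOn.mul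
        (continuousOn_integral (h.velocity n).1
          (hB.continuous.comp (continuous_shat_Xi h.well (ε n))))
      exact (hc.mono Ioo_subset_Icc_self).aestronglyMeasurable measurableSet_Ioo
    · filter_upwards [ae_restrict_mem measurableSet_Ioo] with t ht
      rw [norm_mul]
      refine mul_le_mul (hLφ' t) ?_ (norm_nonneg _) ((norm_nonneg _).trans (hLφ' 0))
      rw [← h.mass n t (Ioo_subset_Icc_self ht)]
      exact norm_integral_le_of_norm_le_const (Eventually.of_forall fun x =>
        hM _ (shat_mem h.well (ε n) x.2))
    · filter_upwards [ae_restrict_mem measurableSet_Ioo] with t ht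
      exact (h.tendsto_integral_rescaled (Ioo_subset_Icc_self ht) (Φ := fun s => B s)
        (hB.continuous.comp continuous_subtype_val)).const_mul _
  have hzero := hlim1.add hlim2
  have hconst : ∀ n, (∫ t in Ioo 0 T, deriv φ t *
      ∫ x : Xi, B (shat H (ε n) x) ∂(ρ n t : Measure Xi))
      + ∫ z, Function.uncurry (what H (ε n) (u n) (v n)) z * (φ z.1 * ψ z.2)
        ∂cyl T (-kappa H) (kappa H) = 0 := by
    intro n
    rw [(hfub _ ((h.w_weak.1 n).integrable (by norm_num))).2.2]
    have := continuityEq_rescaled h.well (h.u_meas n) (h.density n) (h.velocity n) hφ hcφ hsφ hB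
    rw [hd] at this
    exact this
  -- The two terms add up to zero for every `n`, hence also in the limit.
  have hL := tendsto_nhds_unique (hzero.congr hconst) tendsto_const_nhds
  rw [(hfub _ hWi).2.2] at hL
  -- evaluate the time derivative term
  have hi : ∀ x, Integrable (fun t => limDensity H m W F₀ t x * deriv φ t)
      (volume.restrict (Ioo 0 T)) := fun x =>
    (((h.continuousOn_limDensity x).mul
      (hφ.continuous_deriv (by norm_cast)).continuousOn).integrableOn_Icc).mono_set
      Ioo_subset_Icc_self
  have e1 : ∫ t in Ioo 0 T, deriv φ t * (B (-kappa H) * (limDensity H m W F₀ t (-1) / 2)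
        + B (kappa H) * (limDensity H m W F₀ t 1 / 2))
      = B (-kappa H) / 2 * (∫ t in Ioo 0 T, limDensity H m W F₀ t (-1) * deriv φ t)
        + B (kappa H) / 2 * ∫ t in Ioo 0 T, limDensity H m W F₀ t 1 * deriv φ t := by
    rw [← integral_const_mul, ← integral_const_mul,
      ← integral_add ((hi _).const_mul _) ((hi _).const_mul _)]
    congr 1; funext t; ring
  rw [e1, h.integral_limDensity_mul_deriv _ hφ hsφ, h.integral_limDensity_mul_deriv _ hφ hsφ] at hL
  have e2 : ∫ t in Ioo 0 T, φ t * ∫ x in Ioo (-kappa H) (kappa H), ψ x * (1 / (2 * kappa H) *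
        ∫ s in Ioo (-kappa H) (kappa H), W (t, s))
      = (B (kappa H) - B (-kappa H)) * (1 / (2 * kappa H)) *
        ∫ t in Ioo 0 T, φ t * ∫ s in Ioo (-kappa H) (kappa H), W (t, s) := by
    rw [hBd, ← integral_const_mul]
    refine integral_congr_ae (Eventually.of_forall fun t => ?_)
    simp only
    rw [integral_mul_const]; ring
  have e3 : ∫ t in Ioo 0 T, φ t * ∫ x in Ioo (-kappa H) (kappa H), ψ x *
        ((W - fun z : ℝ × ℝ => 1 / (2 * kappa H) *
          ∫ s in Ioo (-kappa H) (kappa H), W (z.1, s)) (t, x))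
      = (∫ t in Ioo 0 T, φ t * ∫ x in Ioo (-kappa H) (kappa H), ψ x * W (t, x))
        - ∫ t in Ioo 0 T, φ t * ∫ x in Ioo (-kappa H) (kappa H), ψ x * (1 / (2 * kappa H) *
          ∫ s in Ioo (-kappa H) (kappa H), W (t, s)) := by
    rw [← (hfub _ (hWi.sub hωi)).2.2, ← (hfub _ hWi).2.2, ← (hfub _ hωi).2.2,
      ← integral_sub (hfub _ hWi).1 (hfub _ hωi).1]
    congr 1; funext z; simp only [Pi.sub_apply]; ring
  refine e3.trans ?_
  rw [e2]
  -- The densities at the two wells have opposite time derivatives, so the boundary values of `B`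
  -- enter only through their difference; the factor `1/(2κ)` is that of the average over `S`.
  have e4 : ∀ I : ℝ, B (-kappa H) / 2 * -(-1 / kappa H * I) + B (kappa H) / 2 * -(1 / kappa H * I)
      = -((B (kappa H) - B (-kappa H)) * (1 / (2 * kappa H)) * I) := by
    intro I; field_simp; ring
  rw [e4] at hL
  linarith

end CurveSeq

/-! ### The limit measures -/

instance isFiniteMeasure_gam0 : IsFiniteMeasure gam0 := by
  refine ⟨?_⟩
  simp only [gam0, Measure.coe_add, Measure.coe_smul, Pi.add_apply, Pi.smul_apply, measure_univ,
    smul_eq_mul, mul_one]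
  exact ENNReal.add_lt_top.2 ⟨by simp, by simp⟩

/-- The limit curve of measures on `Ξ`. -/
def limCurve (H : ℝ → ℝ) (m : ℝ) (W : ℝ × ℝ → ℝ) (F₀ t : ℝ) : FiniteMeasure Xi :=
  ⟨gam0.withDensity fun x => ENNReal.ofReal (limDensity H m W F₀ t x),
    isFiniteMeasure_withDensity_ofReal
      (integrable_of_continuous_Xi (ψ := fun x : Xi => limDensity H m W F₀ t x)
        (continuous_const.add (continuous_subtype_val.mul continuous_const))).2⟩

/-- The limit curve of measures on `S`. -/
def limRescaled (H : ℝ → ℝ) (m : ℝ) (W : ℝ × ℝ → ℝ) (F₀ t : ℝ) : FiniteMeasure (S H) :=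
  ⟨twoPoint H (limDensity H m W F₀ t (-1)) (limDensity H m W F₀ t 1), by
    refine ⟨?_⟩
    simp only [twoPoint, Measure.coe_add, Measure.coe_smul, Pi.add_apply, Pi.smul_apply,
      measure_univ, smul_eq_mul, mul_one]
    exact ENNReal.add_lt_top.2 ⟨ENNReal.ofReal_lt_top, ENNReal.ofReal_lt_top⟩⟩

/-- The spatially constant limit flux. -/
def limFlux (H : ℝ → ℝ) (W : ℝ × ℝ → ℝ) (t : ℝ) : ℝ :=
  1 / (2 * kappa H) * ∫ s in Ioo (-kappa H) (kappa H), W (t, s)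

lemma integral_gam0 {Φ : Xi → ℝ} (hΦ : Continuous Φ) :
    ∫ x, Φ x ∂gam0 = Φ ⟨-1, by norm_num⟩ / 2 + Φ ⟨1, by norm_num⟩ / 2 := by
  rw [gam0, integral_add_measure, integral_smul_measure, integral_smul_measure, integral_dirac,
    integral_dirac]
  · simp only [one_div, ENNReal.toReal_inv, ENNReal.toReal_ofNat, smul_eq_mul]
    ring
  · exact (integrable_of_continuous_Xi hΦ).smul_measure (by simp)
  · exact (integrable_of_continuous_Xi hΦ).smul_measure (by simp)

lemma ae_gam0 {P : Xi → Prop} (h1 : P ⟨-1, by norm_num⟩) (h2 : P ⟨1, by norm_num⟩) :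
    ∀ᵐ x ∂gam0, P x := by
  rw [gam0, ae_add_measure_iff]
  constructor
  · refine Measure.ae_smul_measure ?_ _
    rw [ae_dirac_eq]; exact h1
  · refine Measure.ae_smul_measure ?_ _
    rw [ae_dirac_eq]; exact h2

lemma integral_leb {K : Set ℝ} (hK : MeasurableSet K) (f : ℝ → ℝ) :
    ∫ x : K, f x ∂leb K = ∫ x in K, f x :=
  integral_subtype_comap hK f

lemma integral_twoPoint {H : ℝ → ℝ} {α β : ℝ} (hα : 0 ≤ α) (hβ : 0 ≤ β) (Φ : S H → ℝ) :
    ∫ x, Φ x ∂twoPoint H α β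
      = Φ ⟨-kappa H, le_refl _, neg_le_self (kappa_nonneg H)⟩ * (α / 2)
        + Φ ⟨kappa H, neg_le_self (kappa_nonneg H), le_refl _⟩ * (β / 2) := by
  rw [twoPoint, integral_add_measure, integral_smul_measure, integral_smul_measure, integral_dirac,
    integral_dirac, ENNReal.toReal_ofReal (by positivity), ENNReal.toReal_ofReal (by positivity)]
  · simp only [smul_eq_mul]; ring
  · exact (integrable_dirac (by simp)).smul_measure ENNReal.ofReal_ne_top
  · exact (integrable_dirac (by simp)).smul_measure ENNReal.ofReal_ne_top

namespace CurveSeq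

variable {H : ℝ → ℝ} {T m C K : ℝ} {ε : ℕ → ℝ} {ρ : ℕ → ℝ → FiniteMeasure Xi}
  {u v d : ℕ → ℝ → ℝ → ℝ} {d₀ W : ℝ × ℝ → ℝ} {F₀ : ℝ}

lemma limDensity_left_nonneg (h : CurveSeq H T m C K ε ρ u v d d₀ W F₀) {t : ℝ}
    (ht : t ∈ Icc 0 T) : 0 ≤ limDensity H m W F₀ t (-1) :=
  (h.limDensity_bounds ht (by norm_num)).1

lemma limDensity_right_nonneg (h : CurveSeq H T m C K ε ρ u v d d₀ W F₀) {t : ℝ}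
    (ht : t ∈ Icc 0 T) : 0 ≤ limDensity H m W F₀ t 1 :=
  (h.limDensity_bounds ht (by norm_num)).1

lemma isDensity_limCurve (h : CurveSeq H T m C K ε ρ u v d d₀ W F₀) {t : ℝ} (ht : t ∈ Icc 0 T) :
    IsDensity (limCurve H m W F₀ t : Measure Xi) gam0 (limDensity H m W F₀ t) :=
  ⟨ae_gam0 (h.limDensity_left_nonneg ht) (h.limDensity_right_nonneg ht), rfl⟩

lemma integral_limCurve (h : CurveSeq H T m C K ε ρ u v d d₀ W F₀) {t : ℝ} (ht : t ∈ Icc 0 T)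
    {Φ : Xi → ℝ} (hΦ : Continuous Φ) :
    ∫ x, Φ x ∂(limCurve H m W F₀ t : Measure Xi)
      = Φ ⟨-1, by norm_num⟩ * (limDensity H m W F₀ t (-1) / 2)
        + Φ ⟨1, by norm_num⟩ * (limDensity H m W F₀ t 1 / 2) := by
  have hc : Continuous fun x : Xi => limDensity H m W F₀ t x :=
    continuous_const.add (continuous_subtype_val.mul continuous_const)
  have h1 : (limCurve H m W F₀ t : Measure Xi) = gam0.withDensity fun x =>
      ((limDensity H m W F₀ t x).toNNReal : ℝ≥0∞) := rfl
  rw [h1, integral_withDensity_eq_integral_smul hc.measurable.real_toNNReal]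
  have hcN : Continuous fun x : Xi => (limDensity H m W F₀ t x).toNNReal • Φ x :=
    (continuous_real_toNNReal.comp hc).smul hΦ
  rw [integral_gam0 hcN]
  simp only [NNReal.smul_def, smul_eq_mul]
  rw [Real.coe_toNNReal _ (h.limDensity_left_nonneg ht),
    Real.coe_toNNReal _ (h.limDensity_right_nonneg ht)]
  ring

lemma continuousOn_limCurve (h : CurveSeq H T m C K ε ρ u v d d₀ W F₀) :
    ContinuousOn (limCurve H m W F₀) (Icc 0 T) := by
  intro t ht
  refine FiniteMeasure.tendsto_iff_forall_integral_tendsto.2 fun Φ => ?_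
  have hc : ContinuousOn (fun t => Φ ⟨-1, by norm_num⟩ * (limDensity H m W F₀ t (-1) / 2)
        + Φ ⟨1, by norm_num⟩ * (limDensity H m W F₀ t 1 / 2)) (Icc 0 T) :=
    (continuousOn_const.mul ((h.continuousOn_limDensity (-1)).div_const 2)).add
      (continuousOn_const.mul ((h.continuousOn_limDensity 1).div_const 2))
  rw [h.integral_limCurve ht Φ.continuous]
  refine (hc t ht).congr' ?_
  filter_upwards [self_mem_nhdsWithin] with r hr
  exact (h.integral_limCurve hr Φ.continuous).symm

lemma tendsto_limCurve (h : CurveSeq H T m C K ε ρ u v d d₀ W F₀) {t : ℝ} (ht : t ∈ Icc 0 T) :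
    Tendsto (fun n => ρ n t) atTop (𝓝 (limCurve H m W F₀ t)) := by
  refine FiniteMeasure.tendsto_iff_forall_integral_tendsto.2 fun Φ => ?_
  rw [h.integral_limCurve ht Φ.continuous]
  exact h.tendsto_integral_fixed ht Φ.continuous

lemma integral_limRescaled (h : CurveSeq H T m C K ε ρ u v d d₀ W F₀) {t : ℝ} (ht : t ∈ Icc 0 T)
    (Φ : S H → ℝ) :
    ∫ x, Φ x ∂(limRescaled H m W F₀ t : Measure (S H))
      = Φ ⟨-kappa H, le_refl _, neg_le_self (kappa_nonneg H)⟩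
          * (limDensity H m W F₀ t (-1) / 2)
        + Φ ⟨kappa H, neg_le_self (kappa_nonneg H), le_refl _⟩
          * (limDensity H m W F₀ t 1 / 2) :=
  integral_twoPoint (h.limDensity_left_nonneg ht) (h.limDensity_right_nonneg ht) Φ

lemma continuousOn_limRescaled (h : CurveSeq H T m C K ε ρ u v d d₀ W F₀) :
    ContinuousOn (limRescaled H m W F₀) (Icc 0 T) := by
  intro t ht
  refine FiniteMeasure.tendsto_iff_forall_integral_tendsto.2 fun Φ => ?_
  have hc : ContinuousOn (fun t => Φ ⟨-kappa H, le_refl _, neg_le_self (kappa_nonneg H)⟩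
          * (limDensity H m W F₀ t (-1) / 2)
        + Φ ⟨kappa H, neg_le_self (kappa_nonneg H), le_refl _⟩
          * (limDensity H m W F₀ t 1 / 2)) (Icc 0 T) :=
    (continuousOn_const.mul ((h.continuousOn_limDensity (-1)).div_const 2)).add
      (continuousOn_const.mul ((h.continuousOn_limDensity 1).div_const 2))
  rw [h.integral_limRescaled ht]
  refine (hc t ht).congr' ?_
  filter_upwards [self_mem_nhdsWithin] with r hr
  exact (h.integral_limRescaled hr _).symm

lemma tendsto_limRescaled (h : CurveSeq H T m C K ε ρ u v d d₀ W F₀) {t : ℝ}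
    (ht : t ∈ Icc 0 T) :
    Tendsto (fun n => (ρ n t).map (rescale h.well (ε n))) atTop (𝓝 (limRescaled H m W F₀ t)) := by
  refine FiniteMeasure.tendsto_iff_forall_integral_tendsto.2 fun Φ => ?_
  rw [h.integral_limRescaled ht]
  refine (h.tendsto_integral_rescaled ht Φ.continuous).congr fun n => ?_
  have hresc : Continuous (rescale h.well (ε n)) :=
    (continuous_shat_Xi h.well (ε n)).subtype_mk _
  rw [FiniteMeasure.toMeasure_map, integral_map hresc.measurable.aemeasurable
    Φ.continuous.measurable.aestronglyMeasurable]

/-! #### The continuity equation of the limit -/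

lemma measurable_limFlux (h : CurveSeq H T m C K ε ρ u v d d₀ W F₀) :
    Measurable (limFlux H W) := by
  have h1 : StronglyMeasurable fun t => ∫ s in Ioo (-kappa H) (kappa H), W (t, s) :=
    h.W_meas.stronglyMeasurable.integral_prod_right'
  exact h1.measurable.const_mul _

/-- A spatially constant flux on `S` integrates `∂_s φ` to the difference of the values of `φ` at
`κ` and `-κ`. The time term, integrated by parts, gives the same difference with the opposite sign,
because half the time derivative of the density at `±1` is `±` the flux. The test function need not
vanish at `±κ`. -/
lemma continuityEq_limit (h : CurveSeq H T m C K ε ρ u v d d₀ W F₀) :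
    ContinuityEq 0 T (limRescaled H m W F₀) (fun _ => leb (S H)) fun t _ => limFlux H W t := by
  have hk := kappa_pos h.well
  have hωi : IntegrableOn (limFlux H W) (Ioo 0 T) := h.integrable_limFlux.const_mul _
  refine ⟨h.continuousOn_limRescaled, h.measurable_limFlux.comp measurable_fst, ?_, ?_⟩
  · have hleb : leb (S H) univ < ⊤ := by
      rw [leb, Measure.comap_apply _ Subtype.val_injective (fun s hs =>
        (MeasurableEmbedding.subtype_coe measurableSet_Icc).measurableSet_image.2 hs) _ .univ, image_univ,
        Subtype.range_coe]
      exact measure_Icc_lt_top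
    simp only [lintegral_const]
    rw [lintegral_mul_const' _ _ hleb.ne]
    exact ENNReal.mul_lt_top hωi.2 hleb
  · intro φ hφ hc hs
    have hslice : ∀ x : ℝ, ContDiff ℝ ∞ fun t => φ (t, x) := fun x =>
      hφ.comp (contDiff_id.prodMk contDiff_const)
    have hsupp : ∀ x : ℝ, tsupport (fun t => φ (t, x)) ⊆ Ioo 0 T := by
      intro x t ht
      have h1 : t ∈ (fun t : ℝ => (t, x)) ⁻¹' tsupport φ := by
        refine closure_minimal (fun r hr => ?_) ((isClosed_tsupport φ).preimage
          (by fun_prop : Continuous fun t : ℝ => (t, x))) ht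
        exact subset_tsupport φ hr
      exact (hs h1).1
    have hspace : ∀ t, ∫ x : S H, deriv (fun y => φ (t, y)) x * limFlux H W t ∂leb (S H)
        = (φ (t, kappa H) - φ (t, -kappa H)) * limFlux H W t := by
      intro t
      have hφt : ContDiff ℝ ∞ fun y => φ (t, y) := hφ.comp (contDiff_const.prodMk contDiff_id)
      rw [integral_leb measurableSet_Icc (fun x => deriv (fun y => φ (t, y)) x * limFlux H W t),
        integral_mul_const, integral_Icc_eq_integral_Ioc,
        ← intervalIntegral.integral_of_le (by linarith), intervalIntegral.integral_deriv_eq_sub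
          (fun x _ => hφt.differentiable (by norm_cast) x)
          ((hφt.continuous_deriv (by norm_cast)).intervalIntegrable _ _)]
    have hcφ : ∀ x, Continuous fun t => φ (t, x) := fun x => (hslice x).continuous
    have hcd : ∀ x, Continuous (deriv fun t => φ (t, x)) := fun x =>
      (hslice x).continuous_deriv (by norm_cast)
    have hi : ∀ x y, Integrable (fun t => limDensity H m W F₀ t x * deriv (fun t => φ (t, y)) t)
        (volume.restrict (Ioo 0 T)) := fun x y =>
      (((h.continuousOn_limDensity x).mul (hcd y).continuousOn).integrableOn_Icc).mono_set
        Ioo_subset_Icc_self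
    have hj : ∀ x, Integrable (fun t => φ (t, x) * ∫ s in Ioo (-kappa H) (kappa H), W (t, s))
        (volume.restrict (Ioo 0 T)) := by
      intro x
      obtain ⟨L, hL⟩ := hc.exists_bound_of_continuous hφ.continuous
      exact h.integrable_limFlux.bdd_mul (hcφ x).aestronglyMeasurable (c := L)
        (Eventually.of_forall fun t => hL _)
    have e : ∀ t ∈ Ioo 0 T, (∫ x : S H, deriv (fun r => φ (r, x)) t
          ∂(limRescaled H m W F₀ t : Measure (S H)))
        + ∫ x : S H, deriv (fun y => φ (t, y)) x * limFlux H W t ∂leb (S H)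
        = (1 / 2 * (limDensity H m W F₀ t (-1) * deriv (fun r => φ (r, -kappa H)) t)
          + 1 / 2 * (limDensity H m W F₀ t 1 * deriv (fun r => φ (r, kappa H)) t))
          + (1 / (2 * kappa H) * (φ (t, kappa H) * ∫ s in Ioo (-kappa H) (kappa H), W (t, s))
          - 1 / (2 * kappa H) *
            (φ (t, -kappa H) * ∫ s in Ioo (-kappa H) (kappa H), W (t, s))) := by
      intro t ht
      rw [hspace, h.integral_limRescaled (Ioo_subset_Icc_self ht)
        (fun x : S H => deriv (fun r => φ (r, x)) t)]
      simp only [limFlux]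
      ring
    have hA : Integrable (fun t =>
        1 / 2 * (limDensity H m W F₀ t (-1) * deriv (fun r => φ (r, -kappa H)) t)
          + 1 / 2 * (limDensity H m W F₀ t 1 * deriv (fun r => φ (r, kappa H)) t))
        (volume.restrict (Ioo 0 T)) := ((hi _ _).const_mul _).add ((hi _ _).const_mul _)
    have hB : Integrable (fun t =>
        1 / (2 * kappa H) * (φ (t, kappa H) * ∫ s in Ioo (-kappa H) (kappa H), W (t, s))
          - 1 / (2 * kappa H) * (φ (t, -kappa H) * ∫ s in Ioo (-kappa H) (kappa H), W (t, s)))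
        (volume.restrict (Ioo 0 T)) := ((hj _).const_mul _).sub ((hj _).const_mul _)
    rw [setIntegral_congr_fun measurableSet_Ioo e, integral_add hA hB,
      integral_add ((hi _ _).const_mul _) ((hi _ _).const_mul _),
      integral_sub ((hj _).const_mul _) ((hj _).const_mul _),
      integral_const_mul, integral_const_mul, integral_const_mul, integral_const_mul,
      h.integral_limDensity_mul_deriv _ (hslice _) (hsupp _),
      h.integral_limDensity_mul_deriv _ (hslice _) (hsupp _)]
    field_simp
    ring

end CurveSeq

/-! ### From bounded test functions to weak-* convergence in `L^∞` -/

lemma tendsto_integral_mul_of_L1 {α : Type*} [MeasurableSpace α] {μ : Measure α}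
    {f : ℕ → α → ℝ} {f₀ φ : α → ℝ} {L : ℝ} (hf : ∀ n, Integrable (f n) μ) (hf₀ : Integrable f₀ μ)
    (hφ : AEStronglyMeasurable φ μ) (hL : ∀ᵐ x ∂μ, |φ x| ≤ L)
    (h : Tendsto (fun n => ∫ x, |f n x - f₀ x| ∂μ) atTop (𝓝 0)) :
    Tendsto (fun n => ∫ x, f n x * φ x ∂μ) atTop (𝓝 (∫ x, f₀ x * φ x ∂μ)) := by
  have hi : ∀ f : α → ℝ, Integrable f μ → Integrable (fun x => f x * φ x) μ := fun f hf =>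
    hf.mul_bdd hφ (c := L) hL
  rw [tendsto_iff_norm_sub_tendsto_zero]
  have h' := h.mul_const L
  rw [zero_mul] at h'
  refine squeeze_zero (fun n => norm_nonneg _) (fun n => ?_) h'
  rw [← integral_sub (hi _ (hf n)) (hi _ hf₀), ← integral_mul_const]
  refine norm_integral_le_of_norm_le (((hf n).sub hf₀).abs.mul_const L) ?_
  filter_upwards [hL] with x hx
  rw [← sub_mul, norm_mul]
  exact mul_le_mul_of_nonneg_left hx (abs_nonneg _)

/-- Bounded weak convergence against bounded functions upgrades to weak-* convergence. -/
lemma weakStarLinfty_of_bounded_test {μ : Measure (ℝ × ℝ)} [IsFiniteMeasure μ]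
    {f : ℕ → ℝ × ℝ → ℝ} {f₀ : ℝ × ℝ → ℝ} {C : ℝ} (hf : ∀ n, AEStronglyMeasurable (f n) μ)
    (hf₀ : Integrable f₀ μ) (hb : ∀ n, ∀ᵐ z ∂μ, 0 ≤ f n z ∧ f n z ≤ C)
    (h : ∀ φ : ℝ × ℝ → ℝ, Measurable φ → ∀ L : ℝ, (∀ z, |φ z| ≤ L) →
      Tendsto (fun n => ∫ z, f n z * φ z ∂μ) atTop (𝓝 (∫ z, f₀ z * φ z ∂μ))) :
    WeakStarLinfty μ f f₀ := by
  have hnb : ∀ n, ∀ᵐ z ∂μ, ‖f n z‖ ≤ C := by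
    intro n
    filter_upwards [hb n] with z hz
    rw [Real.norm_eq_abs, abs_of_nonneg hz.1]
    exact hz.2
  have hfi : ∀ n, Integrable (f n) μ := fun n => Integrable.of_bound (hf n) C (hnb n)
  have hset : ∀ A, MeasurableSet A →
      Tendsto (fun n => ∫ z in A, f n z ∂μ) atTop (𝓝 (∫ z in A, f₀ z ∂μ)) := by
    intro A hA
    have := h (A.indicator 1) (measurable_one.indicator hA) 1 (fun z => by
      by_cases hz : z ∈ A <;> simp [hz])
    have e : ∀ g : ℝ × ℝ → ℝ, ∫ z, g z * A.indicator 1 z ∂μ = ∫ z in A, g z ∂μ := by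
      intro g
      rw [← integral_indicator hA]
      congr 1; funext z
      by_cases hz : z ∈ A <;> simp [hz]
    simpa only [e] using this
  -- The bounds pass to the limit through integrals over arbitrary measurable sets.
  have hb₀ : ∀ᵐ z ∂μ, 0 ≤ f₀ z ∧ f₀ z ≤ C := by
    have h1 : (fun _ => (0 : ℝ)) ≤ᵐ[μ] f₀ := by
      refine ae_le_of_forall_setIntegral_le (integrable_const _) hf₀ fun A hA _ => ?_
      rw [integral_zero]
      refine ge_of_tendsto' (hset A hA) fun n => ?_
      refine integral_nonneg_of_ae (ae_restrict_of_ae ?_)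
      filter_upwards [hb n] with z hz
      exact hz.1
    have h2 : f₀ ≤ᵐ[μ] fun _ => C := by
      refine ae_le_of_forall_setIntegral_le hf₀ (integrable_const _) fun A hA _ => ?_
      refine le_of_tendsto' (hset A hA) fun n => ?_
      refine integral_mono_ae (hfi n).integrableOn (integrable_const _) (ae_restrict_of_ae ?_)
      filter_upwards [hb n] with z hz
      exact hz.2
    filter_upwards [h1, h2] with z hz1 hz2
    exact ⟨hz1, hz2⟩
  have hnb₀ : ∀ᵐ z ∂μ, ‖f₀ z‖ ≤ C := by
    filter_upwards [hb₀] with z hz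
    rw [Real.norm_eq_abs, abs_of_nonneg hz.1]
    exact hz.2
  refine ⟨fun n => MemLp.of_bound (hf n) C (hnb n), MemLp.of_bound hf₀.1 C hnb₀, fun φ hφ => ?_⟩
  rw [memLp_one_iff_integrable] at hφ
  have hest : ∀ (g : ℝ × ℝ → ℝ) (ψ : ℝ × ℝ → ℝ), (∀ᵐ z ∂μ, ‖g z‖ ≤ C) → Integrable ψ μ →
      |∫ z, g z * ψ z ∂μ| ≤ C * ∫ z, ‖ψ z‖ ∂μ := by
    intro g ψ hg hψ
    rw [← integral_const_mul, ← Real.norm_eq_abs]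
    refine norm_integral_le_of_norm_le (hψ.norm.const_mul C) ?_
    filter_upwards [hg] with z hz
    rw [norm_mul]
    exact mul_le_mul_of_nonneg_right hz (norm_nonneg _)
  rw [Metric.tendsto_atTop']
  intro e he
  -- Bounded continuous functions are dense in `L¹`. As `f n` and `f₀` are bounded by `C`, replacing
  -- `φ` by `ψ` costs at most `e/4` on each side; `|C| + 1` avoids division by zero.
  obtain ⟨ψ, hψ, hψi⟩ := hφ.exists_boundedContinuous_integral_sub_le
    (ε := e / (4 * (|C| + 1))) (by positivity)
  have hlim := h ψ ψ.continuous.measurable ‖ψ‖ fun z => ψ.norm_coe_le_norm z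
  obtain ⟨N, hN⟩ := Metric.tendsto_atTop'.1 hlim (e / 4) (by linarith)
  refine ⟨N, fun n hn => ?_⟩
  have h1 := hN n hn
  have hi : ∀ (g : ℝ × ℝ → ℝ) (ψ : ℝ × ℝ → ℝ), AEStronglyMeasurable g μ →
      (∀ᵐ z ∂μ, ‖g z‖ ≤ C) → Integrable ψ μ → Integrable (fun z => g z * ψ z) μ :=
    fun g ψ hg hb hψ => hψ.bdd_mul hg (c := C) hb
  have hsplit : ∀ g : ℝ × ℝ → ℝ, AEStronglyMeasurable g μ → (∀ᵐ z ∂μ, ‖g z‖ ≤ C) →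
      |∫ z, g z * φ z ∂μ - ∫ z, g z * ψ z ∂μ| ≤ e / 4 := by
    intro g hg hb
    rw [← integral_sub (hi g φ hg hb hφ) (hi g ψ hg hb hψi)]
    have e1 : ∫ z, g z * φ z - g z * ψ z ∂μ = ∫ z, g z * (φ z - ψ z) ∂μ := by
      congr 1; funext z; ring
    rw [e1]
    refine (hest g (fun z => φ z - ψ z) hb (hφ.sub hψi)).trans ?_
    calc C * ∫ z, ‖φ z - ψ z‖ ∂μ ≤ (|C| + 1) * ∫ z, ‖φ z - ψ z‖ ∂μ :=
          mul_le_mul_of_nonneg_right (by linarith [le_abs_self C])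
            (integral_nonneg fun z => norm_nonneg _)
      _ ≤ (|C| + 1) * (e / (4 * (|C| + 1))) := mul_le_mul_of_nonneg_left hψ (by positivity)
      _ = e / 4 := by field_simp
  have h2 := hsplit (f n) (hf n) (hnb n)
  have h3 := hsplit f₀ hf₀.1 hnb₀
  rw [Real.dist_eq] at h1 ⊢
  rw [abs_le] at h2 h3
  rw [abs_lt] at h1 ⊢
  constructor <;> linarith [h1.1, h1.2, h2.1, h2.2, h3.1, h3.2]

/-- The limit of the rescaled densities. -/
def limUhat (H : ℝ → ℝ) (m : ℝ) (d₀ W : ℝ × ℝ → ℝ) (F₀ t s : ℝ) : ℝ :=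
  limDensity H m W F₀ t (-1) + prim (-kappa H) (kappa H) d₀ t s

namespace CurveSeq

variable {H : ℝ → ℝ} {T m C K : ℝ} {ε : ℕ → ℝ} {ρ : ℕ → ℝ → FiniteMeasure Xi}
  {u v d : ℕ → ℝ → ℝ → ℝ} {d₀ W : ℝ × ℝ → ℝ} {F₀ : ℝ}

/-! #### Strong convergence of the traces -/

lemma integrable_energy (h : CurveSeq H T m C K ε ρ u v d d₀ W F₀) (n : ℕ) :
    Integrable (fun t => 1 + ∫ s in Ioo (-kappa H) (kappa H), d n t s ^ 2)
      (volume.restrict (Ioo 0 T)) :=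
  (integrable_const _).add (integrable_integral_slice (h.d_weak.1 n).integrable_sq)

lemma integral_energy_le (h : CurveSeq H T m C K ε ρ u v d d₀ W F₀) (n : ℕ) :
    ∫ t in Ioo 0 T, (1 + ∫ s in Ioo (-kappa H) (kappa H), d n t s ^ 2) ≤ T + K := by
  have hsq : Integrable (fun z => Function.uncurry (d n) z ^ 2) (cyl T (-kappa H) (kappa H)) :=
    (h.d_weak.1 n).integrable_sq
  have hslice : Integrable (fun t => ∫ s in Ioo (-kappa H) (kappa H), d n t s ^ 2)
    (volume.restrict (Ioo 0 T)) := integrable_integral_slice hsq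
  rw [integral_add (integrable_const _) hslice]
  refine add_le_add ?_ ?_
  · simp [h.T_pos.le]
  · refine le_trans (le_of_eq ?_) (h.d_sq n)
    rw [cyl_eq_prod] at hsq ⊢
    exact (integral_prod _ hsq).symm

lemma tendsto_osc (h : CurveSeq H T m C K ε ρ u v d d₀ W F₀) {δ : ℝ} (hδ : 0 < δ) (hδ1 : δ ≤ 1) :
    Tendsto (fun n => Real.sqrt (kappa H - shat H (ε n) δ) / 2) atTop (𝓝 0) := by
  have h1 := (tendsto_shat h.well h.eps_pos h.eps_lim hδ hδ1).const_sub (kappa H)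
  rw [sub_self] at h1
  have h2 := ((Real.continuous_sqrt.tendsto 0).comp h1).div_const 2
  rw [Real.sqrt_zero, zero_div] at h2
  exact h2

lemma tendsto_integral_gam (h : CurveSeq H T m C K ε ρ u v d d₀ W F₀) {Φ : Xi → ℝ}
    (hΦ : Continuous Φ) :
    Tendsto (fun n => ∫ x, Φ x ∂gam H (ε n)) atTop
      (𝓝 ((Φ ⟨-1, by norm_num⟩ + Φ ⟨1, by norm_num⟩) / 2)) := by
  have hp := fun n => isProbabilityMeasure_gam h.well (ε n)
  obtain ⟨⟨M, hM⟩, hα, hβ⟩ := exists_near_of_continuous hΦ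
  have := tendsto_integral_of_dominated h.well h.eps_pos h.eps_lim
    (μ := fun n => gam H (ε n)) (m := 1) (C := 1) (F := 0) (fun n => by simp)
    (fun n ψ _ _ => by simp) (by simp [integral_shat_gam h.well])
    (Φ := fun _ => Φ) (α := Φ ⟨-1, by norm_num⟩) (β := Φ ⟨1, by norm_num⟩)
    (fun _ => hΦ) (fun _ => hM) (fun e he => ?_) (fun e he => ?_)
  · convert this using 2
    simp only [zero_div, sub_zero, add_zero]; ring
  · obtain ⟨η, hη, h1⟩ := hα e he
    exact ⟨η, hη, Eventually.of_forall fun _ => h1⟩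
  · obtain ⟨η, hη, h1⟩ := hβ e he
    exact ⟨η, hη, Eventually.of_forall fun _ => h1⟩

/-- A cutoff that sees only one well turns the pointwise-in-time convergence of measures into
convergence of the trace there. By `hsum` its integral against `γ_n` tends to `1/2`; by `hval` its
limit integral against `ρ_n(t)` is half the limit density at `x₀`; by `hest` the density is close to
the trace on its support. -/
lemma tendsto_trace (h : CurveSeq H T m C K ε ρ u v d d₀ W F₀) {χ : ℝ → ℝ} (hχ : Continuous χ)
    (h0 : ∀ ξ ∈ Icc (-1 : ℝ) 1, 0 ≤ χ ξ) (h1 : ∀ ξ ∈ Icc (-1 : ℝ) 1, χ ξ ≤ 1)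
    (hsum : χ (-1) + χ 1 = 1) {x₀ : ℝ} (hx₀ : x₀ ∈ Icc (-1 : ℝ) 1)
    (hval : ∀ t, χ (-1) * (limDensity H m W F₀ t (-1) / 2)
      + χ 1 * (limDensity H m W F₀ t 1 / 2) = limDensity H m W F₀ t x₀ / 2)
    {tr : ℕ → ℝ → ℝ} (htr : ∀ n, Integrable (tr n) (volume.restrict (Ioo 0 T)))
    (hest : ∀ n, ∀ᵐ t ∂volume.restrict (Ioo 0 T), ∀ᵐ ξ ∂volume.restrict (Ioo (-1) 1), χ ξ ≠ 0 →
      |u n t ξ - tr n t| ≤ Real.sqrt (kappa H - shat H (ε n) (1 / 2)) / 2 *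
        (1 + ∫ s in Ioo (-kappa H) (kappa H), d n t s ^ 2)) :
    Tendsto (fun n => ∫ t in Ioo 0 T, |tr n t - limDensity H m W F₀ t x₀|) atTop (𝓝 0) := by
  have hχX : Continuous fun x : Xi => χ x := hχ.comp continuous_subtype_val
  have hm0 : 0 ≤ m := by
    rw [← h.mass 0 0 (left_mem_Icc.2 h.T_pos.le)]
    exact measureReal_nonneg
  have hXc : ∀ n, ContinuousOn (fun t => ∫ x : Xi, χ x ∂(ρ n t : Measure Xi)) (Icc 0 T) :=
    fun n => continuousOn_integral (h.velocity n).1 hχX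
  have key := tendsto_integral_abs_sub (μ := volume.restrict (Ioo 0 T)) (f := tr)
    (X := fun n t => ∫ x : Xi, χ x ∂(ρ n t : Measure Xi))
    (b := fun n t => 1 + ∫ s in Ioo (-kappa H) (kappa H), d n t s ^ 2)
    (X₀ := fun t => limDensity H m W F₀ t x₀ / 2) (q := fun n => ∫ x : Xi, χ x ∂gam H (ε n))
    (r := fun n => Real.sqrt (kappa H - shat H (ε n) (1 / 2)) / 2) (M := m) (K := T + K)
    htr (fun n => ((hXc n).mono Ioo_subset_Icc_self).aestronglyMeasurable measurableSet_Ioo)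
    ((((h.continuousOn_limDensity x₀).div_const 2).mono
      Ioo_subset_Icc_self).aestronglyMeasurable measurableSet_Ioo)
    (fun n => ?_) ?_ ?_ h.integrable_energy h.integral_energy_le (fun n => by positivity)
    (h.tendsto_osc (by norm_num) (by norm_num)) ?_ (fun n => ?_)
  · refine key.congr fun n => ?_
    congr 1; funext t; congr 1; ring
  · filter_upwards [ae_restrict_mem measurableSet_Ioo] with t ht
    rw [← h.mass n t (Ioo_subset_Icc_self ht), ← Real.norm_eq_abs]
    refine (norm_integral_le_of_norm_le_const (C := 1) (Eventually.of_forall fun x => ?_)).trans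
      (by rw [one_mul])
    rw [Real.norm_eq_abs, abs_of_nonneg (h0 x x.2)]
    exact h1 x x.2
  · filter_upwards [ae_restrict_mem measurableSet_Ioo] with t ht
    have := h.limDensity_bounds (Ioo_subset_Icc_self ht) hx₀
    rw [abs_of_nonneg (by linarith [this.1])]
    linarith [this.2]
  · filter_upwards [ae_restrict_mem measurableSet_Ioo] with t ht
    have := h.tendsto_integral_fixed (Ioo_subset_Icc_self ht) hχX
    rwa [hval] at this
  · have := h.tendsto_integral_gam hχX
    simp only [hsum] at this
    exact this
  · filter_upwards [hest n, ae_restrict_mem measurableSet_Ioo] with t h2 ht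
    exact abs_integral_sub_mul_le h.well (h.u_meas n).of_uncurry_left
      (h.density n t (Ioo_subset_Icc_self ht)) hχ h0 h1
      (mul_nonneg (by positivity) (add_nonneg zero_le_one (integral_nonneg fun s => sq_nonneg _)))
      h2

lemma tendsto_traceRight (h : CurveSeq H T m C K ε ρ u v d d₀ W F₀) :
    Tendsto (fun n => ∫ t in Ioo 0 T, |traceRight H (ε n) (u n) (d n) t
      - limDensity H m W F₀ t 1|) atTop (𝓝 0) := by
  -- This piecewise linear cutoff vanishes on `[-1,1/2]` and equals `1` at the right well.
  -- Continuity suffices, since it is never differentiated.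
  refine h.tendsto_trace (χ := fun x => max 0 (2 * x - 1)) (by fun_prop)
    (fun ξ _ => le_max_left _ _) (fun ξ hξ => max_le zero_le_one (by linarith [hξ.2]))
    (by norm_num) (by norm_num) (fun t => by norm_num)
    (fun n => integrable_traceRight h.well (h.u_meas n) (h.bounds n) (h.d_meas n) (h.d_weak.1 n))
    fun n => ?_
  filter_upwards [ae_abs_sub_trace_le h.well (δ := 1 / 2) (by norm_num)
    (h.d_weak.1 n) (h.d_rep n)] with t h1
  filter_upwards [h1] with ξ h2 h3
  refine h2.2 (not_lt.1 fun hlt => h3 ?_)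
  exact max_eq_left (by linarith)

lemma tendsto_traceLeft (h : CurveSeq H T m C K ε ρ u v d d₀ W F₀) :
    Tendsto (fun n => ∫ t in Ioo 0 T, |traceLeft H (ε n) (u n) (d n) t
      - limDensity H m W F₀ t (-1)|) atTop (𝓝 0) := by
  refine h.tendsto_trace (χ := fun x => max 0 (-2 * x - 1)) (by fun_prop)
    (fun ξ _ => le_max_left _ _) (fun ξ hξ => max_le zero_le_one (by linarith [hξ.1]))
    (by norm_num) (by norm_num) (fun t => by norm_num)
    (fun n => integrable_traceLeft h.well (h.u_meas n) (h.bounds n) (h.d_meas n) (h.d_weak.1 n))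
    fun n => ?_
  filter_upwards [ae_abs_sub_trace_le h.well (δ := 1 / 2) (by norm_num)
    (h.d_weak.1 n) (h.d_rep n)] with t h1
  filter_upwards [h1] with ξ h2 h3
  refine h2.1 (not_lt.1 fun hlt => h3 ?_)
  exact max_eq_left (by linarith)

lemma integrable_limDensity (h : CurveSeq H T m C K ε ρ u v d d₀ W F₀) (x : ℝ) :
    Integrable (fun t => limDensity H m W F₀ t x) (volume.restrict (Ioo 0 T)) :=
  ((h.continuousOn_limDensity x).integrableOn_Icc).mono_set Ioo_subset_Icc_self

/-- Triangle inequality through the trace: the oscillation on `I` is controlled in `L¹(0,T)` by a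
factor tending to zero times the uniformly bounded energy, and the trace converges in `L¹(0,T)`. -/
lemma tendsto_eLpNorm_top (h : CurveSeq H T m C K ε ρ u v d d₀ W F₀) {I : Set ℝ}
    (hI : MeasurableSet I) (hI1 : I ⊆ Ioo (-1) 1) {δ : ℝ} (hδ : 0 < δ) (hδ1 : δ < 1) {x₀ : ℝ}
    {tr : ℕ → ℝ → ℝ} (htr : ∀ n, Integrable (tr n) (volume.restrict (Ioo 0 T)))
    (hlim : Tendsto (fun n => ∫ t in Ioo 0 T, |tr n t - limDensity H m W F₀ t x₀|) atTop (𝓝 0))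
    (hest : ∀ n, ∀ᵐ t ∂volume.restrict (Ioo 0 T), ∀ᵐ ξ ∂volume.restrict (Ioo (-1) 1), ξ ∈ I →
      |u n t ξ - tr n t| ≤ Real.sqrt (kappa H - shat H (ε n) δ) / 2 *
        (1 + ∫ s in Ioo (-kappa H) (kappa H), d n t s ^ 2)) :
    Tendsto (fun n => ∫⁻ t in Ioo 0 T, eLpNorm (fun ξ => u n t ξ - limDensity H m W F₀ t x₀) ∞
      (volume.restrict I)) atTop (𝓝 0) := by
  have hup : Tendsto (fun n => ENNReal.ofReal (Real.sqrt (kappa H - shat H (ε n) δ) / 2 * (T + K)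
      + ∫ t in Ioo 0 T, |tr n t - limDensity H m W F₀ t x₀|)) atTop (𝓝 0) := by
    have := ENNReal.tendsto_ofReal (((h.tendsto_osc hδ hδ1.le).mul_const (T + K)).add hlim)
    simpa using this
  refine tendsto_of_tendsto_of_tendsto_of_le_of_le tendsto_const_nhds hup (fun _ => zero_le)
    fun n => ?_
  have hi1 := (h.integrable_energy n).const_mul (Real.sqrt (kappa H - shat H (ε n) δ) / 2)
  have hi2 : Integrable (fun t => |tr n t - limDensity H m W F₀ t x₀|)
    (volume.restrict (Ioo 0 T)) := ((htr n).sub (h.integrable_limDensity x₀)).abs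
  have hi3 : Integrable (fun t => Real.sqrt (kappa H - shat H (ε n) δ) / 2 *
      (1 + ∫ s in Ioo (-kappa H) (kappa H), d n t s ^ 2)
      + |tr n t - limDensity H m W F₀ t x₀|) (volume.restrict (Ioo 0 T)) := hi1.add hi2
  have hpos : ∀ t, 0 ≤ Real.sqrt (kappa H - shat H (ε n) δ) / 2 *
      (1 + ∫ s in Ioo (-kappa H) (kappa H), d n t s ^ 2) := fun t =>
    mul_nonneg (by positivity) (add_nonneg zero_le_one (integral_nonneg fun s => sq_nonneg _))
  calc ∫⁻ t in Ioo 0 T, eLpNorm (fun ξ => u n t ξ - limDensity H m W F₀ t x₀) ∞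
        (volume.restrict I)
      ≤ ∫⁻ t in Ioo 0 T, ENNReal.ofReal (Real.sqrt (kappa H - shat H (ε n) δ) / 2 *
        (1 + ∫ s in Ioo (-kappa H) (kappa H), d n t s ^ 2)
        + |tr n t - limDensity H m W F₀ t x₀|) := by
        refine lintegral_mono_ae ?_
        filter_upwards [hest n] with t ht
        rw [eLpNorm_exponent_top]
        refine eLpNormEssSup_le_of_ae_bound ?_
        filter_upwards [ae_mono (Measure.restrict_mono hI1 le_rfl) ht, ae_restrict_mem hI]
          with ξ h1 h2
        have h3 := abs_sub_le (u n t ξ) (tr n t) (limDensity H m W F₀ t x₀)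
        have h4 := h1 h2
        rw [Real.norm_eq_abs]
        linarith
    _ = ENNReal.ofReal (∫ t in Ioo 0 T, (Real.sqrt (kappa H - shat H (ε n) δ) / 2 *
        (1 + ∫ s in Ioo (-kappa H) (kappa H), d n t s ^ 2)
        + |tr n t - limDensity H m W F₀ t x₀|)) := by
        rw [ofReal_integral_eq_lintegral_ofReal hi3]
        exact Eventually.of_forall fun t => add_nonneg (hpos t) (abs_nonneg _)
    _ ≤ _ := by
        refine ENNReal.ofReal_le_ofReal ?_
        rw [integral_add hi1 hi2, integral_const_mul]
        exact add_le_add (mul_le_mul_of_nonneg_left (h.integral_energy_le n) (by positivity)) le_rfl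

lemma tendsto_eLpNorm_left (h : CurveSeq H T m C K ε ρ u v d d₀ W F₀) {δ : ℝ}
    (hδ : δ ∈ Ioo (0 : ℝ) 1) :
    Tendsto (fun n => ∫⁻ t in Ioo 0 T, eLpNorm (fun ξ => u n t ξ - limDensity H m W F₀ t (-1)) ∞
      (volume.restrict (Ioo (-1) (-δ)))) atTop (𝓝 0) := by
  refine h.tendsto_eLpNorm_top measurableSet_Ioo (Ioo_subset_Ioo_right (by linarith [hδ.1]))
    hδ.1 hδ.2 (fun n => integrable_traceLeft h.well (h.u_meas n) (h.bounds n) (h.d_meas n)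
      (h.d_weak.1 n)) h.tendsto_traceLeft fun n => ?_
  filter_upwards [ae_abs_sub_trace_le h.well hδ.2 (h.d_weak.1 n) (h.d_rep n)] with t h1
  filter_upwards [h1] with ξ h2 h3
  exact h2.1 h3.2.le

lemma tendsto_eLpNorm_right (h : CurveSeq H T m C K ε ρ u v d d₀ W F₀) {δ : ℝ}
    (hδ : δ ∈ Ioo (0 : ℝ) 1) :
    Tendsto (fun n => ∫⁻ t in Ioo 0 T, eLpNorm (fun ξ => u n t ξ - limDensity H m W F₀ t 1) ∞
      (volume.restrict (Ioo δ 1))) atTop (𝓝 0) := by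
  refine h.tendsto_eLpNorm_top measurableSet_Ioo (Ioo_subset_Ioo_left (by linarith [hδ.1]))
    hδ.1 hδ.2 (fun n => integrable_traceRight h.well (h.u_meas n) (h.bounds n) (h.d_meas n)
      (h.d_weak.1 n)) h.tendsto_traceRight fun n => ?_
  filter_upwards [ae_abs_sub_trace_le h.well hδ.2 (h.d_weak.1 n) (h.d_rep n)] with t h1
  filter_upwards [h1] with ξ h2 h3
  exact h2.2 h3.1.le

/-! #### The limit of the rescaled densities -/

lemma ae_uhat_eq_prim (h : CurveSeq H T m C K ε ρ u v d d₀ W F₀) (n : ℕ) :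
    ∀ᵐ z ∂cyl T (-kappa H) (kappa H), Function.uncurry (uhat H (ε n) (u n)) z
      = traceLeft H (ε n) (u n) (d n) z.1
        + prim (-kappa H) (kappa H) (Function.uncurry (d n)) z.1 z.2 := by
  have hp := stronglyMeasurable_prim (a := -kappa H) (b := kappa H) (h.d_meas n)
  have htl : Measurable (traceLeft H (ε n) (u n) (d n)) := by
    have h1 : StronglyMeasurable fun z : ℝ × ℝ => 1 / 2 * (u n z.1 z.2
        - prim (-kappa H) (kappa H) (Function.uncurry (d n)) z.1 (shat H (ε n) z.2)) :=
      (((h.u_meas n).sub (hp.measurable.comp (measurable_fst.prodMk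
        ((shat_contDiff h.well (ε n)).continuous.measurable.comp
          measurable_snd)))).const_mul _).stronglyMeasurable
    exact (h1.integral_prod_right' (ν := volume.restrict (Ioo (-1) 1))).measurable
  have hms : MeasurableSet {z : ℝ × ℝ | Function.uncurry (uhat H (ε n) (u n)) z
      = traceLeft H (ε n) (u n) (d n) z.1
        + prim (-kappa H) (kappa H) (Function.uncurry (d n)) z.1 z.2} :=
    measurableSet_eq_fun (measurable_uhat h.well (h.u_meas n))
      ((htl.comp measurable_fst).add hp.measurable)
  rw [cyl_eq_prod, Measure.ae_prod_iff_ae_ae hms]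
  filter_upwards [ae_uhat_eq h.well (h.d_rep n)] with t h1
  filter_upwards [h1, ae_restrict_mem measurableSet_Ioo] with s h2 h3
  rw [prim_eq _ _ (Ioo_subset_Icc_self h3)]
  exact h2

/-- The rescaled density is its left trace plus the primitive of its slope. The first part converges
strongly in `L¹`; in the second, `exists_integral_prim_mul` moves the primitive onto the test
function, leaving a bounded test function for the weakly convergent slopes. -/
lemma tendsto_uhat (h : CurveSeq H T m C K ε ρ u v d d₀ W F₀) {φ : ℝ × ℝ → ℝ}
    (hφ : Measurable φ) {L : ℝ} (hL : ∀ z, |φ z| ≤ L) :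
    Tendsto (fun n => ∫ z, Function.uncurry (uhat H (ε n) (u n)) z * φ z
        ∂cyl T (-kappa H) (kappa H)) atTop
      (𝓝 (∫ z, Function.uncurry (limUhat H m d₀ W F₀) z * φ z
        ∂cyl T (-kappa H) (kappa H))) := by
  obtain ⟨φ', hφ', ⟨L', hL'⟩, hfub⟩ :=
    exists_integral_prim_mul T (-kappa H) (kappa H) hφ hL
  have hdi : ∀ n, Integrable (Function.uncurry (d n)) (cyl T (-kappa H) (kappa H)) := fun n =>
    (h.d_weak.1 n).integrable (by norm_num)
  have hd₀i : Integrable d₀ (cyl T (-kappa H) (kappa H)) := h.d_weak.2.1.integrable (by norm_num)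
  have hfst : ∀ f : ℝ → ℝ, Integrable f (volume.restrict (Ioo 0 T)) →
      Integrable (fun z : ℝ × ℝ => f z.1) (cyl T (-kappa H) (kappa H)) := by
    intro f hf
    rw [cyl_eq_prod]
    exact hf.comp_fst _
  have htl := fun n => hfst _ (integrable_traceLeft (ε := ε n) h.well (h.u_meas n) (h.bounds n)
    (h.d_meas n) (h.d_weak.1 n))
  have hD := hfst _ (h.integrable_limDensity (-1))
  have hmul : ∀ f : ℝ × ℝ → ℝ, Integrable f (cyl T (-kappa H) (kappa H)) →
      Integrable (fun z => f z * φ z) (cyl T (-kappa H) (kappa H)) := fun f hf =>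
    hf.mul_bdd hφ.aestronglyMeasurable (c := L) (Eventually.of_forall hL)
  have hprim : ∀ f : ℝ × ℝ → ℝ, Measurable f → Integrable f (cyl T (-kappa H) (kappa H)) →
      Integrable (fun z : ℝ × ℝ => prim (-kappa H) (kappa H) f z.1 z.2)
        (cyl T (-kappa H) (kappa H)) := fun f hm hf =>
    integrable_prim hm hf measurable_id
  have l1 : Tendsto (fun n => ∫ z, traceLeft H (ε n) (u n) (d n) z.1 * φ z
      ∂cyl T (-kappa H) (kappa H)) atTop
      (𝓝 (∫ z, limDensity H m W F₀ z.1 (-1) * φ z ∂cyl T (-kappa H) (kappa H))) := by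
    refine tendsto_integral_mul_of_L1 htl hD hφ.aestronglyMeasurable (Eventually.of_forall hL) ?_
    have h1 := h.tendsto_traceLeft.const_mul
      ((volume.restrict (Ioo (-kappa H) (kappa H))).real univ)
    rw [mul_zero] at h1
    refine h1.congr fun n => ?_
    rw [cyl_eq_prod]
    exact (integral_fun_fst (fun t => |traceLeft H (ε n) (u n) (d n) t
      - limDensity H m W F₀ t (-1)|)).symm
  have l2 := h.d_weak.2.2 φ' (memLp_of_bounded hφ' hL' 2)
  rw [← hfub d₀ h.d₀_meas hd₀i] at l2
  have l3 := l1.add l2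
  have e0 : ∫ z, Function.uncurry (limUhat H m d₀ W F₀) z * φ z ∂cyl T (-kappa H) (kappa H)
      = ∫ z, limDensity H m W F₀ z.1 (-1) * φ z ∂cyl T (-kappa H) (kappa H)
        + ∫ z, prim (-kappa H) (kappa H) d₀ z.1 z.2 * φ z ∂cyl T (-kappa H) (kappa H) := by
    rw [← integral_add (hmul _ hD) (hmul _ (hprim _ h.d₀_meas hd₀i))]
    refine integral_congr_ae (Eventually.of_forall fun z => ?_)
    simp only [Function.uncurry, limUhat]
    ring
  rw [e0]
  refine l3.congr fun n => ?_
  rw [← hfub _ (h.d_meas n) (hdi n), ← integral_add (hmul _ (htl n))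
    (hmul _ (hprim _ (h.d_meas n) (hdi n)))]
  refine integral_congr_ae ?_
  filter_upwards [h.ae_uhat_eq_prim n] with z hz
  rw [hz]; ring

lemma weakStar_uhat (h : CurveSeq H T m C K ε ρ u v d d₀ W F₀) :
    WeakStarLinfty (cyl T (-kappa H) (kappa H))
      (fun n => Function.uncurry (uhat H (ε n) (u n)))
      (Function.uncurry (limUhat H m d₀ W F₀)) := by
  refine weakStarLinfty_of_bounded_test (C := C)
    (fun n => (measurable_uhat h.well (h.u_meas n)).aestronglyMeasurable) ?_
    (fun n => ae_uhat_bounds h.well (h.bounds n)) fun φ hφ L hL => h.tendsto_uhat hφ hL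
  have h1 := (h.integrable_limDensity (-1)).comp_fst
    (volume.restrict (Ioo (-kappa H) (kappa H)))
  rw [← cyl_eq_prod] at h1
  exact h1.add (integrable_prim h.d₀_meas (h.d_weak.2.1.integrable (by norm_num)) measurable_id)

lemma ae_limUhat_eq (h : CurveSeq H T m C K ε ρ u v d d₀ W F₀) :
    ∀ᵐ t ∂volume.restrict (Ioo 0 T), IntegrableOn (fun s => d₀ (t, s))
        (Ioo (-kappa H) (kappa H)) ∧
      limUhat H m d₀ W F₀ t =ᵐ[volume.restrict (Ioo (-kappa H) (kappa H))]
        fun s => limDensity H m W F₀ t (-1) + ∫ r in (-kappa H)..s, d₀ (t, r) := by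
  filter_upwards [memLp_two_slice (f := fun t s => d₀ (t, s)) h.d_weak.2.1] with t ht
  refine ⟨integrableOn_of_memLp_two ht, ?_⟩
  filter_upwards [ae_restrict_mem measurableSet_Ioo] with s hs
  rw [limUhat, prim_eq _ _ (Ioo_subset_Icc_self hs)]

lemma isL2W12_limUhat (h : CurveSeq H T m C K ε ρ u v d d₀ W F₀) :
    IsL2W12 T (-kappa H) (kappa H) (limUhat H m d₀ W F₀) fun t s => d₀ (t, s) := by
  have hk := kappa_pos h.well
  refine ⟨h.weakStar_uhat.2.1.mono_exponent le_top, h.d_weak.2.1, ?_⟩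
  filter_upwards [h.ae_limUhat_eq] with t ht
  exact isWeakDeriv_of_primitive (by linarith) ht.1 ht.2

/-- Before the limit, the difference of the traces is by definition the spatial integral of the
slope. Testing with indicators of sets of times, strong convergence of the traces and weak
convergence of the slopes identify the limits of the two sides. -/
lemma ae_jump_eq (h : CurveSeq H T m C K ε ρ u v d d₀ W F₀) :
    ∀ᵐ t ∂volume.restrict (Ioo 0 T), ∫ s in Ioo (-kappa H) (kappa H), d₀ (t, s)
      = limDensity H m W F₀ t 1 - limDensity H m W F₀ t (-1) := by
  have hdi : ∀ n, Integrable (Function.uncurry (d n)) (cyl T (-kappa H) (kappa H)) := fun n =>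
    (h.d_weak.1 n).integrable (by norm_num)
  have hd₀i : Integrable d₀ (cyl T (-kappa H) (kappa H)) := h.d_weak.2.1.integrable (by norm_num)
  have hD := h.integrable_limDensity
  refine Integrable.ae_eq_of_forall_setIntegral_eq _ _ (integrable_integral_slice hd₀i)
    ((hD 1).sub (hD (-1))) fun A hA _ => ?_
  have hφ : Measurable (A.indicator (1 : ℝ → ℝ)) := measurable_one.indicator hA
  have hL : ∀ t, |A.indicator (1 : ℝ → ℝ) t| ≤ 1 := by
    intro t; by_cases ht : t ∈ A <;> simp [ht]
  have e : ∀ f : ℝ → ℝ, ∫ t in Ioo 0 T, A.indicator (1 : ℝ → ℝ) t * f t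
      = ∫ t in A, f t ∂(volume.restrict (Ioo 0 T)) := by
    intro f
    rw [← integral_indicator hA]
    congr 1; funext t
    by_cases ht : t ∈ A <;> simp [ht]
  have l1 := h.d_weak.2.2 (fun z => A.indicator (1 : ℝ → ℝ) z.1)
    (memLp_of_bounded (hφ.comp measurable_fst) (fun z => hL z.1) 2)
  rw [integral_cyl_mul_fst hd₀i hφ hL] at l1
  have htl := fun n => integrable_traceLeft (ε := ε n) h.well (h.u_meas n) (h.bounds n)
    (h.d_meas n) (h.d_weak.1 n)
  have htr := fun n => integrable_traceRight (ε := ε n) h.well (h.u_meas n) (h.bounds n)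
    (h.d_meas n) (h.d_weak.1 n)
  have l2 := tendsto_integral_mul_of_L1 htr (hD 1) hφ.aestronglyMeasurable
    (Eventually.of_forall hL) h.tendsto_traceRight
  have l3 := tendsto_integral_mul_of_L1 htl (hD (-1)) hφ.aestronglyMeasurable
    (Eventually.of_forall hL) h.tendsto_traceLeft
  have hmul : ∀ f : ℝ → ℝ, Integrable f (volume.restrict (Ioo 0 T)) →
      Integrable (fun t => f t * A.indicator (1 : ℝ → ℝ) t) (volume.restrict (Ioo 0 T)) :=
    fun f hf => hf.mul_bdd hφ.aestronglyMeasurable (c := 1) (Eventually.of_forall hL)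
  have l4 := l2.sub l3
  have l5 := tendsto_nhds_unique l4 (l1.congr fun n => ?_)
  · rw [← integral_sub (hmul _ (hD 1)) (hmul _ (hD (-1))), e] at l5
    rw [← l5, ← e]
    congr 1; funext t; ring
  · rw [← integral_sub (hmul _ (htr n)) (hmul _ (htl n)), integral_cyl_mul_fst (hdi n) hφ hL]
    congr 1; funext t
    simp only [traceRight, Function.uncurry]
    ring

/-- The value at `-κ` is built into `limUhat`; the value at `κ` is the one supplied by the jump
identity. -/
lemma hasTraces_limUhat (h : CurveSeq H T m C K ε ρ u v d d₀ W F₀) :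
    ∀ᵐ t ∂volume.restrict (Ioo 0 T), HasTraces (-kappa H) (kappa H) (limUhat H m d₀ W F₀ t)
      (limDensity H m W F₀ t (-1)) (limDensity H m W F₀ t 1) := by
  have hk := kappa_pos h.well
  filter_upwards [h.ae_limUhat_eq, h.ae_jump_eq] with t ht hj
  refine ⟨_, continuousOn_primitive (by linarith) ht.1, ht.2, ?_, ?_⟩
  · simp only [intervalIntegral.integral_same, add_zero]
  · rw [intervalIntegral_eq_Ioo (by linarith), hj]
    ring

end CurveSeq

/-! ### Identification of the limit flux and extraction of the subsequence -/

lemma integral_sq_le_of_eLpNorm_le {α : Type*} [MeasurableSpace α] {μ : Measure α} {f : α → ℝ}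
    (hf : MemLp f 2 μ) {K : ℝ≥0∞} (hK : K ≠ ⊤) (h : eLpNorm f 2 μ ≤ K) :
    ∫ x, f x ^ 2 ∂μ ≤ K.toReal ^ 2 := by
  rw [hf.eLpNorm_eq_integral_rpow_norm (by norm_num) (by norm_num)] at h
  have h0 : 0 ≤ ∫ x, f x ^ 2 ∂μ := integral_nonneg fun x => sq_nonneg _
  have h1 := (ENNReal.ofReal_le_iff_le_toReal hK).1 h
  simp only [ENNReal.toReal_ofNat, Real.rpow_two, Real.norm_eq_abs, sq_abs] at h1
  rw [← one_div, ← Real.sqrt_eq_rpow] at h1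
  exact (Real.sqrt_le_left ENNReal.toReal_nonneg).1 h1

/-- A weak limit matters only almost everywhere, so `W` may be replaced by its slice average, a
representative that depends on time alone. -/
lemma CurveSeq.weakL2_limFlux {H : ℝ → ℝ} {T m C K : ℝ} {ε : ℕ → ℝ}
    {ρ : ℕ → ℝ → FiniteMeasure Xi} {u v d : ℕ → ℝ → ℝ → ℝ} {d₀ W : ℝ × ℝ → ℝ} {F₀ : ℝ}
    (h : CurveSeq H T m C K ε ρ u v d d₀ W F₀) :
    WeakL2 (cyl T (-kappa H) (kappa H))
      (fun n => Function.uncurry (what H (ε n) (u n) (v n)))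
      (Function.uncurry fun t _ => limFlux H W t) := by
  have he : W =ᵐ[cyl T (-kappa H) (kappa H)] Function.uncurry fun t _ => limFlux H W t :=
    h.ae_limFlux_eq
  refine ⟨h.w_weak.1, h.w_weak.2.1.ae_eq he, fun φ hφ => ?_⟩
  have := h.w_weak.2.2 φ hφ
  have hi : ∫ z, W z * φ z ∂cyl T (-kappa H) (kappa H)
      = ∫ z, Function.uncurry (fun t _ => limFlux H W t) z * φ z ∂cyl T (-kappa H) (kappa H) :=
    integral_congr_ae (he.mul (EventuallyEq.refl _ φ))
  rwa [hi] at this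

/-- The derivative of the density at the right well is `1/κ` times the total flux, and the average
of the flux over `S`, of length `2κ`, is half of that. -/
lemma CurveSeq.ae_limFlux_eq_deriv {H : ℝ → ℝ} {T m C K : ℝ} {ε : ℕ → ℝ}
    {ρ : ℕ → ℝ → FiniteMeasure Xi} {u v d : ℕ → ℝ → ℝ → ℝ} {d₀ W : ℝ × ℝ → ℝ} {F₀ : ℝ}
    (h : CurveSeq H T m C K ε ρ u v d d₀ W F₀) :
    ∀ᵐ t ∂volume.restrict (Ioo 0 T), DifferentiableAt ℝ (fun r => limDensity H m W F₀ r 1) t ∧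
      limFlux H W t = 1 / 2 * deriv (fun r => limDensity H m W F₀ r 1) t := by
  have hk := (kappa_pos h.well).ne'
  filter_upwards [h.ae_hasDerivAt_limDensity 1] with t ht
  refine ⟨ht.differentiableAt, ?_⟩
  rw [ht.deriv, limFlux]
  field_simp

/-- The densities have slopes in `L²` with uniformly bounded norms, and a subsequence satisfies the
assumptions of the limit procedure. -/
lemma exists_curveSeq {H : ℝ → ℝ} (hH : DoubleWell H) {T m C : ℝ} (hT : 0 < T) (hm : 0 < m)
    (hC : 0 < C) {ε : ℕ → ℝ} (hε : ∀ n, 0 < ε n) (hε0 : Tendsto ε atTop (𝓝 0))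
    {ρ : ℕ → ℝ → FiniteMeasure Xi} {u v : ℕ → ℝ → ℝ → ℝ}
    (hu_meas : ∀ n, Measurable (Function.uncurry (u n)))
    (hu : ∀ n, ∀ t ∈ Icc 0 T, IsDensity (ρ n t : Measure Xi) (gam H (ε n)) (u n t))
    (hv : ∀ n, IsVelocity 0 T (ρ n) (v n))
    (hmass : ∀ n, ∀ t ∈ Icc 0 T, (ρ n t : Measure Xi) univ = ENNReal.ofReal m)
    (hJ : ∀ n, dissipation H (ε n) (ρ n) 0 T ≤ ENNReal.ofReal C)
    (hb : ∀ n, ∀ᵐ z ∂cyl T (-1) 1,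
      0 ≤ Function.uncurry (u n) z ∧ Function.uncurry (u n) z ≤ C) :
    ∃ d : ℕ → ℝ → ℝ → ℝ,
      (∀ n, MemLp (Function.uncurry (d n)) 2 (cyl T (-kappa H) (kappa H))) ∧
      (∀ n, ∀ᵐ t ∂volume.restrict (Ioo 0 T), ∃ k, ∀ᵐ ξ ∂volume.restrict (Ioo (-1) 1),
        u n t ξ = k + ∫ s in (-kappa H)..(shat H (ε n) ξ), d n t s) ∧
      ∃ (σ : ℕ → ℕ) (K F₀ : ℝ) (d₀ W : ℝ × ℝ → ℝ), StrictMono σ ∧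
        CurveSeq H T m C K (fun n => ε (σ n)) (fun n => ρ (σ n)) (fun n => u (σ n))
          (fun n => v (σ n)) (fun n => d (σ n)) d₀ W F₀ := by
  -- The extra `1` makes the bound strict, so that the infimum in the dissipation yields an actual
  -- competitor.
  set J : ℝ≥0∞ := ENNReal.ofReal C + 1 with hJd
  have hJt : J ≠ ⊤ := by simp [hJd]
  have hJ' : ∀ n, dissipation H (ε n) (ρ n) 0 T < J := fun n =>
    (hJ n).trans_lt (ENNReal.lt_add_right ENNReal.ofReal_ne_top one_ne_zero)
  choose p hp_meas hp_weak hp_v hp_s using fun n =>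
    exists_sqrt_deriv hH (hu_meas n) (hu n) (hv n) (hJ' n)
  set B : ℝ≥0∞ := (ENNReal.ofReal (2 * C) * J) ^ (1 / 2 : ℝ) with hB
  have hBt : B ≠ ⊤ :=
    ENNReal.rpow_ne_top_of_nonneg (by norm_num) (ENNReal.mul_ne_top ENNReal.ofReal_ne_top hJt)
  set d : ℕ → ℝ → ℝ → ℝ := fun n => slope H (ε n) (u n) (p n) with hd
  have hd_meas : ∀ n, Measurable (Function.uncurry (d n)) := fun n =>
    measurable_slope hH (hu_meas n) (hp_meas n)
  have hd_le : ∀ n, eLpNorm (Function.uncurry (d n)) 2 (cyl T (-kappa H) (kappa H)) ≤ B := fun n =>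
    eLpNorm_slope_le hH hC.le (hu_meas n) (hp_meas n) (hb n) (hp_s n)
  have hd_mem : ∀ n, MemLp (Function.uncurry (d n)) 2 (cyl T (-kappa H) (kappa H)) := fun n =>
    ⟨(hd_meas n).aestronglyMeasurable, (hd_le n).trans_lt hBt.lt_top⟩
  have hw_le : ∀ n, eLpNorm (Function.uncurry (what H (ε n) (u n) (v n))) 2
      (cyl T (-kappa H) (kappa H)) ≤ B := fun n =>
    eLpNorm_what_le hH hC.le (hu_meas n) (hv n).2.1 (hb n) (hp_v n)
  have hw_mem : ∀ n, MemLp (Function.uncurry (what H (ε n) (u n) (v n))) 2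
      (cyl T (-kappa H) (kappa H)) := fun n =>
    ⟨(measurable_what hH (hu_meas n) (hv n).2.1).aestronglyMeasurable,
      (hw_le n).trans_lt hBt.lt_top⟩
  have hmass' : ∀ n, ∀ t ∈ Icc 0 T, (ρ n t : Measure Xi).real univ = m := by
    intro n t ht
    rw [Measure.real, hmass n t ht, ENNReal.toReal_ofReal hm.le]
  have hd_rep := fun n => ae_eq_primitive_slope hH (hu_meas n) (hp_meas n) (hb n) (hp_weak n) hJt
    (hp_s n)
  -- Three successive extractions: slopes, then fluxes, then the initial means, which lie in a
  -- compact interval. Everything else converges along the composed subsequence.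
  obtain ⟨σ₁, d₀, hσ₁, hd₀, hw₁⟩ := exists_weakL2_subseq (fun n => Function.uncurry (d n)) hd_mem
    hBt hd_le
  obtain ⟨σ₂, W, hσ₂, hW, hw₂⟩ := exists_weakL2_subseq
    (fun n => Function.uncurry (what H (ε (σ₁ n)) (u (σ₁ n)) (v (σ₁ n)))) (fun n => hw_mem _)
    hBt (fun n => hw_le _)
  have hmean : ∀ n, ∫ x : Xi, shat H (ε n) x ∂(ρ n 0 : Measure Xi)
      ∈ Icc (-(kappa H * m)) (kappa H * m) := by
    intro n
    rw [mem_Icc, ← abs_le, ← Real.norm_eq_abs, ← hmass' n 0 (left_mem_Icc.2 hT.le)]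
    refine norm_integral_le_of_norm_le_const (Eventually.of_forall fun x => ?_)
    rw [Real.norm_eq_abs, abs_le]
    exact shat_mem hH (ε n) x.2
  obtain ⟨F₀, -, σ₃, hσ₃, hF₀⟩ := isCompact_Icc.tendsto_subseq fun n => hmean (σ₁ (σ₂ n))
  have hσ : StrictMono fun n => σ₁ (σ₂ (σ₃ n)) := hσ₁.comp (hσ₂.comp hσ₃)
  refine ⟨d, hd_mem, hd_rep, fun n => σ₁ (σ₂ (σ₃ n)), B.toReal ^ 2, F₀, d₀, W, hσ, ?_⟩
  exact
    { well := hH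
      T_pos := hT
      eps_pos := fun n => hε _
      eps_lim := hε0.comp hσ.tendsto_atTop
      u_meas := fun n => hu_meas _
      density := fun n => hu _
      velocity := fun n => hv _
      mass := fun n => hmass' _
      bounds := fun n => hb _
      d_meas := fun n => hd_meas _
      d_sq := fun n => integral_sq_le_of_eLpNorm_le (hd_mem _) hBt (hd_le _)
      d_rep := fun n => hd_rep _
      d_weak := hw₁.subseq (hσ₂.comp hσ₃)
      w_weak := hw₂.subseq hσ₃
      d₀_meas := hd₀.measurable
      W_meas := hW.measurable
      mean_lim := hF₀ }

end KramersLimit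

end

/-! ### The compactness theorem -/

theorem mainTheorem2
    {H : ℝ → ℝ} (hH : DoubleWell H) {T m C : ℝ} (hT : 0 < T) (hm : 0 < m) (hC : 0 < C)
    (ε : ℕ → ℝ) (hε : ∀ n, 0 < ε n) (hε0 : Tendsto ε atTop (𝓝 0))
    -- the curves `ρ_n ∈ C([0,T]; 𝓜(Ξ))`, their densities `u_n` and their velocities `v_n`
    (ρ : ℕ → ℝ → FiniteMeasure Xi) (u v : ℕ → ℝ → ℝ → ℝ)
    (hρ : ∀ n, ContinuousOn (ρ n) (Icc 0 T))
    (hu_meas : ∀ n, Measurable (Function.uncurry (u n)))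
    (hu : ∀ n, ∀ t ∈ Icc 0 T, IsDensity (ρ n t : Measure Xi) (gam H (ε n)) (u n t))
    (hv : ∀ n, IsVelocity 0 T (ρ n) (v n))
    -- the uniform estimates
    (hmass : ∀ n, ∀ t ∈ Icc 0 T, (ρ n t : Measure Xi) univ = ENNReal.ofReal m)
    (hE : ∀ n, freeEnergy H (ε n) (ρ n 0) ≤ (C : EReal))
    (hJ : ∀ n, dissipation H (ε n) (ρ n) 0 T ≤ ENNReal.ofReal C)
    (hu_bdd : ∀ n, eLpNorm (Function.uncurry (u n)) ∞ (cyl T (-1) 1) ≤ ENNReal.ofReal C) :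
    -- a subsequence and a limit `ρ₀ = u₀ γ₀ ∈ C([0,T]; 𝓜(Ξ))`
    ∃ (σ : ℕ → ℕ) (ρ₀ : ℝ → FiniteMeasure Xi) (u₀ : ℝ → ℝ → ℝ),
      StrictMono σ ∧ ContinuousOn ρ₀ (Icc 0 T) ∧
      (∀ t ∈ Icc 0 T, IsDensity (ρ₀ t : Measure Xi) gam0 (u₀ t)) ∧
      -- (1) weak-* convergence for every time
      (∀ t ∈ Icc 0 T, Tendsto (fun n => ρ (σ n) t) atTop (𝓝 (ρ₀ t))) ∧
      -- (2) the traces are well defined and converge strongly in `L¹(0,T)`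
      (∃ um up : ℕ → ℝ → ℝ,
        (∀ n, ∀ᵐ t ∂volume.restrict (Ioo 0 T), HasTraces (-1) 1 (u n t) (um n t) (up n t)) ∧
        StrongL1 (volume.restrict (Ioo 0 T)) (fun n => um (σ n)) (fun t => u₀ t (-1)) ∧
        StrongL1 (volume.restrict (Ioo 0 T)) (fun n => up (σ n)) (fun t => u₀ t 1)) ∧
      -- (3) convergence to the limit traces in `L¹(0,T; L^∞(-1,-δ))` and `L¹(0,T; L^∞(δ,1))`
      (∀ δ ∈ Ioo (0 : ℝ) 1,
        Tendsto (fun n => ∫⁻ t in Ioo 0 T,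
          eLpNorm (fun ξ => u (σ n) t ξ - u₀ t (-1)) ∞ (volume.restrict (Ioo (-1) (-δ))))
          atTop (𝓝 0) ∧
        Tendsto (fun n => ∫⁻ t in Ioo 0 T,
          eLpNorm (fun ξ => u (σ n) t ξ - u₀ t 1) ∞ (volume.restrict (Ioo δ 1)))
          atTop (𝓝 0)) ∧
      -- limits of the transformed quantities; `d n = ∂_s û_n` and `d₀ = ∂_s uhat₀`
      ∃ (uhat₀ what₀ d₀ : ℝ → ℝ → ℝ) (d : ℕ → ℝ → ℝ → ℝ) (ρhat₀ : ℝ → FiniteMeasure (S H)),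
        -- (4) weak convergences
        WeakStarLinfty (cyl T (-kappa H) (kappa H))
          (fun n => Function.uncurry (uhat H (ε (σ n)) (u (σ n)))) (Function.uncurry uhat₀) ∧
        (∀ n, IsL2W12 T (-kappa H) (kappa H) (uhat H (ε n) (u n)) (d n)) ∧
        IsL2W12 T (-kappa H) (kappa H) uhat₀ d₀ ∧
        WeakL2 (cyl T (-kappa H) (kappa H))
          (fun n => Function.uncurry (d (σ n))) (Function.uncurry d₀) ∧
        WeakL2 (cyl T (-kappa H) (kappa H))
          (fun n => Function.uncurry (what H (ε (σ n)) (u (σ n)) (v (σ n))))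
          (Function.uncurry what₀) ∧
        -- (5) identification of the traces of `uhat₀`
        (∀ᵐ t ∂volume.restrict (Ioo 0 T),
          HasTraces (-kappa H) (kappa H) (uhat₀ t) (u₀ t (-1)) (u₀ t 1)) ∧
        -- (6) weak-* convergence of the push-forwards for every time
        (∀ t ∈ Icc 0 T, (ρhat₀ t : Measure (S H)) = twoPoint H (u₀ t (-1)) (u₀ t 1)) ∧
        (∀ t ∈ Icc 0 T,
          Tendsto (fun n => (ρ (σ n) t).map (rescale hH (ε (σ n)))) atTop (𝓝 (ρhat₀ t))) ∧
        -- (7) `u₀⁺` is absolutely continuous, `what₀(t,·) = ½ u̇₀⁺(t)`, limit continuity equation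
        AbsolutelyContinuousOnInterval (fun t => u₀ t 1) 0 T ∧
        (∀ᵐ t ∂volume.restrict (Ioo 0 T), DifferentiableAt ℝ (fun r => u₀ r 1) t ∧
          ∀ᵐ s ∂volume.restrict (Ioo (-kappa H) (kappa H)),
            what₀ t s = 1 / 2 * deriv (fun r => u₀ r 1) t) ∧
        ContinuityEq 0 T ρhat₀ (fun _ => leb (S H)) what₀ := by
  have hb := fun n => ae_cyl_bounds hH hC.le (hu_meas n) (hu n) (hu_bdd n)
  obtain ⟨d, hd, hrep, σ, K, F₀, d₀, W, hσ, h⟩ :=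
    exists_curveSeq hH hT hm hC hε hε0 hu_meas hu hv hmass hJ hb
  refine ⟨σ, limCurve H m W F₀, limDensity H m W F₀, hσ, h.continuousOn_limCurve,
    fun t ht => h.isDensity_limCurve ht, fun t ht => h.tendsto_limCurve ht,
    ⟨fun n => traceLeft H (ε n) (u n) (d n), fun n => traceRight H (ε n) (u n) (d n),
      fun n => hasTraces_trace hH (hd n) (hrep n),
      strongL1_of_tendsto (fun n => integrable_traceLeft hH (h.u_meas n) (h.bounds n) (h.d_meas n)
        (h.d_weak.1 n)) (h.integrable_limDensity (-1)) h.tendsto_traceLeft,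
      strongL1_of_tendsto (fun n => integrable_traceRight hH (h.u_meas n) (h.bounds n) (h.d_meas n)
        (h.d_weak.1 n)) (h.integrable_limDensity 1) h.tendsto_traceRight⟩,
    fun δ hδ => ⟨h.tendsto_eLpNorm_left hδ, h.tendsto_eLpNorm_right hδ⟩,
    limUhat H m d₀ W F₀, fun t _ => limFlux H W t, fun t s => d₀ (t, s), d, limRescaled H m W F₀,
    h.weakStar_uhat, fun n => isL2W12_uhat hH (hu_meas n) (hb n) (hd n) (hrep n),
    h.isL2W12_limUhat, h.d_weak, h.weakL2_limFlux, h.hasTraces_limUhat, fun t _ => rfl,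
    fun t ht => h.tendsto_limRescaled ht, h.absolutelyContinuous_limDensity 1, ?_,
    h.continuityEq_limit⟩
  filter_upwards [h.ae_limFlux_eq_deriv] with t ht
  exact ⟨ht.1, Eventually.of_forall fun _ => ht.2⟩
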